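/- **Setting.** Let $\mathcal G$ be a finite connected bipartite graph, $V(\mathcal G)=B\cup W$, embedded in the sphere, with edge weights $\chi_e>0$ and a marked (outer) face $v_{\rm out}$ of degree $2n$. Let $\partial B\subset B$, $\partial W\subset W$ be the sets of vertices adjacent to $v_{\rm out}$; all other vertices and all other faces are called inner. Assume that * $\mathcal G$ admits a dimer cover (perfect matching) after removing any two vertices $b\in B$, $w\in W$; * every non-empty set $S\subset B\smallsetminus\partial B$ and every non-empty set $S\subset W\smallsetminus\partial W$ has at least $\#S+2$ neighbours in $\mathcal G$. Let $\mathcal G^*$ be the dual graph in which the vertex $v_{\rm out}$ is replaced by a cycle $v_1,\dots,v_{2n}$ (the boundary vertices, labelled counterclockwise, indices modulo $2n$), each $v_k$ being the end of one edge dual to an edge of $v_{\rm out}$; $v_{{\rm in},k}$ is the other end of this edge. The faces of $\mathcal G^*$ other than the outer one are the black and white vertices of $\mathcal G$. The edge $(bw)^*$ of $\mathcal G^*$ dual to $(bw)$ is oriented so that $b$ is on its right, and $df(vv'):=f(v')-f(v)$. Let $K$ be a real Kasteleyn matrix: $K(b,w)=\pm\chi_{(bw)}$ and the product of the signs around each inner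 face of degree $2m$ equals $(-1)^{m-1}$. Functions $\mathcal F^\bullet:B\to\mathbb C$, $\mathcal F^\circ:W\to\mathbb C$ form a *Coulomb gauge* if $[K^\top\mathcal F^\bullet](w)=0$ for $w\in W\smallsetminus\partial W$ and $[K\mathcal F^\circ](b)=0$ for $b\in B\smallsetminus\partial B$. It is *non-degenerate* if $\mathcal F^\bullet$ and $\mathcal F^\circ$ have no zeros, $[K^\top\mathcal F^\bullet](w)\ne0$ for $w\in\partial W$ and $[K\mathcal F^\circ](b)\neq 0$ for $b\in\partial B$. A *t-realisation* $\mathcal T:V(\mathcal G^*)\to\mathbb C$ and an *origami map* $\mathcal O:V(\mathcal G^*)\to\mathbb C$ of the gauge are functions such that $$d\mathcal T(bw^*)=\mathcal F^\bullet(b)K(b,w)\mathcal F^\circ(w),\qquad d\mathcal O(bw^*)=\mathcal F^\bullet(b)K(b,w)\overline{\mathcal F^\circ(w)};$$ each is defined up to an additive constant. $\mathcal T$ is a *perfect t-embedding* if (a) it is a proper orientation preserving embedding of $\mathcal G^*$ with straight edges: distinct vertices have distinct images, edges meet only at common endpoints, all faces except the outer one are non-degenerate convex polygons with disjoint interiors;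 (b) the edge lengths are gauge equivalent to the weights: $|d\mathcal T(bw^*)|=g^\bullet(b)\chi_{(bw)}g^\circ(w)$ with positive $g^\bullet,g^\circ$; (c) at each inner vertex of $\mathcal G^*$ the angles of the adjacent black faces sum up to $\pi$; (d) the outer face is a (possibly non-convex) tangential polygon to the unit circle, that is, the lines containing its sides are tangent to the circle and the bisectors of its interior angles pass through the origin; and the edges $(v_{{\rm in},k}v_k)$ lie on the bisectors of these angles. **Theorem.** A non-degenerate Coulomb gauge $(\mathcal F^\bullet,\mathcal F^\circ)$ defines a perfect t-embedding (for some choice of the additive constant in $\mathcal T$) if and only if one can choose $\lambda\in\mathbb C\smallsetminus\{0\}$ and the additive constants of integration so that the functions $\mathcal T,\mathcal O$ defined by $(\lambda\mathcal F^\bullet,\lambda^{-1}\mathcal F^\circ)$ satisfy 1. $|\mathcal T(v_k)|^2-|\mathcal O(v_k)|^2=1$ and $\operatorname{Im}\mathcal O(v_k)=0$ for all $k$; 2. $\pm\operatorname{Im}\big[(\mathcal T(v_{k\pm1})-\mathcal T(v_k))\cdot\overline{d\mathcal T((v_{{\rm in},k}v_k))}\,\big]>0$ for all $k$ and both signs $\pm$;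 3. the polyline $\mathcal T(v_1)\mathcal T(v_2)\dots\mathcal T(v_{2n})\mathcal T(v_1)$ does not pass through the origin and its index with respect to the origin is $1$. Moreover, whenever $\mathcal T$ and $\mathcal O$ satisfy 1–3 (for some $\lambda$ and some constants), this $\mathcal T$ is a perfect t-embedding; in particular, it is a proper embedding of $\mathcal G^*$. -/

import Mathlib

open scoped ComplexConjugate

noncomputable section

/-- A finite bipartite graph with the topology of the sphere (a connected bipartite map of genus
zero) with a marked face, encoded by its rotation system.  `E` is the set of edges; each edge joins
a black vertex to a white one.  The map `σ` sends an edge to the next edge in the counterclockwise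
order around its black endpoint, and `τ` does the same around its white endpoint.  Hence black
vertices are the cycles of `σ`, white vertices are the cycles of `τ`, and faces are the cycles of
`τ * σ`: the face on the left of an edge `e` (directed from black to white) is the cycle of `e`,
the face on its right is the cycle of `τ e` (equivalently, of `σ⁻¹ e`). -/
structure MarkedBipartiteMap (E : Type*) [Fintype E] where
  σ : Equiv.Perm E
  τ : Equiv.Perm E
  /-- the graph is connected -/
  connected : ∀ e e' : E, ∃ g ∈ Subgroup.closure {σ, τ}, g e = e'
  /-- Euler's formula for the sphere: `#B + #W + #faces = #E + 2` -/
  euler : Nat.card (Quotient (Equiv.Perm.SameCycle.setoid σ))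
      + Nat.card (Quotient (Equiv.Perm.SameCycle.setoid τ))
      + Nat.card (Quotient (Equiv.Perm.SameCycle.setoid (τ * σ))) = Nat.card E + 2
  /-- the marked (outer) face -/
  out : Quotient (Equiv.Perm.SameCycle.setoid (τ * σ))

namespace MarkedBipartiteMap

variable {E : Type*} [Fintype E] (M : MarkedBipartiteMap E)

/-! ### The graph -/

/-- Black vertices. -/
abbrev Black : Type _ := Quotient (Equiv.Perm.SameCycle.setoid M.σ)

/-- White vertices. -/
abbrev White : Type _ := Quotient (Equiv.Perm.SameCycle.setoid M.τ)

/-- Faces. -/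
abbrev Face : Type _ := Quotient (Equiv.Perm.SameCycle.setoid (M.τ * M.σ))

/-- The black endpoint of an edge. -/
def black (e : E) : M.Black := Quotient.mk _ e

/-- The white endpoint of an edge. -/
def white (e : E) : M.White := Quotient.mk _ e

/-- `(e, false)` is the left side of the edge `e`, directed from its black to its white endpoint,
and `(e, true)` is its right side; `M.face` is the face adjacent to the given side. -/
def face : E × Bool → M.Face
  | (e, false) => Quotient.mk _ e
  | (e, true) => Quotient.mk _ (M.τ e)

/-- The next side of an edge along the boundary of the same face.  When applied to the sides
adjacent to the outer face it enumerates them counterclockwise, as seen from the inner faces. -/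
def next : E × Bool → E × Bool
  | (e, false) => (M.σ e, true)
  | (e, true) => (M.τ e, false)

/-- The inverse of `next`. -/
def prev : E × Bool → E × Bool
  | (e, true) => (M.σ.symm e, false)
  | (e, false) => (M.τ.symm e, true)

/-- The other side of the same edge. -/
def opp (_M : MarkedBipartiteMap E) (d : E × Bool) : E × Bool := (d.1, !d.2)

theorem prev_next (d : E × Bool) : M.prev (M.next d) = d := by
  rcases d with ⟨e, _ | _⟩ <;> simp [next, prev]

theorem next_prev (d : E × Bool) : M.next (M.prev d) = d := by
  rcases d with ⟨e, _ | _⟩ <;> simp [next, prev]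

theorem face_next (d : E × Bool) : M.face (M.next d) = M.face d := by
  rcases d with ⟨e, _ | _⟩
  · exact Quotient.sound ((Equiv.Perm.sameCycle_apply_left (f := M.τ * M.σ)).2
      (Equiv.Perm.SameCycle.refl _ _))
  · rfl

/-- Boundary black vertices: those adjacent to the outer face.  (The face in the corner of the
black vertex between the edges `e` and `σ e` is the face on the left of `e`.) -/
def IsBoundaryBlack (b : M.Black) : Prop := ∃ e, M.black e = b ∧ M.face (e, false) = M.out

/-- Boundary white vertices.  (The face in the corner of the white vertex between the edges `e` and
`τ e` is the face on the right of `e`.) -/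
def IsBoundaryWhite (w : M.White) : Prop := ∃ e, M.white e = w ∧ M.face (e, true) = M.out

/-- For all `b` and `w` the graph admits a dimer cover (perfect matching) after removing `b`
and `w`. -/
def HasDimerCovers : Prop :=
  ∀ (b : M.Black) (w : M.White), ∃ D : Set E,
    (∀ e ∈ D, M.black e ≠ b ∧ M.white e ≠ w) ∧
    (∀ b', b' ≠ b → ∃! e, e ∈ D ∧ M.black e = b') ∧
    (∀ w', w' ≠ w → ∃! e, e ∈ D ∧ M.white e = w')

/-- Every non-empty set `S` of inner vertices of one colour has at least `#S + 2` neighbours. -/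
def IsSpread : Prop :=
  (∀ S : Set M.Black, S.Nonempty → (∀ b ∈ S, ¬ M.IsBoundaryBlack b) →
    S.ncard + 2 ≤ {w | ∃ e, M.black e ∈ S ∧ M.white e = w}.ncard) ∧
  (∀ S : Set M.White, S.Nonempty → (∀ w ∈ S, ¬ M.IsBoundaryWhite w) →
    S.ncard + 2 ≤ {b | ∃ e, M.white e ∈ S ∧ M.black e = b}.ncard)

/-! ### Kasteleyn matrices and Coulomb gauges -/

open Classical in
/-- `K` is a real Kasteleyn matrix for the edge weights `χ`: one has `K e = ± χ e`, and around each
inner face of degree `2m` the product of the signs is `(-1) ^ (m - 1)`.  (The boundary of a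
face `f` consists of the edges `e` and `σ e`, where `e` runs over the edges with `f` on the left.) -/
def IsKasteleyn (χ K : E → ℝ) : Prop :=
  (∀ e, |K e| = χ e) ∧
  ∀ f : M.Face, f ≠ M.out →
    ∏ e : E with M.face (e, false) = f, (Real.sign (K e) * Real.sign (K (M.σ e)))
      = (-1) ^ ((Finset.univ.filter fun e : E => M.face (e, false) = f).card - 1)

open Classical in
/-- `[Kᵀ Fb](w)`. -/
def applyTranspose (K : E → ℝ) (Fb : M.Black → ℂ) (w : M.White) : ℂ :=
  ∑ e : E with M.white e = w, (K e : ℂ) * Fb (M.black e)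

open Classical in
/-- `[K Fw](b)`. -/
def applyMatrix (K : E → ℝ) (Fw : M.White → ℂ) (b : M.Black) : ℂ :=
  ∑ e : E with M.black e = b, (K e : ℂ) * Fw (M.white e)

/-- Coulomb gauge functions. -/
def IsCoulombGauge (K : E → ℝ) (Fb : M.Black → ℂ) (Fw : M.White → ℂ) : Prop :=
  (∀ w, ¬ M.IsBoundaryWhite w → M.applyTranspose K Fb w = 0) ∧
  (∀ b, ¬ M.IsBoundaryBlack b → M.applyMatrix K Fw b = 0)

/-- Non-degenerate gauge functions. -/
def IsNondegenerate (K : E → ℝ) (Fb : M.Black → ℂ) (Fw : M.White → ℂ) : Prop :=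
  (∀ b, Fb b ≠ 0) ∧ (∀ w, M.IsBoundaryWhite w → M.applyTranspose K Fb w ≠ 0) ∧
  (∀ w, Fw w ≠ 0) ∧ (∀ b, M.IsBoundaryBlack b → M.applyMatrix K Fw b ≠ 0)

/-! ### The dual graph, augmented at the outer face -/

/-- Vertices of the augmented dual: inner faces, and one boundary vertex for each side of an edge
adjacent to the outer face. -/
def DualVertex : Type _ := {f : M.Face // f ≠ M.out} ⊕ {d : E × Bool // M.face d = M.out}

open Classical in
/-- The vertex of the augmented dual which lies at the given side of an edge. -/
def vtx (d : E × Bool) : M.DualVertex :=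
  if h : M.face d = M.out then Sum.inr ⟨d, h⟩ else Sum.inl ⟨M.face d, h⟩

/-- Edges of the augmented dual: the dual edges, and the edges of the boundary cycle. -/
def DualEdge : Type _ := E ⊕ {d : E × Bool // M.face d = M.out}

/-- The endpoints of an edge of the augmented dual. -/
def ends : M.DualEdge → M.DualVertex × M.DualVertex
  | Sum.inl e => (M.vtx (e, false), M.vtx (e, true))
  | Sum.inr d => (M.vtx d.1, M.vtx (M.next d.1))

/-- Faces of the augmented dual other than the outer one: black and white vertices of the graph. -/
abbrev DualFace : Type _ := M.Black ⊕ M.White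

/-- The set of vertices of a face of the augmented dual. -/
def faceVertices : M.DualFace → Set M.DualVertex
  | Sum.inl b => {v | ∃ e s, M.black e = b ∧ v = M.vtx (e, s)}
  | Sum.inr w => {v | ∃ e s, M.white e = w ∧ v = M.vtx (e, s)}

/-- The sides of a face of the augmented dual, directed counterclockwise: the dual edges of the
edges `e` at the given vertex of the graph, and the edges of the boundary cycle (if any).  In an
inner corner `vtx (next d) = vtx d`, and the corresponding pair is a trivial one. -/
def faceSides : M.DualFace → Set (M.DualVertex × M.DualVertex)
  | Sum.inl b => {p | ∃ e, M.black e = b ∧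
      (p = (M.vtx (e, true), M.vtx (e, false)) ∨
        p = (M.vtx (e, false), M.vtx (M.next (e, false))))}
  | Sum.inr w => {p | ∃ e, M.white e = w ∧
      (p = (M.vtx (e, false), M.vtx (e, true)) ∨
        p = (M.vtx (e, true), M.vtx (M.next (e, true))))}

/-! ### t-realisations and perfect t-embeddings -/

/-- `T` is a t-realisation defined by the gauge functions: `dT(bw*) = Fb(b) K(b,w) Fw(w)`, where the
dual edge `bw*` is oriented so that `b` is on its right, i.e. it goes from the face on the
left of the edge (directed from `b` to `w`) to the face on its right. -/
def IsTRealisation (K : E → ℝ) (Fb : M.Black → ℂ) (Fw : M.White → ℂ)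
    (T : M.DualVertex → ℂ) : Prop :=
  ∀ e : E, T (M.vtx (e, true)) - T (M.vtx (e, false))
    = Fb (M.black e) * (K e : ℂ) * Fw (M.white e)

/-- `O` is an associated origami map: `dO(bw*) = Fb(b) K(b,w) conj (Fw(w))`. -/
def IsOrigami (K : E → ℝ) (Fb : M.Black → ℂ) (Fw : M.White → ℂ)
    (O : M.DualVertex → ℂ) : Prop :=
  ∀ e : E, O (M.vtx (e, true)) - O (M.vtx (e, false))
    = Fb (M.black e) * (K e : ℂ) * conj (Fw (M.white e))

/-- The image of a face is a non-degenerate convex polygon, traversed counterclockwise: all its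
vertices lie on the left of (or on) the line containing each side, and they are not
all collinear. -/
def IsConvexFace (T : M.DualVertex → ℂ) (f : M.DualFace) : Prop :=
  (∀ p ∈ M.faceSides f, ∀ x ∈ M.faceVertices f,
    0 ≤ (conj (T p.2 - T p.1) * (T x - T p.1)).im) ∧
  (∃ p ∈ M.faceSides f, ∃ x ∈ M.faceVertices f,
    0 < (conj (T p.2 - T p.1) * (T x - T p.1)).im)

/-- Proper (orientation preserving) embeddings of the augmented dual with straight edges: distinct
vertices have distinct images, edges may only meet at their common endpoints, and all faces other
than the outer one are non-overlapping convex polygons. -/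
def IsProperEmbedding (T : M.DualVertex → ℂ) : Prop :=
  Function.Injective T ∧
  (∀ ε ε' : M.DualEdge, ε ≠ ε' →
    segment ℝ (T (M.ends ε).1) (T (M.ends ε).2) ∩ segment ℝ (T (M.ends ε').1) (T (M.ends ε').2)
      ⊆ T '' ({(M.ends ε).1, (M.ends ε).2} ∩ {(M.ends ε').1, (M.ends ε').2})) ∧
  (∀ f : M.DualFace, M.IsConvexFace T f) ∧
  (∀ f f' : M.DualFace, f ≠ f' →
    Disjoint (interior (convexHull ℝ (T '' M.faceVertices f)))
      (interior (convexHull ℝ (T '' M.faceVertices f'))))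

open Classical in
/-- At each inner vertex of the dual graph the angles of the adjacent black faces sum up to `π`.
(The black faces at the vertex `f` correspond to the edges `e` with `f` on the left; the corner of
such a face at `f` is bounded by the edges dual to `e` and `σ e`.) -/
def AngleCondition (T : M.DualVertex → ℂ) : Prop :=
  ∀ f : M.Face, f ≠ M.out →
    ∑ e : E with M.face (e, false) = f,
      EuclideanGeometry.angle (T (M.vtx (e, true))) (T (M.vtx (e, false)))
        (T (M.vtx (M.σ e, false))) = Real.pi

/-- Finite t-embeddings. -/
def IsTEmbedding (T : M.DualVertex → ℂ) : Prop := M.IsProperEmbedding T ∧ M.AngleCondition T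

/-- The edge lengths are gauge equivalent to the weights `χ`. -/
def HasGaugeEquivalentLengths (χ : E → ℝ) (T : M.DualVertex → ℂ) : Prop :=
  ∃ (gb : M.Black → ℝ) (gw : M.White → ℝ), (∀ b, 0 < gb b) ∧ (∀ w, 0 < gw w) ∧
    ∀ e : E, ‖T (M.vtx (e, true)) - T (M.vtx (e, false))‖ = gb (M.black e) * χ e * gw (M.white e)

/-- The point `x ≠ v` lies on the bisector of the angle at the vertex `v` of a counterclockwise
polygon `… p, v, q, …`: the interior angle at `v` is the one swept when rotating `q - v`
counterclockwise to `p - v`, and `x - v` divides it into two equal parts. -/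
def _root_.OnBisector (p v q x : ℂ) : Prop :=
  0 < Complex.arg ((x - v) / (q - v)) ∧ Complex.arg ((x - v) / (q - v)) < Real.pi ∧
    Complex.arg ((p - v) / (x - v)) = Complex.arg ((x - v) / (q - v))

/-- The outer face is a (possibly, non-convex) tangential polygon to the unit circle: all lines
containing its sides are tangent to the unit circle, and the bisectors of its angles pass through
the centre of this circle. -/
def IsTangential (T : M.DualVertex → ℂ) : Prop :=
  ∀ d : E × Bool, M.face d = M.out →
    Metric.infDist (0 : ℂ) (line[ℝ, T (M.vtx d), T (M.vtx (M.next d))] : Set ℂ) = 1 ∧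
    OnBisector (T (M.vtx (M.prev d))) (T (M.vtx d)) (T (M.vtx (M.next d))) 0

/-- All non-boundary edges emanating from boundary vertices are bisectors of the angles of the
boundary polygon. -/
def BisectorCondition (T : M.DualVertex → ℂ) : Prop :=
  ∀ d : E × Bool, M.face d = M.out →
    OnBisector (T (M.vtx (M.prev d))) (T (M.vtx d)) (T (M.vtx (M.next d)))
      (T (M.vtx (M.opp d)))

/-- Perfect t-embeddings of the dual of the weighted graph. -/
def IsPerfectTEmbedding (χ : E → ℝ) (T : M.DualVertex → ℂ) : Prop :=
  M.IsTEmbedding T ∧ M.HasGaugeEquivalentLengths χ T ∧ M.IsTangential T ∧ M.BisectorCondition T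

/-! ### The conditions at the boundary -/

/-- The points `(T(v), O(v))`, where `v` is a boundary vertex, lie on the hyperboloid. -/
def BoundaryOnHyperboloid (T O : M.DualVertex → ℂ) : Prop :=
  ∀ d : E × Bool, M.face d = M.out →
    ‖T (M.vtx d)‖ ^ 2 - ‖O (M.vtx d)‖ ^ 2 = 1 ∧ (O (M.vtx d)).im = 0

/-- The local orientation inequalities at boundary vertices.  (The inner neighbour of the boundary
vertex `vtx d` is `vtx (opp d)`.) -/
def BoundaryOriented (T : M.DualVertex → ℂ) : Prop :=
  ∀ d : E × Bool, M.face d = M.out →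
    0 < ((T (M.vtx (M.next d)) - T (M.vtx d)) *
      conj (T (M.vtx d) - T (M.vtx (M.opp d)))).im ∧
    0 < -((T (M.vtx (M.prev d)) - T (M.vtx d)) *
      conj (T (M.vtx d) - T (M.vtx (M.opp d)))).im

open Classical in
/-- The closed boundary polyline does not pass through the origin, and its index with respect to
the origin, i.e. the total increment of the argument divided by `2π`, equals one. -/
def BoundaryIndexOne (T : M.DualVertex → ℂ) : Prop :=
  (∀ d : E × Bool, M.face d = M.out →
    (0 : ℂ) ∉ segment ℝ (T (M.vtx d)) (T (M.vtx (M.next d)))) ∧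
  (∑ d : E × Bool with M.face d = M.out,
    Complex.arg (T (M.vtx (M.next d)) / T (M.vtx d))) / (2 * Real.pi) = 1

end MarkedBipartiteMap

end

/-! The proof rests on an angle count without slack, and on the geometry of the quadratic form `|T|²
- |O|²` along the boundary.

From conditions 1–3 to a perfect t-embedding. The Kasteleyn signs make the ratios of consecutive
sides at the corners of one colour around an inner vertex of the dual multiply to a negative number,
so the absolute values of these angles sum to at least π (`pi_le_sum_abs_arg`). Every closed polygon
has total absolute turning at least 2π (`two_pi_le_sum_abs_turn`). Along the boundary `O` is real
and the increments of `(T, O)` are null vectors joining points of a hyperboloid. With the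
orientation inequalities this forces the edges at boundary vertices to be radial
(`im_eq_zero_of_hyperboloid`), and index one then makes the boundary star-shaped around the origin
(`isRadial_and_isStar`), so the angles next to the boundary are those of triangles with apex at the
origin. Adding all exterior and interior angles, Euler's formula turns every lower bound into an
equality (`angle_sums_eq`). Thus a face turns always left, or always right, or is contained in a
line. A cluster of flat faces would have too few neighbours (`not_isFlat_of_spread`), and the
orientation propagates from the boundary through the vertices of the dual
(`isLocallyConvex_of_angle_sums`).

Local convexity becomes an embedding by comparing winding angles. The angles at which the faces are
seen from a point add up to the angle at which the boundary is seen, which is at most 2π. The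
corners at a vertex, or the two sides of an edge, already use up this amount, so nothing else can
pass through the same point (`IsLocallyConvex.isProperEmbedding`).

From a perfect t-embedding to conditions 1–3. The bisector condition makes the boundary increments
of `O` parallel with alternating directions (`outer_origami_alternate`). Their lengths are those of
the boundary sides, so after a rotation and a shift `O` equals, up to an alternating sign, the
tangent length to the unit circle; Pythagoras gives the hyperboloid (`exists_hyperboloid`). The
rotation of `O` is realised by rescaling the gauge by a square root of the rotation factor. The
index comes from counting the angles of black faces only, with equally many black and white vertices
(`two_mul_sum_half_angles`).

Planarity enters through Euler's formula, in the linear form `exists_potential`: edge functions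
orthogonal to all gradients are sums of vertex stars. This yields the origami map
(`exists_primitive`) and, with the dimer covers, the fact that a face of the map has at most one
corner at each vertex (`HasDimerCovers.corner_unique`). -/

namespace PlanarPolygon

open Complex Finset

/-! ### Arguments of products of complex numbers. -/

theorem abs_arg_neg {r : ℂ} (hr : r ≠ 0) : |arg (-r)| = Real.pi - |arg r| := by
  have h1 := Complex.angle_eq_abs_arg (x := r) (y := 1) hr one_ne_zero
  have h2 := Complex.angle_eq_abs_arg (x := -r) (y := 1) (neg_ne_zero.2 hr) one_ne_zero
  rw [div_one] at h1 h2
  rw [← h1, ← h2, InnerProductGeometry.angle_neg_left]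

theorem abs_arg_neg_inv {r : ℂ} (hr : r ≠ 0) : |arg (-r⁻¹)| = Real.pi - |arg r| := by
  rw [abs_arg_neg (inv_ne_zero hr), Complex.abs_arg_inv]

theorem coe_sum_arg {ι : Type*} (s : Finset ι) (r : ι → ℂ) (hr : ∀ i ∈ s, r i ≠ 0) :
    ((∑ i ∈ s, arg (r i) : ℝ) : Real.Angle) = (arg (∏ i ∈ s, r i) : Real.Angle) := by
  classical
  induction s using Finset.induction_on with
  | empty => simp
  | insert a s ha ih =>
    rw [Finset.sum_insert ha, Finset.prod_insert ha, Real.Angle.coe_add,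
      ih fun i hi => hr i (mem_insert_of_mem hi),
      Complex.arg_mul_coe_angle (hr a (mem_insert_self a s))
        (Finset.prod_ne_zero_iff.2 fun i hi => hr i (mem_insert_of_mem hi))]

theorem exists_sum_arg_eq {ι : Type*} (s : Finset ι) (r : ι → ℂ) (hr : ∀ i ∈ s, r i ≠ 0) :
    ∃ k : ℤ, ∑ i ∈ s, arg (r i) = arg (∏ i ∈ s, r i) + 2 * Real.pi * k := by
  obtain ⟨k, hk⟩ := Real.Angle.angle_eq_iff_two_pi_dvd_sub.1 (coe_sum_arg s r hr)
  exact ⟨k, by linarith⟩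

theorem pi_le_abs_odd (k : ℤ) : Real.pi ≤ |Real.pi + 2 * Real.pi * k| := by
  have hpi := Real.pi_pos
  rcases le_or_gt 0 k with hk | hk
  · have : (0 : ℝ) ≤ k := by exact_mod_cast hk
    rw [abs_of_nonneg (by positivity)]
    nlinarith
  · have : (k : ℝ) ≤ -1 := by exact_mod_cast (by omega : k ≤ -1)
    rw [abs_of_nonpos (by nlinarith)]
    nlinarith

/-- A negative product makes the sum of the arguments an odd multiple of π. Applied to the corners
of one colour at an inner vertex of the dual, this is the lower bound in the angle count. -/
theorem pi_le_sum_abs_arg {ι : Type*} (s : Finset ι) (r : ι → ℂ) (hr : ∀ i ∈ s, r i ≠ 0)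
    (h : arg (∏ i ∈ s, r i) = Real.pi) : Real.pi ≤ ∑ i ∈ s, |arg (r i)| := by
  obtain ⟨k, hk⟩ := exists_sum_arg_eq s r hr
  rw [h] at hk
  calc Real.pi ≤ |Real.pi + 2 * Real.pi * k| := pi_le_abs_odd k
    _ = |∑ i ∈ s, arg (r i)| := by rw [hk]
    _ ≤ _ := Finset.abs_sum_le_sum_abs _ _

theorem nonneg_of_sum_eq_sum_abs {ι : Type*} (s : Finset ι) (f : ι → ℝ)
    (h : ∑ i ∈ s, f i = ∑ i ∈ s, |f i|) : ∀ i ∈ s, 0 ≤ f i := by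
  intro i hi
  have := (Finset.sum_eq_sum_iff_of_le (f := f) (g := fun i => |f i|)
    (fun i _ => le_abs_self (f i))).1 h i hi
  rw [this]; exact abs_nonneg _

theorem nonpos_of_sum_eq_neg_sum_abs {ι : Type*} (s : Finset ι) (f : ι → ℝ)
    (h : ∑ i ∈ s, f i = -∑ i ∈ s, |f i|) : ∀ i ∈ s, f i ≤ 0 := by
  intro i hi
  have := nonneg_of_sum_eq_sum_abs s (fun i => -f i) (by simp [h]) i hi
  linarith

/-- In the equality case the sum itself is π or -π, so there is no cancellation between positive and
negative arguments. -/
theorem same_sign_of_sum_abs_arg_eq_pi {ι : Type*} (s : Finset ι) (r : ι → ℂ)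
    (hr : ∀ i ∈ s, r i ≠ 0) (h : arg (∏ i ∈ s, r i) = Real.pi)
    (hs : ∑ i ∈ s, |arg (r i)| = Real.pi) :
    (∀ i ∈ s, 0 ≤ arg (r i)) ∨ (∀ i ∈ s, arg (r i) ≤ 0) := by
  obtain ⟨k, hk⟩ := exists_sum_arg_eq s r hr
  rw [h] at hk
  have hpi := Real.pi_pos
  have hle : |Real.pi + 2 * Real.pi * k| ≤ Real.pi := by
    rw [← hk, ← hs]; exact Finset.abs_sum_le_sum_abs _ _
  rw [abs_le] at hle
  have h1 : (k : ℝ) ≤ 0 := by nlinarith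
  have h2 : (-1 : ℝ) ≤ k := by nlinarith
  have h1' : k ≤ 0 := by exact_mod_cast h1
  have h2' : -1 ≤ k := by exact_mod_cast h2
  have : k = 0 ∨ k = -1 := by omega
  rcases this with rfl | rfl
  · exact Or.inl (nonneg_of_sum_eq_sum_abs s _ (by rw [hk, hs]; simp))
  · exact Or.inr (nonpos_of_sum_eq_neg_sum_abs s _ (by rw [hk, hs]; push_cast; ring))

/-! ### Closed polygons given by their sides -/

/-- The exterior angle between two consecutive sides. -/
noncomputable def turn (z : ℕ → ℂ) (i : ℕ) : ℝ := arg (z (i + 1) / z i)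

/-- The direction of a side relative to the initial one, continued along the polygon. -/
noncomputable def dir (z : ℕ → ℂ) (i : ℕ) : ℝ := ∑ j ∈ range i, turn z j

@[simp] theorem dir_zero (z : ℕ → ℂ) : dir z 0 = 0 := by simp [dir]

theorem dir_succ (z : ℕ → ℂ) (i : ℕ) : dir z (i + 1) = dir z i + turn z i :=
  Finset.sum_range_succ _ _

variable {z : ℕ → ℂ} {n : ℕ}

/-- The accumulated turning is a real lift of the direction of the side; half-plane arguments
thereby become estimates of `dir` on an interval. -/
theorem eq_mul_exp_dir (hz : ∀ i, z i ≠ 0) (i : ℕ) :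
    z i = z 0 / ‖z 0‖ * (‖z i‖ * exp (dir z i * I)) := by
  have hn : ∀ i, (‖z i‖ : ℂ) ≠ 0 := fun i => by simpa using hz i
  induction i with
  | zero => have := hn 0; simp; field_simp
  | succ i ih =>
    have h1 : z (i + 1) / z i = ‖z (i + 1) / z i‖ * exp (turn z i * I) :=
      (Complex.norm_mul_exp_arg_mul_I _).symm
    rw [div_eq_iff (hz i), norm_div] at h1
    have h2 : z i / ‖z i‖ = z 0 / ‖z 0‖ * exp (dir z i * I) := by
      rw [div_eq_iff (hn i)]; linear_combination ih
    rw [dir_succ, ofReal_add, add_mul, Complex.exp_add]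
    push_cast at h1
    linear_combination h1 + ‖z (i + 1)‖ * exp (turn z i * I) * h2

theorem conj_mul_side (hz : ∀ i, z i ≠ 0) (i j : ℕ) :
    conj (z j) * z i = (‖z j‖ * ‖z i‖ : ℝ) * exp ((dir z i - dir z j : ℝ) * I) := by
  have h0 : (‖z 0‖ : ℂ) ≠ 0 := by simpa using hz 0
  have h1 : conj (z 0 / ‖z 0‖) * (z 0 / ‖z 0‖) = 1 := by
    rw [mul_comm, Complex.mul_conj, Complex.normSq_eq_norm_sq]; simp [hz 0]
  rw [eq_mul_exp_dir hz i, eq_mul_exp_dir hz j]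
  have h2 : exp ((dir z i - dir z j : ℝ) * I) = conj (exp (dir z j * I)) * exp (dir z i * I) := by
    rw [← Complex.exp_conj, ← Complex.exp_add]
    congr 1; simp only [map_mul, conj_ofReal, conj_I]; push_cast; ring
  have h3 : ∀ k, ‖z 0 / ‖z 0‖ * (‖z k‖ * exp (dir z k * I))‖ = ‖z k‖ := fun k => by
    rw [← eq_mul_exp_dir hz k]
  rw [h3, h3, h2, map_mul, map_mul, conj_ofReal]
  push_cast
  linear_combination (‖z j‖ * conj (exp (dir z j * I)) * ‖z i‖ * exp (dir z i * I)) * h1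

theorem im_conj_mul_side (hz : ∀ i, z i ≠ 0) (i j : ℕ) :
    (conj (z j) * z i).im = ‖z j‖ * ‖z i‖ * Real.sin (dir z i - dir z j) := by
  rw [conj_mul_side hz, Complex.im_ofReal_mul, Complex.exp_ofReal_mul_I_im]

/-- A vanishing linear combination of sides also vanishes in every projection. -/
theorem sum_sin_eq_zero (hz : ∀ i, z i ≠ 0) (s : Finset ℕ) (c : ℕ → ℝ)
    (h : ∑ i ∈ s, (c i : ℂ) * z i = 0) (m : ℝ) :
    ∑ i ∈ s, c i * (‖z i‖ * Real.sin (dir z i - m)) = 0 := by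
  have h0 : z 0 / ‖z 0‖ ≠ 0 := div_ne_zero (hz 0) (by simpa using hz 0)
  have h1 : ∑ i ∈ s, (c i : ℂ) * (‖z i‖ * exp ((dir z i - m : ℝ) * I)) = 0 := by
    have : (z 0 / ‖z 0‖ * exp (m * I)) *
        ∑ i ∈ s, (c i : ℂ) * (‖z i‖ * exp ((dir z i - m : ℝ) * I)) = 0 := by
      rw [← h, Finset.mul_sum]
      refine Finset.sum_congr rfl fun i _ => ?_
      conv_rhs => rw [eq_mul_exp_dir hz i]
      have : exp (dir z i * I) = exp (m * I) * exp ((dir z i - m : ℝ) * I) := by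
        rw [← Complex.exp_add]; congr 1; push_cast; ring
      rw [this]; ring
    exact (mul_eq_zero.1 this).resolve_left (mul_ne_zero h0 (Complex.exp_ne_zero _))
  have h2 := congrArg Complex.im h1
  rw [Complex.im_sum] at h2
  simpa only [Complex.im_ofReal_mul, Complex.exp_ofReal_mul_I_im, Complex.zero_im] using h2

theorem sum_norm_mul_sin_eq_zero (hz : ∀ i, z i ≠ 0) (h : ∑ i ∈ range n, z i = 0) (m : ℝ) :
    ∑ i ∈ range n, ‖z i‖ * Real.sin (dir z i - m) = 0 := by
  simpa using sum_sin_eq_zero hz (range n) (fun _ => 1) (by simpa using h) m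

theorem exists_dir_eq (hz : ∀ i, z i ≠ 0) (hn : z n = z 0) : ∃ k : ℤ, dir z n = 2 * Real.pi * k := by
  have h := conj_mul_side hz n 0
  rw [hn, mul_comm, Complex.mul_conj, Complex.normSq_eq_norm_sq] at h
  have h0 : ((‖z 0‖ * ‖z 0‖ : ℝ) : ℂ) ≠ 0 := by
    have := norm_ne_zero_iff.2 (hz 0)
    exact_mod_cast mul_ne_zero this this
  rw [sq, eq_comm, mul_eq_left₀ h0, Complex.exp_eq_one_iff] at h
  obtain ⟨k, hk⟩ := h
  refine ⟨k, ?_⟩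
  have := congrArg Complex.im hk
  simp at this
  linarith

theorem dir_sub_dir (z : ℕ → ℂ) {a b : ℕ} (h : a ≤ b) :
    dir z b - dir z a = ∑ j ∈ Ico a b, turn z j := by
  rw [dir, dir, ← Finset.sum_range_add_sum_Ico _ h]; ring

/-- With zero net turning, the change of direction from `a` to `b` is undone along the complementary
arc, so it is paid for twice. -/
theorem two_mul_abs_dir_sub_le (hn : dir z n = 0) {a b : ℕ} (hab : a ≤ b) (hb : b ≤ n) :
    2 * |dir z b - dir z a| ≤ ∑ j ∈ range n, |turn z j| := by
  have h1 : |dir z b - dir z a| ≤ ∑ j ∈ Ico a b, |turn z j| := by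
    rw [dir_sub_dir z hab]; exact Finset.abs_sum_le_sum_abs _ _
  have h2 : |dir z b - dir z a| ≤ ∑ j ∈ range a, |turn z j| + ∑ j ∈ Ico b n, |turn z j| := by
    have : dir z b - dir z a = -(dir z a + (dir z n - dir z b)) := by rw [hn]; ring
    rw [this, abs_neg, dir_sub_dir z hb, dir]
    exact (abs_add_le _ _).trans
      (add_le_add (Finset.abs_sum_le_sum_abs _ _) (Finset.abs_sum_le_sum_abs _ _))
  have h3 := Finset.sum_range_add_sum_Ico (fun j => |turn z j|) hab
  have h4 := Finset.sum_range_add_sum_Ico (fun j => |turn z j|) hb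
  linarith

theorem sin_sub_eq_zero {a b m : ℝ} (ha : Real.sin (a - m) = 0) (hb : Real.sin (b - m) = 0) :
    Real.sin (a - b) = 0 := by
  have : a - b = (a - m) - (b - m) := by ring
  rw [this, Real.sin_sub, ha, hb]; ring

theorem collinear_of_sin_nonneg (hz : ∀ i, z i ≠ 0) (h : ∑ i ∈ range n, z i = 0) (m : ℝ)
    (hs : ∀ i < n, 0 ≤ Real.sin (dir z i - m)) :
    ∀ i < n, ∀ j < n, (conj (z j) * z i).im = 0 := by
  have h1 := (Finset.sum_eq_zero_iff_of_nonneg (fun i hi =>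
    mul_nonneg (norm_nonneg (z i)) (hs i (mem_range.1 hi)))).1 (sum_norm_mul_sin_eq_zero hz h m)
  have h2 : ∀ i < n, Real.sin (dir z i - m) = 0 := fun i hi =>
    (mul_eq_zero.1 (h1 i (mem_range.2 hi))).resolve_left (norm_ne_zero_iff.2 (hz i))
  intro i hi j hj
  rw [im_conj_mul_side hz, sin_sub_eq_zero (h2 i hi) (h2 j hj), mul_zero]

theorem not_sin_pos (hz : ∀ i, z i ≠ 0) (hn0 : 0 < n) (h : ∑ i ∈ range n, z i = 0) (m : ℝ)
    (hs : ∀ i < n, 0 < Real.sin (dir z i - m)) : False := by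
  refine (Finset.sum_pos (fun i hi => ?_) ⟨0, mem_range.2 hn0⟩).ne'
    (sum_norm_mul_sin_eq_zero hz h m)
  exact mul_pos (norm_pos_iff.2 (hz i)) (hs i (mem_range.1 hi))

/-- A closed polygon whose total winding vanishes has total turning at least `2π`, with equality
only for polygons contained in a line. -/
theorem two_pi_le_of_dir_eq_zero (hz : ∀ i, z i ≠ 0) (hn0 : 0 < n) (h : ∑ i ∈ range n, z i = 0)
    (hn : dir z n = 0) : 2 * Real.pi ≤ ∑ j ∈ range n, |turn z j| ∧
      (∑ j ∈ range n, |turn z j| = 2 * Real.pi →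
        ∀ i < n, ∀ j < n, (conj (z j) * z i).im = 0) := by
  obtain ⟨a, ha, hamax⟩ := Finset.exists_max_image (range n) (dir z) ⟨0, mem_range.2 hn0⟩
  obtain ⟨b, hb, hbmin⟩ := Finset.exists_min_image (range n) (dir z) ⟨0, mem_range.2 hn0⟩
  rw [mem_range] at ha hb
  have hW : 2 * (dir z a - dir z b) ≤ ∑ j ∈ range n, |turn z j| := by
    rcases le_total a b with hab | hab
    · refine le_trans ?_ (two_mul_abs_dir_sub_le hn hab hb.le)
      rw [abs_sub_comm]
      linarith [le_abs_self (dir z a - dir z b)]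
    · refine le_trans ?_ (two_mul_abs_dir_sub_le hn hab ha.le)
      linarith [le_abs_self (dir z a - dir z b)]
  -- If the directions spanned less than π, all sides would lie in the open half-plane centred at
  -- the middle direction, and could not sum to zero.
  have hpi : Real.pi ≤ dir z a - dir z b := by
    by_contra hlt
    push Not at hlt
    refine not_sin_pos hz hn0 h ((dir z a + dir z b) / 2 - Real.pi / 2) fun i hi => ?_
    have h1 := hamax i (mem_range.2 hi)
    have h2 := hbmin i (mem_range.2 hi)
    exact Real.sin_pos_of_pos_of_lt_pi (by linarith) (by linarith)
  refine ⟨by linarith, fun heq => ?_⟩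
  refine collinear_of_sin_nonneg hz h (dir z b) fun i hi => ?_
  have h1 := hamax i (mem_range.2 hi)
  have h2 := hbmin i (mem_range.2 hi)
  exact Real.sin_nonneg_of_nonneg_of_le_pi (by linarith) (by linarith)

/-- The net turning is a multiple of 2π. A nonzero one gives the bound at once; a vanishing one is
the case treated just above. -/
theorem two_pi_le_sum_abs_turn (hz : ∀ i, z i ≠ 0) (hn0 : 0 < n) (h : ∑ i ∈ range n, z i = 0)
    (hn : z n = z 0) : 2 * Real.pi ≤ ∑ j ∈ range n, |turn z j| := by
  obtain ⟨k, hk⟩ := exists_dir_eq hz hn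
  by_cases hk0 : k = 0
  · exact (two_pi_le_of_dir_eq_zero hz hn0 h (by simp [hk, hk0])).1
  · have h1 : (1 : ℝ) ≤ |(k : ℝ)| := by exact_mod_cast Int.one_le_abs hk0
    have hpi := Real.pi_pos
    calc 2 * Real.pi ≤ |dir z n| := by
          rw [hk, abs_mul, abs_of_pos (by positivity)]; nlinarith
      _ ≤ _ := Finset.abs_sum_le_sum_abs _ _

/-- The net turning can only be 2π, -2π or 0. The first two values exhaust the total absolute
turning and leave no room for turns of the other sign; the last is the equality case for polygons
with zero net turning. -/
theorem turning_eq_two_pi (hz : ∀ i, z i ≠ 0) (hn0 : 0 < n) (h : ∑ i ∈ range n, z i = 0)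
    (hn : z n = z 0) (heq : ∑ j ∈ range n, |turn z j| = 2 * Real.pi) :
    ((∀ i < n, 0 ≤ turn z i) ∧ dir z n = 2 * Real.pi) ∨
    ((∀ i < n, turn z i ≤ 0) ∧ dir z n = -(2 * Real.pi)) ∨
    ∀ i < n, ∀ j < n, (conj (z j) * z i).im = 0 := by
  obtain ⟨k, hk⟩ := exists_dir_eq hz hn
  have hpi := Real.pi_pos
  have hle : |dir z n| ≤ 2 * Real.pi := by rw [← heq]; exact Finset.abs_sum_le_sum_abs _ _
  rw [hk, abs_le] at hle
  have h1 : (k : ℝ) ≤ 1 := by nlinarith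
  have h2 : (-1 : ℝ) ≤ k := by nlinarith
  have h1' : k ≤ 1 := by exact_mod_cast h1
  have h2' : -1 ≤ k := by exact_mod_cast h2
  have : k = 1 ∨ k = -1 ∨ k = 0 := by omega
  rcases this with rfl | rfl | rfl
  · refine Or.inl ⟨fun i hi => nonneg_of_sum_eq_sum_abs (range n) (turn z) ?_ i (mem_range.2 hi),
      by simp [hk]⟩
    rw [heq]; simpa [dir] using hk
  · refine Or.inr (Or.inl ⟨fun i hi =>
      nonpos_of_sum_eq_neg_sum_abs (range n) (turn z) ?_ i (mem_range.2 hi), by simp [hk]⟩)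
    rw [heq]; simpa [dir] using hk
  · exact Or.inr (Or.inr ((two_pi_le_of_dir_eq_zero hz hn0 h (by simp [hk])).2 heq))

theorem dir_mono (h : ∀ i < n, 0 ≤ turn z i) {a b : ℕ} (hab : a ≤ b) (hb : b ≤ n) :
    dir z a ≤ dir z b := by
  rw [← sub_nonneg, dir_sub_dir z hab]
  exact Finset.sum_nonneg fun j hj => h j ((mem_Ico.1 hj).2.trans_le hb)

/-- For a polygon turning left, a U-turn leaves only π for all other turns. Modulo 2π all directions
then lie in the half-turn starting right after the U-turn, so the vanishing of the sum of the sides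
confines them to a line. -/
theorem collinear_of_turn_eq_pi (hz : ∀ i, z i ≠ 0) (hn0 : 0 < n) (h : ∑ i ∈ range n, z i = 0)
    (hn : z n = z 0) (heq : ∑ j ∈ range n, |turn z j| = 2 * Real.pi) {i : ℕ} (hi : i < n)
    (hpi : turn z i = Real.pi) : ∀ i < n, ∀ j < n, (conj (z j) * z i).im = 0 := by
  rcases turning_eq_two_pi hz hn0 h hn heq with ⟨h1, h2⟩ | ⟨h1, h2⟩ | h1
  · refine collinear_of_sin_nonneg hz h (dir z i + Real.pi) fun j hj => ?_
    have hs : dir z (i + 1) = dir z i + Real.pi := by rw [dir_succ, hpi]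
    have hend := dir_mono h1 (Nat.succ_le_of_lt hi) le_rfl
    rcases le_or_gt j i with hji | hji
    · have h3 := dir_mono h1 hji hi.le
      have h4 := dir_mono h1 (Nat.zero_le j) hj.le
      rw [dir_zero] at h4
      rw [show dir z j - (dir z i + Real.pi) = (dir z j - dir z i + Real.pi) - 2 * Real.pi by ring,
        Real.sin_sub_two_pi]
      refine Real.sin_nonneg_of_nonneg_of_le_pi ?_ ?_
      · simp only [Nat.succ_eq_add_one] at hend; linarith
      · linarith
    · have h3 := dir_mono h1 (Nat.succ_le_of_lt hji) hj.le
      have h4 := dir_mono h1 hj.le le_rfl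
      have h5 := dir_mono h1 (Nat.zero_le i) hi.le
      rw [dir_zero] at h5
      simp only [Nat.succ_eq_add_one] at h3
      exact Real.sin_nonneg_of_nonneg_of_le_pi (by linarith) (by linarith)
  · have := h1 i hi
    have := Real.pi_pos
    linarith
  · exact h1

end PlanarPolygon

namespace PlanarPolygon

open Complex Finset

variable {z : ℕ → ℂ} {n : ℕ}

/-! ### Convex polygons: exterior angles in `[0, π)` with sum `2π` -/

theorem dir_mem_of_lt (ht : ∀ i < n, 0 ≤ turn z i) (hd : dir z n = 2 * Real.pi) {i : ℕ}
    (hi : i ≤ n) : 0 ≤ dir z i ∧ dir z i ≤ 2 * Real.pi := by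
  have h1 := dir_mono ht (Nat.zero_le i) hi
  have h2 := dir_mono ht hi le_rfl
  rw [dir_zero] at h1
  exact ⟨h1, by linarith⟩

theorem im_conj_mul_sum (hz : ∀ i, z i ≠ 0) (s : Finset ℕ) :
    (conj (z 0) * ∑ i ∈ s, z i).im = ∑ i ∈ s, ‖z 0‖ * ‖z i‖ * Real.sin (dir z i) := by
  rw [Finset.mul_sum, Complex.im_sum]
  refine Finset.sum_congr rfl fun i _ => ?_
  rw [im_conj_mul_side hz, dir_zero, sub_zero]

/-- The height above the initial side does not decrease while the direction is at most π and does
not increase afterwards; it vanishes at both ends. In the second case it is computed from the end of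
the polygon. -/
theorem left_of_first_side (hz : ∀ i, z i ≠ 0) (h : ∑ i ∈ range n, z i = 0)
    (ht : ∀ i < n, 0 ≤ turn z i) (hd : dir z n = 2 * Real.pi) {j : ℕ} (hj : j ≤ n) :
    0 ≤ (conj (z 0) * ∑ i ∈ range j, z i).im := by
  have hnn : ∀ i, 0 ≤ ‖z 0‖ * ‖z i‖ := fun i => by positivity
  by_cases hall : ∀ i < j, dir z i ≤ Real.pi
  · rw [im_conj_mul_sum hz]
    refine Finset.sum_nonneg fun i hi => mul_nonneg (hnn i) ?_
    have hi := mem_range.1 hi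
    exact Real.sin_nonneg_of_nonneg_of_le_pi (dir_mem_of_lt ht hd (by omega)).1 (hall i hi)
  · push Not at hall
    obtain ⟨i, hij, hi⟩ := hall
    have hsum : ∑ i ∈ range j, z i = -∑ i ∈ Ico j n, z i := by
      rw [eq_neg_iff_add_eq_zero, Finset.sum_range_add_sum_Ico _ hj, h]
    rw [hsum, mul_neg, neg_im, im_conj_mul_sum hz, neg_nonneg]
    refine Finset.sum_nonpos fun k hk => mul_nonpos_of_nonneg_of_nonpos (hnn k) ?_
    have hk := mem_Ico.1 hk
    have h1 := dir_mono ht (show i ≤ k by omega) hk.2.le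
    have h2 := (dir_mem_of_lt ht hd hk.2.le).2
    rw [← neg_nonneg, ← Real.sin_sub_pi]
    exact Real.sin_nonneg_of_nonneg_of_le_pi (by linarith) (by linarith)

theorem exists_left_of_first_side (hz : ∀ i, z i ≠ 0)
    (ht : ∀ i < n, 0 ≤ turn z i) (ht' : ∀ i < n, turn z i < Real.pi)
    (hd : dir z n = 2 * Real.pi) :
    ∃ j ≤ n, 0 < (conj (z 0) * ∑ i ∈ range j, z i).im := by
  classical
  have hpi := Real.pi_pos
  have hex : ∃ i, 0 < dir z i := ⟨n, by rw [hd]; positivity⟩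
  -- The first side not parallel to the initial one. Its direction is below π because a single turn
  -- leads to it.
  set i := Nat.find hex with hi
  have hipos : 0 < dir z i := Nat.find_spec hex
  have hmin : ∀ k < i, dir z k ≤ 0 := fun k hk => not_lt.1 (Nat.find_min hex hk)
  have hin : i ≤ n := Nat.find_min' hex (by rw [hd]; positivity)
  have hi0 : i ≠ 0 := by rintro h0; rw [h0, dir_zero] at hipos; exact lt_irrefl _ hipos
  obtain ⟨k, hk⟩ := Nat.exists_eq_succ_of_ne_zero hi0
  have hk' : i = k + 1 := hk
  have hlt : dir z i < Real.pi := by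
    rw [hk', dir_succ]
    linarith [hmin k (by omega), ht' k (by omega)]
  have hin' : i < n := by
    rcases hin.lt_or_eq with h1 | h1
    · exact h1
    · rw [h1, hd] at hlt; linarith
  refine ⟨i + 1, hin', ?_⟩
  have h0 : 0 < ‖z 0‖ := norm_pos_iff.2 (hz 0)
  rw [im_conj_mul_sum hz, Finset.sum_range_succ]
  refine add_pos_of_nonneg_of_pos (Finset.sum_nonneg fun j hj => ?_) ?_
  · have hj := mem_range.1 hj
    have h1 := (dir_mem_of_lt ht hd (show j ≤ n by omega)).1
    have h2 := hmin j hj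
    rw [le_antisymm h2 h1]; simp
  · exact mul_pos (mul_pos h0 (norm_pos_iff.2 (hz i))) (Real.sin_pos_of_pos_of_lt_pi hipos hlt)

/-- A positive combination of sides whose directions are in an open half-plane is nonzero. -/
theorem combination_ne_zero (hz : ∀ i, z i ≠ 0) (s : Finset ℕ) (c : ℕ → ℝ)
    (hc : ∀ i ∈ s, 0 ≤ c i) {j : ℕ} (hj : j ∈ s) (hcj : 0 < c j) (m : ℝ)
    (hs : ∀ i ∈ s, 0 < Real.sin (dir z i - m)) : ∑ i ∈ s, (c i : ℂ) * z i ≠ 0 := by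
  intro h
  refine (Finset.sum_pos' (fun i hi => ?_) ⟨j, hj, ?_⟩).ne' (sum_sin_eq_zero hz s c h m)
  · exact mul_nonneg (hc i hi) (mul_nonneg (norm_nonneg _) (hs i hi).le)
  · exact mul_pos hcj (mul_pos (norm_pos_iff.2 (hz j)) (hs j hj))

/-- Distinct half-open sides of a convex polygon are disjoint. -/
theorem sides_disjoint (hz : ∀ i, z i ≠ 0) (h : ∑ i ∈ range n, z i = 0)
    (ht : ∀ i < n, 0 ≤ turn z i) (ht' : ∀ i < n, turn z i < Real.pi)
    (hd : dir z n = 2 * Real.pi) {j : ℕ} (hj0 : 0 < j) (hj : j < n) {t t' : ℝ}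
    (h0 : 0 < t) (h1 : t ≤ 1) (h0' : 0 < t') (h1' : t' ≤ 1) :
    (t : ℂ) * z 0 ≠ ∑ i ∈ range j, z i + t' * z j := by
  intro heq
  have hpi := Real.pi_pos
  -- the chain from the point to itself along the sides `0, …, j`
  have hA : ∑ i ∈ range (j + 1),
      ((if i = 0 then 1 - t else if i = j then t' else 1 : ℝ) : ℂ) * z i = 0 := by
    rw [Finset.sum_range_succ, Finset.sum_eq_sum_sdiff_singleton_add (mem_range.2 hj0)]
    have : ∑ i ∈ range j \ {0},
        ((if i = 0 then 1 - t else if i = j then t' else 1 : ℝ) : ℂ) * z i =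
        ∑ i ∈ range j \ {0}, z i := by
      refine Finset.sum_congr rfl fun i hi => ?_
      rw [mem_sdiff, mem_singleton, mem_range] at hi
      rw [if_neg hi.2, if_neg hi.1.ne]; simp
    rw [this, if_pos rfl, if_neg hj0.ne', if_pos rfl]
    rw [Finset.sum_eq_sum_sdiff_singleton_add (mem_range.2 hj0)] at heq
    push_cast
    linear_combination -heq
  have hcA : ∀ i, 0 ≤ (if i = 0 then 1 - t else if i = j then t' else 1 : ℝ) := fun i => by
    split_ifs <;> linarith
  have hdj := dir_mem_of_lt ht hd hj.le
  -- A common point closes up both the chain of sides from `0` to `j` and the complementary one. If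
  -- `dir z j < π`, the first chain lies in an open half-plane; if `dir z j > π`, the second does,
  -- once direction 2π is assigned to side `0`. If `dir z j = π`, all directions up to `j` would be
  -- `0` or π, and a turn smaller than π cannot jump from one to the other.
  rcases lt_trichotomy (dir z j) Real.pi with hlt | heqpi | hgt
  · refine combination_ne_zero hz _ _ (fun i _ => hcA i) (j := j) (by simp)
      (by rw [if_neg hj0.ne', if_pos rfl]; exact h0') (dir z j / 2 - Real.pi / 2) (fun i hi => ?_) hA
    have hi := mem_range.1 hi
    have h2 := dir_mono ht (show i ≤ j by omega) hj.le
    have h3 := (dir_mem_of_lt ht hd (show i ≤ n by omega)).1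
    exact Real.sin_pos_of_pos_of_lt_pi (by linarith) (by linarith)
  · have hB := sum_sin_eq_zero hz _ _ hA 0
    have hnn : ∀ i ∈ range (j + 1), 0 ≤ Real.sin (dir z i - 0) := fun i hi => by
      have hi := mem_range.1 hi
      have h2 := dir_mono ht (show i ≤ j by omega) hj.le
      have h3 := (dir_mem_of_lt ht hd (show i ≤ n by omega)).1
      exact Real.sin_nonneg_of_nonneg_of_le_pi (by linarith) (by linarith)
    have hC := (Finset.sum_eq_zero_iff_of_nonneg fun i hi =>
      mul_nonneg (hcA i) (mul_nonneg (norm_nonneg (z i)) (hnn i hi))).1 hB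
    have hD : ∀ i ≤ j, dir z i = 0 ∨ dir z i = Real.pi := by
      intro i hi
      by_cases hi0 : i = 0
      · left; rw [hi0, dir_zero]
      have hne : (if i = 0 then 1 - t else if i = j then t' else 1 : ℝ) ≠ 0 := by
        rw [if_neg hi0]; split_ifs
        · exact h0'.ne'
        · exact one_ne_zero
      have h2 := ((mul_eq_zero.1 (hC i (mem_range.2 (by omega)))).resolve_left hne)
      have h3 := (mul_eq_zero.1 h2).resolve_left (norm_ne_zero_iff.2 (hz i))
      rw [sub_zero] at h3
      have h4 := (dir_mem_of_lt ht hd (show i ≤ n by omega)).1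
      have h5 := dir_mono ht hi hj.le
      by_contra hcon
      push Not at hcon
      exact (Real.sin_pos_of_pos_of_lt_pi (lt_of_le_of_ne h4 hcon.1.symm)
        (lt_of_le_of_ne (by linarith) hcon.2)).ne' h3
    have hE : ∀ i ≤ j, dir z i = 0 := by
      intro i
      induction i with
      | zero => simp
      | succ i ih =>
        intro hi
        refine (hD _ hi).resolve_right fun hp => ?_
        rw [dir_succ, ih (by omega)] at hp
        linarith [ht' i (by omega)]
    rw [hE j le_rfl] at heqpi
    linarith
  · have hB : ∑ i ∈ insert 0 (Ico j n),
        ((if i = 0 then t else if i = j then 1 - t' else 1 : ℝ) : ℂ) * z i = 0 := by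
      rw [Finset.sum_insert (by simp; omega), Finset.sum_eq_sum_Ico_succ_bot hj]
      have : ∑ i ∈ Ico (j + 1) n,
          ((if i = 0 then t else if i = j then 1 - t' else 1 : ℝ) : ℂ) * z i =
          ∑ i ∈ Ico (j + 1) n, z i := by
        refine Finset.sum_congr rfl fun i hi => ?_
        rw [mem_Ico] at hi
        rw [if_neg (by omega), if_neg (by omega)]; simp
      rw [this, if_pos rfl, if_neg hj0.ne', if_pos rfl]
      rw [← Finset.sum_range_add_sum_Ico _ hj.le, Finset.sum_eq_sum_Ico_succ_bot hj] at h
      push_cast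
      linear_combination heq + h
    refine combination_ne_zero hz _ _ (fun i _ => ?_) (j := 0) (by simp)
      (by rw [if_pos rfl]; exact h0) ((dir z j + 2 * Real.pi) / 2 - Real.pi / 2) (fun i hi => ?_) hB
    · split_ifs <;> linarith
    · rcases mem_insert.1 hi with rfl | hi
      · rw [dir_zero, ← Real.sin_add_two_pi]
        exact Real.sin_pos_of_pos_of_lt_pi (by linarith) (by linarith)
      · have hi := mem_Ico.1 hi
        have h2 := dir_mono ht hi.1 hi.2.le
        have h3 := (dir_mem_of_lt ht hd hi.2.le).2
        exact Real.sin_pos_of_pos_of_lt_pi (by linarith) (by linarith)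

/-- If a polygon which turns left winds more than once, then two different corners have a common
supporting direction. -/
theorem exists_common_direction (hz : ∀ i, z i ≠ 0) (ht : ∀ i < n, 0 ≤ turn z i)
    (ht' : ∀ i < n, turn z i < Real.pi) (hd : 4 * Real.pi ≤ dir z n) :
    ∃ i < n, ∃ j < n, i ≠ j ∧ ∃ u : ℂ, 0 < (conj (z i) * u).im ∧ 0 < (conj u * z (i + 1)).im ∧
      0 < (conj (z j) * u).im ∧ 0 < (conj u * z (j + 1)).im := by
  classical
  have hpi := Real.pi_pos
  have hex : ∃ i, 0 < dir z (i + 1) := by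
    refine ⟨n - 1, ?_⟩
    rcases Nat.eq_zero_or_pos n with rfl | hn
    · rw [dir_zero] at hd; linarith
    · rw [Nat.sub_add_cancel hn]; linarith
  set i := Nat.find hex with hi
  have hipos : 0 < dir z (i + 1) := Nat.find_spec hex
  have hn : n ≠ 0 := by rintro rfl; rw [dir_zero] at hd; linarith
  have hin : i < n := by
    have : i ≤ n - 1 := Nat.find_min' hex (by rw [Nat.sub_add_cancel (by omega)]; linarith)
    omega
  have hi0 : dir z i = 0 := by
    rcases Nat.eq_zero_or_pos i with h0 | h0
    · rw [h0, dir_zero]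
    · have h1 := Nat.find_min hex (show i - 1 < i by omega)
      rw [Nat.sub_add_cancel h0, not_lt] at h1
      have h2 := dir_mono ht (Nat.zero_le i) hin.le
      rw [dir_zero] at h2
      exact le_antisymm h1 h2
  have hi1 : dir z (i + 1) < Real.pi := by rw [dir_succ, hi0, zero_add]; exact ht' i hin
  -- The direction `f` lies strictly inside the corner `i`. Finitely many values are excluded so
  -- that `f + 2π` is not the direction of any side, and hence lies strictly inside a corner `j` of
  -- the second turn.
  obtain ⟨f, ⟨hf0, hf1⟩, hfn⟩ : (Set.Ioo 0 (dir z (i + 1)) \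
      ((fun k => dir z k - 2 * Real.pi) '' (range (n + 1) : Set ℕ))).Nonempty :=
    ((Set.Ioo_infinite hipos).sdiff ((Finset.finite_toSet _).image _)).nonempty
  have hfn' : ∀ k ≤ n, dir z k ≠ f + 2 * Real.pi := fun k hk hk' =>
    hfn ⟨k, by simp; omega, by simp only [hk']; ring⟩
  have hex2 : ∃ j, f + 2 * Real.pi < dir z (j + 1) :=
    ⟨n - 1, by rw [Nat.sub_add_cancel (by omega)]; linarith⟩
  set j := Nat.find hex2 with hj
  have hjpos : f + 2 * Real.pi < dir z (j + 1) := Nat.find_spec hex2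
  have hjn : j < n := by
    have : j ≤ n - 1 := Nat.find_min' hex2 (by rw [Nat.sub_add_cancel (by omega)]; linarith)
    omega
  have hj0 : dir z j < f + 2 * Real.pi := by
    rcases Nat.eq_zero_or_pos j with h0 | h0
    · rw [h0, dir_zero]; linarith
    · have h1 := Nat.find_min hex2 (show j - 1 < j by omega)
      rw [Nat.sub_add_cancel h0, not_lt] at h1
      exact lt_of_le_of_ne h1 (hfn' j hjn.le)
  have hjt := ht' j hjn
  have hjs := dir_succ z j
  refine ⟨i, hin, j, hjn, ?_, z 0 * exp (f * I), ?_⟩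
  · intro hij
    rw [← hij] at hjpos
    linarith
  have key : ∀ k, conj (z k) * (z 0 * exp (f * I)) =
      (‖z k‖ * ‖z 0‖ : ℝ) * exp ((f - dir z k : ℝ) * I) := fun k => by
    rw [← mul_assoc, conj_mul_side hz, dir_zero, mul_assoc, ← Complex.exp_add]
    congr 2; push_cast; ring
  have key' : ∀ k, (conj (z k) * (z 0 * exp (f * I))).im =
      ‖z k‖ * ‖z 0‖ * Real.sin (f - dir z k) := fun k => by
    rw [key, Complex.im_ofReal_mul, Complex.exp_ofReal_mul_I_im]
  have key2 : ∀ k, (conj (z 0 * exp (f * I)) * z k).im =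
      ‖z k‖ * ‖z 0‖ * Real.sin (dir z k - f) := fun k => by
    have : conj (z 0 * exp (f * I)) * z k = conj (conj (z k) * (z 0 * exp (f * I))) := by
      rw [map_mul (starRingEnd ℂ) (conj (z k)), conj_conj, mul_comm]
    rw [this, conj_im, key', ← neg_sub f, Real.sin_neg]; ring
  have hp : ∀ k, 0 < ‖z k‖ * ‖z 0‖ := fun k =>
    mul_pos (norm_pos_iff.2 (hz k)) (norm_pos_iff.2 (hz 0))
  have hs : ∀ x, Real.sin x = Real.sin (x + 2 * Real.pi) := fun x => (Real.sin_add_two_pi x).symm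
  have hs' : ∀ x, Real.sin x = Real.sin (x - 2 * Real.pi) := fun x => (Real.sin_sub_two_pi x).symm
  rw [key', key', key2, key2]
  refine ⟨mul_pos (hp i) ?_, mul_pos (hp _) ?_, mul_pos (hp j) ?_, mul_pos (hp _) ?_⟩
  · exact Real.sin_pos_of_pos_of_lt_pi (by linarith) (by linarith)
  · exact Real.sin_pos_of_pos_of_lt_pi (by linarith) (by linarith)
  · rw [hs]; exact Real.sin_pos_of_pos_of_lt_pi (by linarith) (by linarith)
  · rw [hs']; exact Real.sin_pos_of_pos_of_lt_pi (by linarith) (by linarith)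

end PlanarPolygon

/-! ### Angles at which segments and closed polygons are seen from a point. -/

namespace PlanarPolygon

open Complex Finset

/-- The argument, symmetrized so that it is odd under inversion: negative reals have argument `0`. -/
noncomputable def symArg (w : ℂ) : ℝ := if arg w = Real.pi then 0 else arg w

theorem symArg_of_ne {w : ℂ} (h : arg w ≠ Real.pi) : symArg w = arg w := if_neg h

theorem symArg_of_eq {w : ℂ} (h : arg w = Real.pi) : symArg w = 0 := if_pos h

theorem symArg_inv (w : ℂ) : symArg w⁻¹ = -symArg w := by
  have hpi := Real.pi_pos
  unfold symArg
  rw [Complex.arg_inv]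
  split_ifs with h1 h2 h2
  · simp
  · exact absurd rfl h2
  · have := neg_pi_lt_arg w; linarith
  · rfl

/-- The signed angle at which the segment from `A` to `B` is seen from `w`. -/
noncomputable def view (A B w : ℂ) : ℝ := symArg ((B - w) / (A - w))

/-- The convention of `symArg` on negative reals makes this antisymmetry exact, even for points of
the segment. The two directions of an edge therefore always cancel. -/
theorem view_swap (A B w : ℂ) : view B A w = -view A B w := by
  rw [view, view, ← symArg_inv, inv_div]

theorem view_self_left (A B : ℂ) : view A B A = 0 := by
  simp [view, symArg, Real.pi_pos.ne]

theorem im_div_eq (A B w : ℂ) :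
    ((B - w) / (A - w)).im = (conj (B - A) * (w - A)).im / normSq (A - w) := by
  rw [div_eq_mul_inv, Complex.inv_def, ← mul_assoc, Complex.im_mul_ofReal, div_eq_mul_inv]
  congr 1
  simp
  ring

theorem view_nonneg {A B w : ℂ} (h : 0 ≤ (conj (B - A) * (w - A)).im) : 0 ≤ view A B w := by
  unfold view symArg
  split_ifs
  · exact le_rfl
  · rw [Complex.arg_nonneg_iff, im_div_eq]
    exact div_nonneg h (normSq_nonneg _)

theorem ne_of_left {A B w : ℂ} (h : (conj (B - A) * (w - A)).im ≠ 0) : A ≠ w ∧ B ≠ w := by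
  constructor
  · rintro rfl; simp at h
  · rintro rfl
    rw [mul_comm, Complex.mul_conj] at h
    simp at h

theorem im_div_pos {A B w : ℂ} (h : 0 < (conj (B - A) * (w - A)).im) :
    0 < ((B - w) / (A - w)).im := by
  rw [im_div_eq]
  exact div_pos h (normSq_pos.2 (sub_ne_zero.2 (ne_of_left h.ne').1))

theorem arg_mem_of_im_pos {r : ℂ} (h : 0 < r.im) : 0 < arg r ∧ arg r < Real.pi := by
  refine ⟨lt_of_le_of_ne (Complex.arg_nonneg_iff.2 h.le) fun h0 => ?_, ?_⟩
  · rw [eq_comm, Complex.arg_eq_zero_iff] at h0; exact h.ne' h0.2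
  · rw [Complex.arg_lt_pi_iff]; exact Or.inr h.ne'

theorem im_pos_of_arg_mem {r : ℂ} (h0 : 0 < arg r) (h1 : arg r < Real.pi) : 0 < r.im := by
  have hr : r ≠ 0 := by rintro rfl; simp at h0
  have h := Real.sin_pos_of_pos_of_lt_pi h0 h1
  rw [Complex.sin_arg] at h
  exact (div_pos_iff_of_pos_right (norm_pos_iff.2 hr)).1 h

theorem view_eq_arg_of_left {A B w : ℂ} (h : 0 < (conj (B - A) * (w - A)).im) :
    view A B w = arg ((B - w) / (A - w)) :=
  symArg_of_ne (arg_mem_of_im_pos (im_div_pos h)).2.ne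

theorem view_mem_of_left {A B w : ℂ} (h : 0 < (conj (B - A) * (w - A)).im) :
    0 < view A B w ∧ view A B w < Real.pi := by
  rw [view_eq_arg_of_left h]
  exact arg_mem_of_im_pos (im_div_pos h)

theorem abs_view_lt (A B w : ℂ) : |view A B w| < Real.pi := by
  unfold view symArg
  split_ifs with h
  · simpa using Real.pi_pos
  · exact abs_lt.2 ⟨neg_pi_lt_arg _, lt_of_le_of_ne (arg_le_pi _) h⟩

theorem mem_segment_of_arg_eq_pi {A B w : ℂ} (h : arg ((B - w) / (A - w)) = Real.pi) :
    ∃ t : ℝ, 0 < t ∧ t < 1 ∧ w = A + t * (B - A) := by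
  rw [Complex.arg_eq_pi_iff] at h
  set r := (B - w) / (A - w) with hr
  have hA : A - w ≠ 0 := by rintro h0; rw [hr, h0] at h; simp at h
  have hre : r = (r.re : ℂ) := Complex.ext (by simp) (by simp [h.2])
  have hB : B - w = r.re * (A - w) := by
    rw [← hre, hr, div_mul_cancel₀ _ hA]
  have h1 : 0 < 1 - r.re := by linarith [h.1]
  refine ⟨(1 - r.re)⁻¹, inv_pos.2 h1, inv_lt_one_of_one_lt₀ (by linarith [h.1]), ?_⟩
  have h2 : (1 - r.re : ℂ) ≠ 0 := by exact_mod_cast h1.ne'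
  push_cast
  field_simp
  linear_combination -hB

theorem arg_div_of_re_pos {a b : ℂ} (ha : 0 < a.re) (hb : 0 < b.re) :
    arg (b / a) = arg b - arg a := by
  have ha0 : a ≠ 0 := by rintro rfl; simp at ha
  have hb0 : b ≠ 0 := by rintro rfl; simp at hb
  have h1 := abs_lt.1 (Complex.abs_arg_lt_pi_div_two_iff.2 (Or.inl ha))
  have h2 := abs_lt.1 (Complex.abs_arg_lt_pi_div_two_iff.2 (Or.inl hb))
  have h := Complex.arg_div_coe_angle hb0 ha0
  rw [← Complex.arg_coe_angle_toReal_eq_arg (b / a), h, ← Real.Angle.coe_sub,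
    Real.Angle.toReal_coe_eq_self_iff]
  exact ⟨by linarith, by linarith⟩

section Cycle

variable {ι : Type*} {p : Equiv.Perm ι} {C : Finset ι} {A B : ι → ℂ}

theorem sum_comp_perm {M : Type*} [AddCommMonoid M] (hC : ∀ s, p s ∈ C ↔ s ∈ C) (f : ι → M) :
    ∑ s ∈ C, f (p s) = ∑ s ∈ C, f s :=
  Finset.sum_equiv p (fun s => (hC s).symm) fun _ _ => rfl

theorem prod_comp_perm {M : Type*} [CommMonoid M] (hC : ∀ s, p s ∈ C ↔ s ∈ C) (f : ι → M) :
    ∏ s ∈ C, f (p s) = ∏ s ∈ C, f s :=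
  Finset.prod_equiv p (fun s => (hC s).symm) fun _ _ => rfl

/-- On a half-plane the argument is single-valued; each view is its increment, and the increments
telescope around the cycle. -/
theorem sum_view_eq_zero_of_halfPlane (hC : ∀ s, p s ∈ C ↔ s ∈ C) (hAB : ∀ s, A (p s) = B s)
    {w a : ℂ} (h : ∀ s ∈ C, 0 < (conj a * (A s - w)).re) : ∑ s ∈ C, view (A s) (B s) w = 0 := by
  have ha : conj a ≠ 0 ∨ ∀ s, s ∉ C := by
    by_cases ha : conj a = 0
    · right; intro s hs; have := h s hs; rw [ha, zero_mul] at this; simp at this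
    · exact Or.inl ha
  rcases ha with ha | ha
  · have : ∀ s ∈ C, view (A s) (B s) w = arg (conj a * (B s - w)) - arg (conj a * (A s - w)) := by
      intro s hs
      have h1 := h s hs
      have h2 := h (p s) ((hC s).2 hs)
      rw [hAB] at h2
      have h3 := arg_div_of_re_pos h1 h2
      have h4 : conj a * (B s - w) / (conj a * (A s - w)) = (B s - w) / (A s - w) :=
        mul_div_mul_left _ _ ha
      rw [h4] at h3
      rw [← h3]
      refine symArg_of_ne ?_
      rw [h3]
      have h5 := abs_lt.1 (Complex.abs_arg_lt_pi_div_two_iff.2 (Or.inl h1))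
      have h6 := abs_lt.1 (Complex.abs_arg_lt_pi_div_two_iff.2 (Or.inl h2))
      intro h7
      linarith
    rw [Finset.sum_congr rfl this, Finset.sum_sub_distrib, sub_eq_zero]
    rw [← sum_comp_perm hC fun s => arg (conj a * (A s - w))]
    simp only [hAB]
  · exact Finset.sum_eq_zero fun s hs => absurd hs (ha s)

/-- A closed polygon on the left of each of its sides is seen at zero angle from a point on the
right of one of its sides. -/
theorem sum_view_eq_zero_of_right (hC : ∀ s, p s ∈ C ↔ s ∈ C) (hAB : ∀ s, A (p s) = B s)
    {w : ℂ} {s₀ : ι} (hleft : ∀ s ∈ C, 0 ≤ (conj (B s₀ - A s₀) * (A s - A s₀)).im)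
    (hw : (conj (B s₀ - A s₀) * (w - A s₀)).im < 0) : ∑ s ∈ C, view (A s) (B s) w = 0 := by
  refine sum_view_eq_zero_of_halfPlane (a := I * (B s₀ - A s₀)) hC hAB fun s hs => ?_
  have h1 := hleft s hs
  have : (conj (I * (B s₀ - A s₀)) * (A s - w)).re =
      (conj (B s₀ - A s₀) * (A s - A s₀)).im - (conj (B s₀ - A s₀) * (w - A s₀)).im := by
    simp; ring
  rw [this]; linarith

theorem prod_sub_eq (hC : ∀ s, p s ∈ C ↔ s ∈ C) (hAB : ∀ s, A (p s) = B s) (w : ℂ) :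
    ∏ s ∈ C, (B s - w) = ∏ s ∈ C, (A s - w) := by
  rw [← prod_comp_perm hC fun s => A s - w]
  simp only [hAB]

/-- The ratios multiply to 1, so the sum is a multiple of 2π, and all its terms are positive. -/
theorem two_pi_le_sum_view (hC : ∀ s, p s ∈ C ↔ s ∈ C) (hAB : ∀ s, A (p s) = B s)
    (hne : C.Nonempty) {w : ℂ} (hw : ∀ s ∈ C, 0 < (conj (B s - A s) * (w - A s)).im) :
    2 * Real.pi ≤ ∑ s ∈ C, view (A s) (B s) w := by
  have hpi := Real.pi_pos
  have h0 : ∀ s ∈ C, A s - w ≠ 0 := fun s hs => sub_ne_zero.2 (ne_of_left (hw s hs).ne').1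
  have h1 : ∀ s ∈ C, B s - w ≠ 0 := fun s hs => sub_ne_zero.2 (ne_of_left (hw s hs).ne').2
  obtain ⟨k, hk⟩ := exists_sum_arg_eq C (fun s => (B s - w) / (A s - w))
    fun s hs => div_ne_zero (h1 s hs) (h0 s hs)
  rw [Finset.prod_div_distrib, prod_sub_eq hC hAB, div_self (Finset.prod_ne_zero_iff.2 h0),
    Complex.arg_one, zero_add] at hk
  rw [Finset.sum_congr rfl fun s hs => view_eq_arg_of_left (hw s hs), hk]
  have hpos : 0 < ∑ s ∈ C, arg ((B s - w) / (A s - w)) :=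
    Finset.sum_pos (fun s hs => (arg_mem_of_im_pos (im_div_pos (hw s hs))).1) hne
  rw [hk] at hpos
  have : 0 < k := by
    have : (0 : ℝ) < k := pos_of_mul_pos_right hpos (by positivity)
    exact_mod_cast this
  have : (1 : ℝ) ≤ k := by exact_mod_cast this
  nlinarith

/-- Either the point is on the left of every side and each view is nonnegative, or it is strictly on
the right of one side and the total vanishes. -/
theorem sum_view_nonneg (hC : ∀ s, p s ∈ C ↔ s ∈ C) (hAB : ∀ s, A (p s) = B s)
    (hleft : ∀ s ∈ C, ∀ s' ∈ C, 0 ≤ (conj (B s - A s) * (A s' - A s)).im) (w : ℂ) :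
    0 ≤ ∑ s ∈ C, view (A s) (B s) w := by
  by_cases hw : ∀ s ∈ C, 0 ≤ (conj (B s - A s) * (w - A s)).im
  · exact Finset.sum_nonneg fun s hs => view_nonneg (hw s hs)
  · push Not at hw
    obtain ⟨s, hs, hlt⟩ := hw
    exact (sum_view_eq_zero_of_right hC hAB (hleft s hs) hlt).ge

theorem left_of_mem_side {s₀ : ι} (hC : ∀ s, p s ∈ C ↔ s ∈ C) (hAB : ∀ s, A (p s) = B s)
    (hleft : ∀ s ∈ C, ∀ s' ∈ C, 0 ≤ (conj (B s - A s) * (A s' - A s)).im) (hs₀ : s₀ ∈ C)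
    {t : ℝ} (h0 : 0 ≤ t) (h1 : t ≤ 1) {s : ι} (hs : s ∈ C) :
    0 ≤ (conj (B s - A s) * (A s₀ + t * (B s₀ - A s₀) - A s)).im := by
  have h2 := hleft s hs s₀ hs₀
  have h3 := hleft s hs (p s₀) ((hC s₀).2 hs₀)
  rw [hAB] at h3
  have : A s₀ + t * (B s₀ - A s₀) - A s =
      ((1 - t : ℝ) : ℂ) * (A s₀ - A s) + (t : ℂ) * (B s₀ - A s) := by
    push_cast; ring
  rw [this, mul_add, mul_left_comm, mul_left_comm _ (t : ℂ), Complex.add_im, Complex.im_ofReal_mul,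
    Complex.im_ofReal_mul]
  have : 0 ≤ 1 - t := by linarith
  positivity

/-- Leave out the side through `w`. The other ratios multiply to the inverse of a negative number,
so their arguments sum to an odd multiple of π, and this sum is nonnegative. Disjointness of the
sides guarantees that no other side contains `w`, so that views and arguments agree. -/
theorem pi_le_sum_view_of_mem_side
    (hdis : ∀ s ∈ C, ∀ s' ∈ C, s ≠ s' → ∀ t t' : ℝ, 0 < t → t ≤ 1 → 0 < t' → t' ≤ 1 →
      A s + t * (B s - A s) ≠ A s' + t' * (B s' - A s'))
    (hC : ∀ s, p s ∈ C ↔ s ∈ C) (hAB : ∀ s, A (p s) = B s)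
    (hne : ∀ s ∈ C, A s ≠ B s)
    (hleft : ∀ s ∈ C, ∀ s' ∈ C, 0 ≤ (conj (B s - A s) * (A s' - A s)).im)
    {s₀ : ι} (hs₀ : s₀ ∈ C) {t : ℝ} (h0 : 0 < t) (h1 : t < 1) {w : ℂ}
    (hw : w = A s₀ + t * (B s₀ - A s₀)) :
    Real.pi ≤ ∑ s ∈ C, view (A s) (B s) w := by
  classical
  have hpi := Real.pi_pos
  have hB : ∀ s ∈ C, B s ≠ w := by
    intro s hs h
    by_cases hss : s = s₀
    · rw [hss, hw] at h
      have h2 : ((1 - t : ℝ) : ℂ) * (B s₀ - A s₀) = 0 := by push_cast; linear_combination h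
      rcases mul_eq_zero.1 h2 with h3 | h3
      · have : 1 - t = 0 := by exact_mod_cast h3
        linarith
      · exact hne s₀ hs₀ (sub_eq_zero.1 h3).symm
    · refine hdis s hs s₀ hs₀ hss 1 t one_pos le_rfl h0 h1.le ?_
      rw [← hw, ← h]; push_cast; ring
  have hA : ∀ s ∈ C, A s ≠ w := by
    intro s hs
    have h2 : p (p.symm s) = s := p.apply_symm_apply s
    have := hB (p.symm s) ((hC _).1 (by rwa [h2]))
    rwa [← hAB, h2] at this
  have hview : ∀ s ∈ C \ {s₀}, view (A s) (B s) w = arg ((B s - w) / (A s - w)) := by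
    intro s hs
    rw [mem_sdiff, mem_singleton] at hs
    refine symArg_of_ne fun h => ?_
    obtain ⟨t', h2, h3, h4⟩ := mem_segment_of_arg_eq_pi h
    exact hdis s hs.1 s₀ hs₀ hs.2 t' t h2 h3.le h0 h1.le (by rw [← h4, hw])
  have hA0 : ∀ s ∈ C, A s - w ≠ 0 := fun s hs => sub_ne_zero.2 (hA s hs)
  have hB0 : ∀ s ∈ C, B s - w ≠ 0 := fun s hs => sub_ne_zero.2 (hB s hs)
  have hprod : (∏ s ∈ C \ {s₀}, (B s - w) / (A s - w)) * ((B s₀ - w) / (A s₀ - w)) = 1 := by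
    rw [← Finset.prod_eq_prod_sdiff_singleton_mul hs₀, Finset.prod_div_distrib, prod_sub_eq hC hAB,
      div_self (Finset.prod_ne_zero_iff.2 hA0)]
  have hratio : (A s₀ - w) / (B s₀ - w) = ((-(t / (1 - t)) : ℝ) : ℂ) := by
    rw [div_eq_iff (hB0 s₀ hs₀), hw]
    have h2 : (1 - t : ℂ) ≠ 0 := by exact_mod_cast (sub_pos.2 h1).ne'
    push_cast
    field_simp
    ring
  have hprod' : ∏ s ∈ C \ {s₀}, (B s - w) / (A s - w) = ((-(t / (1 - t)) : ℝ) : ℂ) := by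
    rw [← hratio, ← inv_div]
    exact eq_inv_of_mul_eq_one_left hprod
  obtain ⟨k, hk⟩ := exists_sum_arg_eq (C \ {s₀}) (fun s => (B s - w) / (A s - w))
    fun s hs => div_ne_zero (hB0 s (mem_sdiff.1 hs).1) (hA0 s (mem_sdiff.1 hs).1)
  rw [hprod', Complex.arg_ofReal_of_neg (by
    have := div_pos h0 (sub_pos.2 h1); linarith), ← Finset.sum_congr rfl hview] at hk
  have hnn : ∀ s ∈ C, 0 ≤ view (A s) (B s) w := fun s hs => view_nonneg (by
    rw [hw]; exact left_of_mem_side hC hAB hleft hs₀ h0.le h1.le hs)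
  have hle : ∑ s ∈ C \ {s₀}, view (A s) (B s) w ≤ ∑ s ∈ C, view (A s) (B s) w :=
    Finset.sum_le_sum_of_subset_of_nonneg sdiff_subset fun s hs _ => hnn s hs
  have h2 : 0 ≤ ∑ s ∈ C \ {s₀}, view (A s) (B s) w :=
    Finset.sum_nonneg fun s hs => hnn s (mem_sdiff.1 hs).1
  rw [hk] at h2 hle
  have : (-1 : ℝ) < k := by nlinarith
  have : (0 : ℝ) ≤ k := by exact_mod_cast (show (0 : ℤ) ≤ k by have : (-1 : ℤ) < k := (by exact_mod_cast this); omega)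
  nlinarith

/-- Here both sides at the vertex are left out. The remaining ratios multiply to the ratio of these
two sides, whose argument is the interior angle. -/
theorem interior_angle_le_sum_view
    (hdis : ∀ s ∈ C, ∀ s' ∈ C, s ≠ s' → ∀ t t' : ℝ, 0 < t → t ≤ 1 → 0 < t' → t' ≤ 1 →
      A s + t * (B s - A s) ≠ A s' + t' * (B s' - A s'))
    (hC : ∀ s, p s ∈ C ↔ s ∈ C) (hAB : ∀ s, A (p s) = B s)
    (hne : ∀ s ∈ C, A s ≠ B s)
    (hleft : ∀ s ∈ C, ∀ s' ∈ C, 0 ≤ (conj (B s - A s) * (A s' - A s)).im)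
    {s₀ : ι} (hs₀ : s₀ ∈ C) :
    arg (-(B s₀ - A s₀) / (B (p s₀) - A (p s₀))) ≤ ∑ s ∈ C, view (A s) (B s) (B s₀) := by
  classical
  have hpi := Real.pi_pos
  set w := B s₀ with hw
  have hps₀ : p s₀ ∈ C := (hC s₀).2 hs₀
  have hpne : p s₀ ≠ s₀ := by
    intro h
    have := hAB s₀
    rw [h] at this
    exact hne s₀ hs₀ this
  have hB : ∀ s ∈ C, s ≠ s₀ → B s - w ≠ 0 := by
    intro s hs hss h
    refine hdis s hs s₀ hs₀ hss 1 1 one_pos le_rfl one_pos le_rfl ?_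
    push_cast
    linear_combination h
  have hA : ∀ s ∈ C, s ≠ p s₀ → A s - w ≠ 0 := by
    intro s hs hss
    have h2 : p (p.symm s) = s := p.apply_symm_apply s
    have := hB (p.symm s) ((hC _).1 (by rwa [h2])) (by rintro h3; rw [← h3, h2] at hss; exact hss rfl)
    rwa [← hAB, h2] at this
  set D := (C \ {s₀}) \ {p s₀} with hD
  have hDC : ∀ s ∈ D, s ∈ C ∧ s ≠ s₀ ∧ s ≠ p s₀ := fun s hs => by
    simpa [hD, and_assoc] using hs
  have hview : ∀ s ∈ D, view (A s) (B s) w = arg ((B s - w) / (A s - w)) := by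
    intro s hs
    obtain ⟨h1, h2, h3⟩ := hDC s hs
    refine symArg_of_ne fun h => ?_
    obtain ⟨t', h4, h5, h6⟩ := mem_segment_of_arg_eq_pi h
    exact hdis s h1 s₀ hs₀ h2 t' 1 h4 h5.le one_pos le_rfl (by rw [← h6]; push_cast; ring)
  have hmem : p s₀ ∈ C \ {s₀} := by simp [hps₀, hpne]
  have hmem' : s₀ ∈ C \ {p s₀} := by simp [hs₀, hpne.symm]
  have hprodB : ∏ s ∈ C \ {s₀}, (B s - w) = ∏ s ∈ C \ {p s₀}, (A s - w) := by
    refine Finset.prod_equiv p (fun s => ?_) fun s _ => by rw [hAB]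
    simp [hC]
  rw [Finset.prod_eq_prod_sdiff_singleton_mul hmem, Finset.prod_eq_prod_sdiff_singleton_mul hmem',
    sdiff_right_comm, sdiff_right_comm C, ← hD] at hprodB
  have hD' : (C \ {p s₀}) \ {s₀} = D := by rw [hD, sdiff_right_comm]
  have hprodA : ∏ s ∈ D, (A s - w) ≠ 0 :=
    Finset.prod_ne_zero_iff.2 fun s hs => hA s (hDC s hs).1 (hDC s hs).2.2
  have hprod : ∏ s ∈ D, (B s - w) / (A s - w) = -(B s₀ - A s₀) / (B (p s₀) - A (p s₀)) := by
    rw [Finset.prod_div_distrib, hAB, ← hw, div_eq_div_iff hprodA (hB _ hps₀ hpne)]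
    linear_combination hprodB
  obtain ⟨k, hk⟩ := exists_sum_arg_eq D (fun s => (B s - w) / (A s - w))
    fun s hs => div_ne_zero (hB s (hDC s hs).1 (hDC s hs).2.1) (hA s (hDC s hs).1 (hDC s hs).2.2)
  rw [hprod, ← Finset.sum_congr rfl hview] at hk
  have hnn : ∀ s ∈ C, 0 ≤ view (A s) (B s) w := fun s hs => view_nonneg (by
    have := left_of_mem_side hC hAB hleft hs₀ zero_le_one le_rfl hs
    rw [hw]; convert this using 4; push_cast; ring)
  have hle : ∑ s ∈ D, view (A s) (B s) w ≤ ∑ s ∈ C, view (A s) (B s) w :=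
    Finset.sum_le_sum_of_subset_of_nonneg (fun s hs => (hDC s hs).1) fun s hs _ => hnn s hs
  have h2 : 0 ≤ ∑ s ∈ D, view (A s) (B s) w :=
    Finset.sum_nonneg fun s hs => hnn s (hDC s hs).1
  rw [hk] at h2 hle
  have h3 := arg_le_pi (-(B s₀ - A s₀) / (B (p s₀) - A (p s₀)))
  have : (-1 : ℝ) < k := by nlinarith
  have : (0 : ℝ) ≤ k := by exact_mod_cast (show (0 : ℤ) ≤ k by have : (-1 : ℤ) < k := (by exact_mod_cast this); omega)
  nlinarith

end Cycle

end PlanarPolygon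

/-! ### Triangles with a vertex at the origin, and polygons that are star-shaped around it. -/

namespace PlanarPolygon

open Complex Finset

/-- The three angles of a positively oriented triangle with a vertex at the origin. -/
theorem sum_angles_triangle {a b : ℂ} (h : 0 < (conj a * b).im) :
    arg (-a / (b - a)) + arg ((a - b) / -b) = Real.pi - arg (b / a) := by
  have hpi := Real.pi_pos
  have h1 : 0 < (conj (b - a) * (0 - a)).im := by
    have : (conj (b - a) * (0 - a)).im = (conj a * b).im := by simp; ring
    rwa [this]
  have h2 : 0 < (conj (0 - b) * (a - b)).im := by
    have : (conj (0 - b) * (a - b)).im = (conj a * b).im := by simp; ring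
    rwa [this]
  have h3 : 0 < (conj (a - 0) * (b - 0)).im := by simpa using h
  have hdiv : ∀ u v : ℂ, 0 < (conj u * v).im → 0 < arg (v / u) ∧ arg (v / u) < Real.pi := by
    intro u v huv
    have : 0 < (v / u).im := by
      have hu : u ≠ 0 := by rintro rfl; simp at huv
      rw [div_eq_mul_inv, Complex.inv_def, ← mul_assoc, Complex.im_mul_ofReal, mul_comm v]
      exact mul_pos huv (inv_pos.2 (normSq_pos.2 hu))
    exact arg_mem_of_im_pos this
  have k1 := hdiv _ _ h1
  have k2 := hdiv _ _ h2
  have k3 := hdiv _ _ h3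
  simp only [zero_sub, sub_zero] at k1 k2 k3
  have ha : a ≠ 0 := by rintro rfl; simp at h
  have hb : b ≠ 0 := by rintro rfl; simp at h
  have hab : a - b ≠ 0 := by
    intro hab; rw [sub_eq_zero.1 hab, mul_comm, Complex.mul_conj] at h; simp at h
  have hba : b - a ≠ 0 := by rwa [← neg_sub, neg_ne_zero]
  obtain ⟨k, hk⟩ := exists_sum_arg_eq univ ![-a / (b - a), (a - b) / -b, b / a] (by
    intro i _
    fin_cases i
    · exact div_ne_zero (neg_ne_zero.2 ha) hba
    · exact div_ne_zero hab (neg_ne_zero.2 hb)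
    · exact div_ne_zero hb ha)
  rw [Fin.prod_univ_three, Fin.sum_univ_three] at hk
  simp only [Matrix.cons_val_zero, Matrix.cons_val_one, Matrix.cons_val] at hk
  have hprod : -a / (b - a) * ((a - b) / -b) * (b / a) = -1 := by
    rw [div_mul_div_comm, div_mul_div_comm, div_eq_iff
      (mul_ne_zero (mul_ne_zero hba (neg_ne_zero.2 hb)) ha)]
    ring
  rw [hprod, Complex.arg_neg_one] at hk
  have : (-1 : ℝ) < k := by nlinarith
  have : (-1 : ℤ) < k := by exact_mod_cast this
  have : (k : ℝ) < 1 := by nlinarith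
  have : k < 1 := by exact_mod_cast this
  have : k = 0 := by omega
  subst this
  push_cast at hk
  linarith

/-- The angle at which the triangle `0, a, b` is seen. -/
noncomputable def triangleView (a b w : ℂ) : ℝ := view 0 a w + view a b w + view b 0 w

/-- Such a point is strictly on the right of one of the two sides through the origin. -/
theorem triangleView_eq_zero {a b w : ℂ} (h : 0 < (conj a * b).im)
    (hw : (conj a * w).im < 0 ∨ 0 < (conj b * w).im) : triangleView a b w = 0 := by
  have hC : ∀ s : Fin 3, finRotate 3 s ∈ (univ : Finset (Fin 3)) ↔ s ∈ (univ : Finset (Fin 3)) :=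
    fun s => by simp
  have hAB : ∀ s : Fin 3, (![0, a, b] : Fin 3 → ℂ) (finRotate 3 s) = ![a, b, 0] s := by
    intro s; fin_cases s <;> rfl
  have key : ∀ s₀ : Fin 3,
      (∀ s ∈ (univ : Finset (Fin 3)), 0 ≤ (conj ((![a, b, 0] : Fin 3 → ℂ) s₀ -
        (![0, a, b] : Fin 3 → ℂ) s₀) * ((![0, a, b] : Fin 3 → ℂ) s -
        (![0, a, b] : Fin 3 → ℂ) s₀)).im) →
      (conj ((![a, b, 0] : Fin 3 → ℂ) s₀ - (![0, a, b] : Fin 3 → ℂ) s₀) *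
        (w - (![0, a, b] : Fin 3 → ℂ) s₀)).im < 0 → triangleView a b w = 0 := by
    intro s₀ h1 h2
    have := sum_view_eq_zero_of_right hC hAB h1 h2
    rw [Fin.sum_univ_three] at this
    simpa [triangleView] using this
  rcases hw with hw | hw
  · refine key 0 (fun s _ => ?_) (by simpa using hw)
    fin_cases s
    · simp
    · simp; linarith
    · simp at h ⊢; linarith
  · refine key 2 (fun s _ => ?_) (by simp at hw ⊢; linarith)
    fin_cases s
    · simp; linarith
    · simp at h ⊢; linarith
    · simp

theorem view_zero_left_mem {a w : ℂ} (h : 0 < (conj a * w).im) :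
    0 < view 0 a w ∧ view 0 a w < Real.pi :=
  view_mem_of_left (by simpa using h)

theorem left_of_zero_right {b w : ℂ} (h : (conj b * w).im < 0) :
    0 < (conj (0 - b) * (w - b)).im := by
  have : (conj (0 - b) * (w - b)).im = -(conj b * w).im := by simp; ring
  rw [this]; linarith

theorem view_zero_right_mem {b w : ℂ} (h : (conj b * w).im < 0) :
    0 < view b 0 w ∧ view b 0 w < Real.pi :=
  view_mem_of_left (left_of_zero_right h)

/-- The three arguments sum to a multiple of 2π that is below 3π. If `w` is inside the side from `a`
to `b`, the argument π of that side is counted as zero, which improves the bound to π. -/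
theorem triangleView_le_two_pi {a b w : ℂ} (ha : 0 < (conj a * w).im)
    (hb : (conj b * w).im < 0) : triangleView a b w ≤ 2 * Real.pi ∧
      (arg ((b - w) / (a - w)) = Real.pi → triangleView a b w ≤ Real.pi) := by
  have hpi := Real.pi_pos
  have h1 := view_zero_left_mem ha
  have h2 := view_zero_right_mem hb
  have h3 := abs_lt.1 (abs_view_lt a b w)
  have hl1 : 0 < (conj (a - 0) * (w - 0)).im := by simpa using ha
  have hl2 := left_of_zero_right hb
  have hw0 : (0 : ℂ) - w ≠ 0 := sub_ne_zero.2 (ne_of_left hl1.ne').1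
  have haw : a - w ≠ 0 := sub_ne_zero.2 (ne_of_left hl1.ne').2
  have hbw : b - w ≠ 0 := sub_ne_zero.2 (ne_of_left hl2.ne').1
  obtain ⟨k, hk⟩ := exists_sum_arg_eq univ
    ![(a - w) / (0 - w), (b - w) / (a - w), (0 - w) / (b - w)] (by
    intro i _
    fin_cases i
    · exact div_ne_zero haw hw0
    · exact div_ne_zero hbw haw
    · exact div_ne_zero hw0 hbw)
  rw [Fin.prod_univ_three, Fin.sum_univ_three] at hk
  simp only [Matrix.cons_val_zero, Matrix.cons_val_one, Matrix.cons_val] at hk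
  have hprod : (a - w) / (0 - w) * ((b - w) / (a - w)) * ((0 - w) / (b - w)) = 1 := by
    field_simp
  rw [hprod, Complex.arg_one, zero_add, ← view_eq_arg_of_left hl1, ← view_eq_arg_of_left hl2] at hk
  unfold triangleView
  by_cases hpi' : arg ((b - w) / (a - w)) = Real.pi
  · have h4 : view a b w = 0 := symArg_of_eq hpi'
    rw [hpi'] at hk
    have : (k : ℝ) < 2 := by nlinarith
    have : k < 2 := by exact_mod_cast this
    have : (k : ℝ) ≤ 1 := by exact_mod_cast (show k ≤ 1 by omega)
    rw [h4]
    exact ⟨by nlinarith, fun _ => by nlinarith⟩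
  · refine ⟨?_, fun h => absurd h hpi'⟩
    have h4 : view a b w = arg ((b - w) / (a - w)) := symArg_of_ne hpi'
    rw [← h4] at hk
    have : (k : ℝ) < 2 := by nlinarith
    have : k < 2 := by exact_mod_cast this
    have : (k : ℝ) ≤ 1 := by exact_mod_cast (show k ≤ 1 by omega)
    nlinarith

theorem symArg_of_im_eq_zero {r : ℂ} (h : r.im = 0) : symArg r = 0 := by
  rcases le_or_gt 0 r.re with h0 | h0
  · have : arg r = 0 := Complex.arg_eq_zero_iff.2 ⟨h0, h⟩
    rw [symArg_of_ne (by rw [this]; exact Real.pi_pos.ne), this]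
  · exact symArg_of_eq (Complex.arg_eq_pi_iff.2 ⟨h0, h⟩)

theorem arg_of_im_eq_zero {r : ℂ} (h : r.im = 0) : arg r = 0 ∨ arg r = Real.pi := by
  rcases le_or_gt 0 r.re with h0 | h0
  · exact Or.inl (Complex.arg_eq_zero_iff.2 ⟨h0, h⟩)
  · exact Or.inr (Complex.arg_eq_pi_iff.2 ⟨h0, h⟩)

/-- On the ray through `a` one side is seen at zero angle. For `l ≠ 1` the other two ratios have a
real product, so their arguments sum to a multiple of π below 2π. At `a` itself only the side from
`b` to the origin is seen, at the interior angle. -/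
theorem triangleView_ray_left {a b : ℂ} (h : 0 < (conj a * b).im) {l : ℝ} (hl : 0 < l) :
    triangleView a b (l * a) ≤ Real.pi ∧
      (l = 1 → triangleView a b (l * a) = arg (-a / (b - a))) := by
  have hpi := Real.pi_pos
  have ha : a ≠ 0 := by rintro rfl; simp at h
  have hl' : (l : ℂ) ≠ 0 := by exact_mod_cast hl.ne'
  have hb : (conj b * (l * a)).im < 0 := by
    have : (conj b * (l * a)).im = -(l * (conj a * b).im) := by simp; ring
    rw [this]; have := mul_pos hl h; linarith
  have h1 : view 0 a (l * a) = 0 := by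
    have : (a - l * a) / (0 - l * a) = ((-(1 - l) / l : ℝ) : ℂ) := by
      push_cast; field_simp; ring
    rw [view, this]; exact symArg_of_im_eq_zero (ofReal_im _)
  have hl2 := left_of_zero_right hb
  have h2 := view_zero_right_mem hb
  have h3 := abs_lt.1 (abs_view_lt a b (l * a))
  unfold triangleView
  rw [h1, zero_add]
  by_cases h1l : l = 1
  · subst h1l
    rw [ofReal_one, one_mul, view_self_left, zero_add] at *
    refine ⟨h2.2.le, fun _ => ?_⟩
    rw [view_eq_arg_of_left hl2, zero_sub]
  · refine ⟨?_, fun h' => absurd h' h1l⟩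
    have hne : arg ((b - l * a) / (a - l * a)) ≠ Real.pi := by
      intro hpi'
      obtain ⟨t, h0, _, ht⟩ := mem_segment_of_arg_eq_pi hpi'
      have h4 : (conj a * (l * a)).im = t * (conj a * b).im := by rw [ht]; simp; ring
      have h5 : (conj a * (l * a)).im = 0 := by simp; ring
      have := mul_pos h0 h
      linarith
    have h4 : view a b (l * a) = arg ((b - l * a) / (a - l * a)) := symArg_of_ne hne
    have hw0 : (0 : ℂ) - l * a ≠ 0 := by rw [zero_sub]; exact neg_ne_zero.2 (mul_ne_zero hl' ha)
    have h1l' : (1 : ℂ) - l ≠ 0 := sub_ne_zero.2 (by exact_mod_cast Ne.symm h1l)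
    have haw : a - l * a ≠ 0 := by
      rw [show a - l * a = (1 - l) * a by ring]; exact mul_ne_zero h1l' ha
    have hbw : b - l * a ≠ 0 := sub_ne_zero.2 (ne_of_left hl2.ne').1
    obtain ⟨k, hk⟩ := exists_sum_arg_eq univ
      ![(b - l * a) / (a - l * a), (0 - l * a) / (b - l * a)] (by
      intro i _
      fin_cases i
      · exact div_ne_zero hbw haw
      · exact div_ne_zero hw0 hbw)
    rw [Fin.prod_univ_two, Fin.sum_univ_two] at hk
    simp only [Matrix.cons_val_zero, Matrix.cons_val_one] at hk
    have hprod : (b - l * a) / (a - l * a) * ((0 - l * a) / (b - l * a)) =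
        ((-(l / (1 - l)) : ℝ) : ℂ) := by
      rw [show a - l * a = (1 - l) * a by ring]
      push_cast; field_simp; ring
    rw [← h4, ← view_eq_arg_of_left hl2, hprod] at hk
    rcases arg_of_im_eq_zero (ofReal_im (-(l / (1 - l)))) with h5 | h5
    all_goals
      rw [h5] at hk
      have : (k : ℝ) < 1 := by nlinarith
      have : k < 1 := by exact_mod_cast this
      have : (k : ℝ) ≤ 0 := by exact_mod_cast (show k ≤ 0 by omega)
      nlinarith

theorem symArg_conj (r : ℂ) : symArg (conj r) = -symArg r := by
  unfold symArg
  rw [Complex.arg_conj]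
  split_ifs with h1 h2 h2
  · simp
  · exact absurd rfl h2
  · have := neg_pi_lt_arg r; linarith
  · rfl

theorem view_conj (a b w : ℂ) : view (conj a) (conj b) (conj w) = -view a b w := by
  unfold view
  rw [← map_sub, ← map_sub, ← map_div₀, symArg_conj]

/-- Complex conjugation exchanges the two rays. -/
theorem triangleView_ray_right {a b : ℂ} (h : 0 < (conj a * b).im) {l : ℝ} (hl : 0 < l) :
    triangleView a b (l * b) ≤ Real.pi ∧
      (l = 1 → triangleView a b (l * b) = arg ((a - b) / -b)) := by
  have h' : 0 < (conj (conj b) * conj a).im := by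
    have : (conj (conj b) * conj a).im = (conj a * b).im := by simp; ring
    rwa [this]
  have key : triangleView a b (l * b) = triangleView (conj b) (conj a) (l * conj b) := by
    have hl : (l : ℂ) * conj b = conj (l * b) := by simp
    unfold triangleView
    rw [hl, ← map_zero conj, view_conj, view_conj, view_conj, map_zero,
      view_swap a 0, view_swap 0 b, view_swap b a]
    ring
  have h2 := triangleView_ray_left h' hl
  rw [key]
  refine ⟨h2.1, fun hl1 => ?_⟩
  rw [h2.2 hl1, ← map_neg, ← map_sub, ← map_div₀, Complex.arg_conj, ← inv_div (-b), Complex.arg_inv]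

section Star

variable {ι : Type*} [Fintype ι] {nx : Equiv.Perm ι} {T : ι → ℂ}

/-- The angle at which a closed polygon is seen. -/
noncomputable def outerView (nx : Equiv.Perm ι) (T : ι → ℂ) (w : ℂ) : ℝ :=
  ∑ d, view (T d) (T (nx d)) w

/-- Each segment from the origin to a vertex is traversed once in each direction and cancels. -/
theorem outerView_eq_sum_triangleView (w : ℂ) :
    outerView nx T w = ∑ d, triangleView (T d) (T (nx d)) w := by
  unfold outerView triangleView
  rw [Finset.sum_add_distrib, Finset.sum_add_distrib]
  have : ∑ d, view (T (nx d)) 0 w = -∑ d, view 0 (T d) w := by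
    rw [← Equiv.sum_comp nx fun d => view 0 (T d) w, ← Finset.sum_neg_distrib]
    exact Finset.sum_congr rfl fun d _ => view_swap _ _ _
  rw [this]; ring

theorem im_neg_div (a w : ℂ) : (-a / w).im = (conj a * w).im / normSq w := by
  rw [div_eq_mul_inv, Complex.inv_def, ← mul_assoc, Complex.im_mul_ofReal, div_eq_mul_inv]
  congr 1
  simp
  ring

theorem arg_pos_of_left {a w : ℂ} (hw : w ≠ 0) : (0 < arg (-a / w) ∧ arg (-a / w) < Real.pi) ↔
    0 < (conj a * w).im := by
  rw [← div_pos_iff_of_pos_right (a := (conj a * w).im) (normSq_pos.2 hw), ← im_neg_div]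
  exact ⟨fun h => im_pos_of_arg_mem h.1 h.2, arg_mem_of_im_pos⟩

theorem arg_neg_of_right {a w : ℂ} (hw : w ≠ 0) : arg (-a / w) < 0 ↔ (conj a * w).im < 0 := by
  rw [← not_le, Complex.arg_nonneg_iff, not_le, im_neg_div]
  have := normSq_pos.2 hw
  rw [div_lt_iff₀ this, zero_mul]

theorem ne_zero_of_star {ι : Type*} {nx : Equiv.Perm ι} {T : ι → ℂ}
    (hstar : ∀ d, 0 < (conj (T d) * T (nx d)).im) (d : ι) : T d ≠ 0 := by
  intro h
  have := hstar d
  simp [h] at this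

theorem arg_succ_mem {ι : Type*} {nx : Equiv.Perm ι} {T : ι → ℂ}
    (hstar : ∀ d, 0 < (conj (T d) * T (nx d)).im) (d : ι) :
    0 < arg (T (nx d) / T d) ∧ arg (T (nx d) / T d) < Real.pi := by
  refine arg_mem_of_im_pos ?_
  rw [div_eq_mul_inv, Complex.inv_def, ← mul_assoc, Complex.im_mul_ofReal, mul_comm (T (nx d))]
  exact mul_pos (hstar d) (inv_pos.2 (normSq_pos.2 (ne_zero_of_star hstar d)))

/-- A polygon which winds once around the origin crosses each ray exactly once. -/
theorem exists_sector (hstar : ∀ d, 0 < (conj (T d) * T (nx d)).im)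
    (hsum : ∑ d, arg (T (nx d) / T d) = 2 * Real.pi) {w : ℂ} (hw : w ≠ 0) :
    ∃ d₀, (arg (-T (nx d₀) / w) = arg (-T d₀ / w) + arg (T (nx d₀) / T d₀) - 2 * Real.pi) ∧
      ∀ d, d ≠ d₀ → arg (-T (nx d) / w) = arg (-T d / w) + arg (T (nx d) / T d) := by
  classical
  have hpi := Real.pi_pos
  have hT := ne_zero_of_star hstar
  -- Taking arguments of `-T d / w` places the cut of `arg` along the ray through `w`, so `m d`
  -- counts the crossings of this ray. All crossings are counterclockwise, and the total turning 2π
  -- allows exactly one.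
  have hm : ∀ d, ∃ k : ℤ, arg (-T (nx d) / w) = arg (-T d / w) + arg (T (nx d) / T d)
      - 2 * Real.pi * k := by
    intro d
    have h1 := Complex.arg_mul_coe_angle (div_ne_zero (neg_ne_zero.2 (hT d)) hw)
      (div_ne_zero (hT (nx d)) (hT d))
    have h2 : -T d / w * (T (nx d) / T d) = -T (nx d) / w := by
      have := hT d; field_simp
    rw [h2, ← Real.Angle.coe_add] at h1
    obtain ⟨k, hk⟩ := Real.Angle.angle_eq_iff_two_pi_dvd_sub.1 h1
    exact ⟨-k, by push_cast; linarith⟩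
  choose m hm using hm
  have hm0 : ∀ d, 0 ≤ m d := by
    intro d
    have h1 := neg_pi_lt_arg (-T d / w)
    have h2 := arg_le_pi (-T (nx d) / w)
    have h3 := (arg_succ_mem hstar d).1
    have h4 := hm d
    have : (-1 : ℝ) < m d := by nlinarith
    have : -1 < m d := by exact_mod_cast this
    omega
  have hmsum : ∑ d, m d = 1 := by
    have h1 : ∑ d, arg (-T (nx d) / w) = ∑ d, arg (-T d / w) :=
      Equiv.sum_comp nx fun d => arg (-T d / w)
    have h2 := Finset.sum_congr (rfl : (univ : Finset ι) = univ) fun d _ => hm d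
    rw [Finset.sum_sub_distrib, Finset.sum_add_distrib, hsum, h1, ← Finset.mul_sum] at h2
    have h3 : 2 * Real.pi * (∑ d, (m d : ℝ)) = 2 * Real.pi * 1 := by linarith
    have h4 := mul_left_cancel₀ (by positivity) h3
    exact_mod_cast h4
  obtain ⟨d₀, hd₀⟩ : ∃ d₀, 0 < m d₀ := by
    by_contra hcon
    push Not at hcon
    have : ∑ d, m d ≤ 0 := Finset.sum_nonpos fun d _ => hcon d
    omega
  have hrest : m d₀ + ∑ d ∈ univ.erase d₀, m d = 1 := by
    rw [Finset.add_sum_erase _ _ (mem_univ d₀), hmsum]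
  have hnn : 0 ≤ ∑ d ∈ univ.erase d₀, m d := Finset.sum_nonneg fun d _ => hm0 d
  refine ⟨d₀, ?_, fun d hd => ?_⟩
  · have : m d₀ = 1 := by omega
    rw [hm d₀, this]; push_cast; ring
  · have h0 : ∑ d ∈ univ.erase d₀, m d = 0 := by omega
    have := (Finset.sum_eq_zero_iff_of_nonneg fun d _ => hm0 d).1 h0 d (mem_erase.2 ⟨hd, mem_univ d⟩)
    rw [hm d, this]; push_cast; ring

theorem outerView_zero (hstar : ∀ d, 0 < (conj (T d) * T (nx d)).im)
    (hsum : ∑ d, arg (T (nx d) / T d) = 2 * Real.pi) : outerView nx T 0 = 2 * Real.pi := by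
  rw [← hsum]
  refine Finset.sum_congr rfl fun d _ => ?_
  rw [view, sub_zero, sub_zero, symArg_of_ne (arg_succ_mem hstar d).2.ne]

/-- The angle at which a star-shaped polygon is seen, in terms of one or two triangles. -/
theorem outerView_cases (hstar : ∀ d, 0 < (conj (T d) * T (nx d)).im)
    (hsum : ∑ d, arg (T (nx d) / T d) = 2 * Real.pi) {w : ℂ} (hw : w ≠ 0) :
    (∃ d, 0 < (conj (T d) * w).im ∧ (conj (T (nx d)) * w).im < 0 ∧
      outerView nx T w = triangleView (T d) (T (nx d)) w ∧
      ∀ d', 0 < (conj (T d') * w).im → (conj (T (nx d')) * w).im < 0 → d' = d) ∨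
    (∃ d, ∃ l : ℝ, 0 < l ∧ w = l * T (nx d) ∧
      outerView nx T w = triangleView (T d) (T (nx d)) w +
        triangleView (T (nx d)) (T (nx (nx d))) w ∧
      (∀ d' , 0 < (conj (T d') * w).im → ¬ (conj (T (nx d')) * w).im < 0) ∧
      ∀ d', arg (-T d' / w) = Real.pi → d' = nx d) := by
  classical
  have hpi := Real.pi_pos
  obtain ⟨d₀, h₀, hd⟩ := exists_sector hstar hsum hw
  have ha := arg_succ_mem hstar
  have hle := fun d => arg_le_pi (-T d / w)
  have hgt := fun d => neg_pi_lt_arg (-T d / w)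
  have hpiuniq : ∀ d, arg (-T d / w) = Real.pi → d = d₀ := by
    intro d h
    by_contra hne
    have h1 := hd d hne
    have h2 := (ha d).1
    have h3 := hle (nx d)
    linarith
  have hzero : ∀ d, d ≠ d₀ → nx d ≠ d₀ → triangleView (T d) (T (nx d)) w = 0 := by
    intro d h1 h2
    refine triangleView_eq_zero (hstar d) ?_
    have h3 := hd d h1
    have h4 := (ha d).1
    rcases lt_or_ge (arg (-T d / w)) 0 with h5 | h5
    · exact Or.inl ((arg_neg_of_right hw).1 h5)
    · refine Or.inr ((arg_pos_of_left hw).1 ⟨by linarith, lt_of_le_of_ne (hle _) ?_⟩)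
      exact fun h6 => h2 (hpiuniq _ h6)
  have hsect : ∀ d', 0 < (conj (T d') * w).im → (conj (T (nx d')) * w).im < 0 → d' = d₀ := by
    intro d' h1 h2
    by_contra hne
    have h3 := hd d' hne
    have h4 := (ha d').1
    have h5 := (arg_pos_of_left hw).2 h1
    have h6 := (arg_neg_of_right hw).2 h2
    linarith [h5.1]
  have h1 := (ha d₀)
  have hnx := hgt (nx d₀)
  rw [outerView_eq_sum_triangleView]
  -- The ray through `w` contains the vertex `T d₀`, and both triangles at this vertex count;
  -- otherwise it crosses a single side and only one triangle counts.
  by_cases hp : arg (-T d₀ / w) = Real.pi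
  · right
    set d := nx.symm d₀ with hdd
    have hnd : nx d = d₀ := nx.apply_symm_apply d₀
    have hne : d ≠ d₀ := by
      intro h
      rw [h] at hnd
      have := hstar d₀
      rw [hnd, mul_comm, Complex.mul_conj] at this
      simp at this
    rw [Complex.arg_eq_pi_iff] at hp
    obtain ⟨r, hr⟩ : ∃ r : ℝ, -T d₀ / w = r :=
      ⟨(-T d₀ / w).re, Complex.ext (by simp) (by simp [hp.2])⟩
    have hr0 : r < 0 := by have := hp.1; rwa [hr, ofReal_re] at this
    refine ⟨d, -r⁻¹, by rw [neg_pos]; exact inv_lt_zero.2 hr0, ?_, ?_, ?_, ?_⟩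
    · rw [hnd]
      have hrc : (r : ℂ) ≠ 0 := by exact_mod_cast hr0.ne
      push_cast
      rw [div_eq_iff hw] at hr
      field_simp
      linear_combination -hr
    · rw [hnd, ← Finset.add_sum_erase _ _ (mem_univ d₀),
        ← Finset.add_sum_erase _ _ (mem_erase.2 ⟨hne, mem_univ d⟩), hnd,
        Finset.sum_eq_zero, add_zero, add_comm]
      intro d' hd'
      rw [mem_erase, mem_erase] at hd'
      refine hzero d' hd'.2.1 fun h => hd'.1 ?_
      rw [hdd, ← h, Equiv.symm_apply_apply]
    · intro d' h2 h3
      have := hsect d' h2 h3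
      rw [this] at h2
      have h4 := (arg_pos_of_left hw).2 h2
      rw [Complex.arg_eq_pi_iff.2 hp] at h4
      exact lt_irrefl _ h4.2
    · intro d' h; rw [hnd]; exact hpiuniq d' h
  · left
    have hlt := lt_of_le_of_ne (hle d₀) hp
    refine ⟨d₀, ?_, ?_, ?_, hsect⟩
    · exact (arg_pos_of_left hw).1 ⟨by linarith [h1.2], hlt⟩
    · refine (arg_neg_of_right hw).1 (by linarith [h1.2])
    · refine Finset.sum_eq_single d₀ (fun d _ hne => ?_) fun h => absurd (mem_univ d₀) h
      by_cases hnd : nx d = d₀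
      · refine triangleView_eq_zero (hstar d) ?_
        have h3 := hd d hne
        have h4 := (ha d).1
        rcases lt_or_ge (arg (-T d / w)) 0 with h5 | h5
        · exact Or.inl ((arg_neg_of_right hw).1 h5)
        · rw [hnd] at h3 h4 ⊢
          exact Or.inr ((arg_pos_of_left hw).1 ⟨by linarith, hlt⟩)
      · exact hzero d hne hnd

theorem outerView_le_two_pi (hstar : ∀ d, 0 < (conj (T d) * T (nx d)).im)
    (hsum : ∑ d, arg (T (nx d) / T d) = 2 * Real.pi) (w : ℂ) : outerView nx T w ≤ 2 * Real.pi := by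
  by_cases hw : w = 0
  · rw [hw]; exact (outerView_zero hstar hsum).le
  rcases outerView_cases hstar hsum hw with ⟨d, h1, h2, h3, _⟩ | ⟨d, l, hl, h1, h2, _⟩
  · rw [h3]; exact (triangleView_le_two_pi h1 h2).1
  · rw [h2, h1]
    have h3 := (triangleView_ray_right (hstar d) hl).1
    have h4 := (triangleView_ray_left (hstar (nx d)) hl).1
    linarith

/-- The ray passes through the vertex itself, so this is the two-triangle case with `l = 1`, in
which each triangle contributes its angle at that vertex. -/
theorem outerView_vertex (hstar : ∀ d, 0 < (conj (T d) * T (nx d)).im)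
    (hsum : ∑ d, arg (T (nx d) / T d) = 2 * Real.pi) (d : ι) :
    outerView nx T (T (nx d)) = arg ((T d - T (nx d)) / -T (nx d)) +
      arg (-T (nx d) / (T (nx (nx d)) - T (nx d))) := by
  have hw := ne_zero_of_star hstar (nx d)
  rcases outerView_cases hstar hsum hw with ⟨d', h1, h2, h3, h4⟩ | ⟨d', l, hl, h1, h2, h3, h4⟩
  · exfalso
    have hself : (conj (T (nx d)) * T (nx d)).im = 0 := by simp; ring
    obtain ⟨d₀, h₀, hd⟩ := exists_sector hstar hsum hw
    have hp : arg (-T (nx d) / T (nx d)) = Real.pi := by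
      rw [neg_div, div_self hw, Complex.arg_neg_one]
    have ha := arg_succ_mem hstar
    have e1 : nx d = d₀ := by
      by_contra hne
      have := hd _ hne
      have := (ha (nx d)).1
      have := arg_le_pi (-T (nx (nx d)) / T (nx d))
      linarith
    have e2 : d' = d₀ := by
      by_contra hne
      have k1 := hd _ hne
      have k2 := (ha d').1
      have k3 := (arg_pos_of_left hw).2 h1
      have k4 := (arg_neg_of_right hw).2 h2
      linarith [k3.1]
    rw [e2, ← e1, hself] at h1
    exact lt_irrefl _ h1
  · have hp : arg (-T (nx d) / T (nx d)) = Real.pi := by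
      rw [neg_div, div_self hw, Complex.arg_neg_one]
    have hdd : d' = d := nx.injective (h4 _ hp).symm
    subst hdd
    have hl1 : l = 1 := by
      have : ((l : ℂ) - 1) * T (nx d') = 0 := by linear_combination -h1
      have := (mul_eq_zero.1 this).resolve_right hw
      exact_mod_cast sub_eq_zero.1 this
    have e1 := (triangleView_ray_right (hstar d') hl).2 hl1
    have e2 := (triangleView_ray_left (hstar (nx d')) hl).2 hl1
    rw [← h1] at e1 e2
    rw [h2, e1, e2]

/-- Only the triangle over this side counts, and `w` is on its side opposite to the origin, where
the bound 2π improves to π. -/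
theorem outerView_le_pi_of_mem_side (hstar : ∀ d, 0 < (conj (T d) * T (nx d)).im)
    (hsum : ∑ d, arg (T (nx d) / T d) = 2 * Real.pi) (d : ι) {t : ℝ} (h0 : 0 < t) (h1 : t < 1)
    {w : ℂ} (hw : w = T d + t * (T (nx d) - T d)) : outerView nx T w ≤ Real.pi := by
  have hl : (conj (T d) * w).im = t * (conj (T d) * T (nx d)).im := by rw [hw]; simp; ring
  have hr : (conj (T (nx d)) * w).im = -((1 - t) * (conj (T d) * T (nx d)).im) := by
    rw [hw]; simp; ring
  have hl' : 0 < (conj (T d) * w).im := by rw [hl]; exact mul_pos h0 (hstar d)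
  have hr' : (conj (T (nx d)) * w).im < 0 := by
    rw [hr, neg_lt_zero]; exact mul_pos (sub_pos.2 h1) (hstar d)
  have hw0 : w ≠ 0 := by rintro rfl; simp at hl'
  rcases outerView_cases hstar hsum hw0 with ⟨d', k1, k2, k3, k4⟩ | ⟨d', l, hl, k1, k2, k3, k4⟩
  · have := k4 d hl' hr'
    subst this
    rw [k3]
    refine (triangleView_le_two_pi hl' hr').2 ?_
    have ht : (1 - t : ℂ) ≠ 0 := by exact_mod_cast (sub_pos.2 h1).ne'
    have hne : T d - w ≠ 0 := by
      intro h
      rw [← sub_eq_zero.1 h] at hl'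
      rw [mul_comm, Complex.mul_conj] at hl'
      simp at hl'
    have : (T (nx d) - w) / (T d - w) = ((-((1 - t) / t) : ℝ) : ℂ) := by
      rw [div_eq_iff hne, hw]
      have ht0 : (t : ℂ) ≠ 0 := by exact_mod_cast h0.ne'
      push_cast; field_simp; ring
    rw [this]
    exact Complex.arg_ofReal_of_neg (by have := div_pos (sub_pos.2 h1) h0; linarith)
  · exact absurd hr' (k3 d hl')

end Star

end PlanarPolygon

/-! ### Linear algebra of planar maps: gradients, stars and corners. -/

noncomputable section

namespace MarkedBipartiteMap

open Finset

variable {E : Type*} [Fintype E] (M : MarkedBipartiteMap E)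

theorem eq_of_invariant {α : Type*} {c : E → α} (hσ : ∀ e, c (M.σ e) = c e)
    (hτ : ∀ e, c (M.τ e) = c e) (e e' : E) : c e = c e' := by
  obtain ⟨g, hg, rfl⟩ := M.connected e e'
  have key : ∀ e, c (g e) = c e := by
    induction hg using Subgroup.closure_induction with
    | mem x hx =>
      rcases hx with rfl | rfl
      · exact hσ
      · exact hτ
    | one => intro e; rfl
    | mul x y _ _ hx hy => intro e; rw [Equiv.Perm.mul_apply, hx, hy]
    | inv x _ hx =>
      intro e
      have := hx (x⁻¹ e)
      rw [← Equiv.Perm.mul_apply, mul_inv_cancel, Equiv.Perm.one_apply] at this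
      exact this.symm
  exact (key e).symm

theorem nonempty_edges {E : Type*} [Fintype E] (M : MarkedBipartiteMap E) : Nonempty E :=
  ⟨Quotient.out M.out⟩

theorem black_eq_iff {e e' : E} : M.black e = M.black e' ↔ M.σ.SameCycle e e' := Quotient.eq

theorem white_eq_iff {e e' : E} : M.white e = M.white e' ↔ M.τ.SameCycle e e' := Quotient.eq

theorem black_surjective : Function.Surjective M.black := Quotient.mk_surjective

theorem white_surjective : Function.Surjective M.white := Quotient.mk_surjective

theorem face_false_surjective (f : M.Face) : ∃ e, M.face (e, false) = f := Quotient.mk_surjective f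

theorem face_true_surjective (f : M.Face) : ∃ e, M.face (e, true) = f := by
  obtain ⟨e, he⟩ := M.face_false_surjective f
  exact ⟨M.σ e, by rw [← he]; exact M.face_next (e, false)⟩

@[simp] theorem black_σ (e : E) : M.black (M.σ e) = M.black e :=
  M.black_eq_iff.2 ((Equiv.Perm.sameCycle_apply_left).2 (Equiv.Perm.SameCycle.refl _ _))

@[simp] theorem white_τ (e : E) : M.white (M.τ e) = M.white e :=
  M.white_eq_iff.2 ((Equiv.Perm.sameCycle_apply_left).2 (Equiv.Perm.SameCycle.refl _ _))

@[simp] theorem face_σ_true (e : E) : M.face (M.σ e, true) = M.face (e, false) :=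
  M.face_next (e, false)

@[simp] theorem face_τ_false (e : E) : M.face (M.τ e, false) = M.face (e, true) :=
  M.face_next (e, true)

instance : Finite M.Black := Quotient.finite _
instance : Finite M.White := Quotient.finite _
instance : Finite M.Face := Quotient.finite _
noncomputable instance : Fintype M.Black := Fintype.ofFinite _
noncomputable instance : Fintype M.White := Fintype.ofFinite _
noncomputable instance : Fintype M.Face := Fintype.ofFinite _

theorem card_add_card_add_card :
    Fintype.card M.Black + Fintype.card M.White + Fintype.card M.Face = Fintype.card E + 2 := by
  have := M.euler
  simpa [Nat.card_eq_fintype_card] using this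

/-! ### The linear algebra of planarity -/

section LinearAlgebra

variable {k : Type*} [Field k]

theorem eq_of_gradient_eq_zero {α : Type*} {g : M.Face → α}
    (h : ∀ e, g (M.face (e, true)) = g (M.face (e, false))) (f f' : M.Face) : g f = g f' := by
  obtain ⟨e, rfl⟩ := M.face_false_surjective f
  obtain ⟨e', rfl⟩ := M.face_false_surjective f'
  refine M.eq_of_invariant (c := fun e => g (M.face (e, false))) (fun e => ?_) (fun e => ?_) e e'
  · rw [← h, face_σ_true]
  · rw [face_τ_false, h]

/-- The face on the right of `σ e` is the face on the left of `e`, so the differences telescope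
around each black vertex: stars are closed paths in the dual. -/
theorem sum_black_gradient_eq_zero (c : M.Black → k) (g : M.Face → k) :
    ∑ e, c (M.black e) * (g (M.face (e, true)) - g (M.face (e, false))) = 0 := by
  simp only [mul_sub, Finset.sum_sub_distrib]
  rw [← Equiv.sum_comp M.σ fun e => c (M.black e) * g (M.face (e, true))]
  simp

theorem sum_white_gradient_eq_zero (c : M.White → k) (g : M.Face → k) :
    ∑ e, c (M.white e) * (g (M.face (e, true)) - g (M.face (e, false))) = 0 := by
  simp only [mul_sub, Finset.sum_sub_distrib]
  rw [← Equiv.sum_comp M.τ fun e => c (M.white e) * g (M.face (e, false))]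
  simp

/-- On the sphere, a function on edges orthogonal to all gradients of functions on faces is a sum of
vertex stars. -/
theorem exists_potential (x : E → k)
    (h : ∀ g : M.Face → k, ∑ e, x e * (g (M.face (e, true)) - g (M.face (e, false))) = 0) :
    ∃ (cb : M.Black → k) (cw : M.White → k), ∀ e, x e = cb (M.black e) + cw (M.white e) := by
  classical
  obtain ⟨e₀⟩ := M.nonempty_edges
  let Ψ : ((M.Black → k) × (M.White → k)) →ₗ[k] (E → k) :=
    { toFun := fun c e => c.1 (M.black e) + c.2 (M.white e)
      map_add' := fun c c' => by ext e; simp; ring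
      map_smul' := fun t c => by ext e; simp; ring }
  let A : Matrix E M.Face k := fun e f =>
    (if M.face (e, true) = f then 1 else 0) - (if M.face (e, false) = f then 1 else 0)
  have hA : ∀ g e, A.mulVec g e = g (M.face (e, true)) - g (M.face (e, false)) := by
    intro g e
    simp [A, Matrix.mulVec, dotProduct, sub_mul]
  have hAT : ∀ y : E → k, y ∈ LinearMap.ker (Matrix.transpose A).mulVecLin ↔
      ∀ g : M.Face → k, ∑ e, y e * (g (M.face (e, true)) - g (M.face (e, false))) = 0 := by
    intro y
    have : ∀ g, ∑ e, y e * (g (M.face (e, true)) - g (M.face (e, false))) =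
        dotProduct ((Matrix.transpose A).mulVec y) g := by
      intro g
      rw [Matrix.mulVec_transpose, ← Matrix.dotProduct_mulVec]
      simp only [dotProduct, hA]
    simp only [this]
    rw [LinearMap.mem_ker, Matrix.mulVecLin_apply]
    constructor
    · intro h g; rw [h, zero_dotProduct]
    · intro h
      ext f
      simpa using h (Pi.single f 1)
  have hle : LinearMap.range Ψ ≤ LinearMap.ker (Matrix.transpose A).mulVecLin := by
    rintro _ ⟨c, rfl⟩
    rw [hAT]
    intro g
    have h1 := M.sum_black_gradient_eq_zero c.1 g
    have h2 := M.sum_white_gradient_eq_zero c.2 g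
    simp only [Ψ, LinearMap.coe_mk, AddHom.coe_mk, add_mul, Finset.sum_add_distrib, h1, h2, add_zero]
  have hkerA : Module.finrank k (LinearMap.ker A.mulVecLin) ≤ 1 := by
    rw [← Module.finrank_self k]
    refine LinearMap.finrank_le_finrank_of_injective
      (f := (LinearMap.proj (M.face (e₀, false))).comp (LinearMap.ker A.mulVecLin).subtype) ?_
    rw [← LinearMap.ker_eq_bot, LinearMap.ker_eq_bot']
    rintro ⟨g, hg⟩ h0
    have h0 : g (M.face (e₀, false)) = 0 := h0
    have hg' : ∀ e, g (M.face (e, true)) = g (M.face (e, false)) := fun e => by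
      have := congrFun (LinearMap.mem_ker.1 hg) e
      rw [Matrix.mulVecLin_apply, hA] at this
      exact sub_eq_zero.1 this
    ext f
    exact (M.eq_of_gradient_eq_zero hg' f _).trans h0
  have hkerΨ : Module.finrank k (LinearMap.ker Ψ) ≤ 1 := by
    rw [← Module.finrank_self k]
    refine LinearMap.finrank_le_finrank_of_injective
      (f := ((LinearMap.proj (M.black e₀)).comp (LinearMap.fst k _ _)).comp
        (LinearMap.ker Ψ).subtype) ?_
    rw [← LinearMap.ker_eq_bot, LinearMap.ker_eq_bot']
    rintro ⟨⟨cb, cw⟩, hc⟩ h0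
    have h0 : cb (M.black e₀) = 0 := h0
    have hc' : ∀ e, cb (M.black e) + cw (M.white e) = 0 := fun e =>
      congrFun (LinearMap.mem_ker.1 hc) e
    have hconst := M.eq_of_invariant (c := fun e => cb (M.black e)) (fun e => by simp) (fun e => by
      have h1 := hc' e
      have h2 := hc' (M.τ e)
      rw [white_τ] at h2
      linear_combination h2 - h1)
    have hb : ∀ e, cb (M.black e) = 0 := fun e => (hconst e e₀).trans h0
    have hw : ∀ e, cw (M.white e) = 0 := fun e => by have := hc' e; rwa [hb, zero_add] at this
    have e1 : cb = 0 := by ext b; obtain ⟨e, rfl⟩ := M.black_surjective b; exact hb e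
    have e2 : cw = 0 := by ext b; obtain ⟨e, rfl⟩ := M.white_surjective b; exact hw e
    simp [e1, e2]
  -- Connectedness makes both kernels at most one-dimensional. So the sums of stars have dimension
  -- at least `#B + #W - 1`, the orthogonal complement of the gradients has dimension at most `#E -
  -- #F + 1`, and Euler's formula equates the two numbers.
  have d1 := LinearMap.finrank_range_add_finrank_ker Ψ
  have d2 := LinearMap.finrank_range_add_finrank_ker (Matrix.transpose A).mulVecLin
  have d3 := LinearMap.finrank_range_add_finrank_ker A.mulVecLin
  have d4 : Module.finrank k (LinearMap.range (Matrix.transpose A).mulVecLin) =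
      Module.finrank k (LinearMap.range A.mulVecLin) := Matrix.rank_transpose A
  have d5 := M.card_add_card_add_card
  rw [Module.finrank_prod, Module.finrank_fintype_fun_eq_card,
    Module.finrank_fintype_fun_eq_card] at d1
  rw [Module.finrank_fintype_fun_eq_card] at d2 d3
  have heq := Submodule.eq_of_le_of_finrank_le hle (by omega)
  have hx : x ∈ LinearMap.range Ψ := by rw [heq, hAT]; exact h
  obtain ⟨c, hc⟩ := hx
  exact ⟨c.1, c.2, fun e => (congrFun hc e).symm⟩

end LinearAlgebra

/-! ### Two-connectedness -/

/-- The indicator of an arc of a cycle of a permutation. -/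
theorem exists_arc {ρ : Equiv.Perm E} {e₁ e₂ : E} (h : ρ.SameCycle e₁ e₂) (hne : e₁ ≠ e₂) :
    ∃ x : E → ℚ, x e₁ = 0 ∧ x e₂ ≠ 0 ∧ (∀ e, x e ≠ 0 → ρ.SameCycle e₁ e) ∧
      ∀ ψ : E → ℚ, ∑ e, x e * (ψ e - ψ (ρ.symm e)) = ψ e₂ - ψ e₁ := by
  classical
  obtain ⟨i₀, _, hi₀⟩ := h.exists_pow_eq'
  have hex : ∃ i, (ρ ^ i) e₁ = e₂ := ⟨i₀, hi₀⟩
  -- The arc starts after `e₁` and stops at the first visit to `e₂`, so it does not return to `e₁`.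
  set i := Nat.find hex with hi
  have hie : (ρ ^ i) e₁ = e₂ := Nat.find_spec hex
  have hmin : ∀ j < i, (ρ ^ j) e₁ ≠ e₂ := fun j hj => Nat.find_min hex hj
  refine ⟨fun e => ∑ j ∈ range i, if (ρ ^ (j + 1)) e₁ = e then 1 else 0, ?_, ?_, ?_, ?_⟩
  · refine Finset.sum_eq_zero fun j hj => if_neg fun hj' => ?_
    have hj := mem_range.1 hj
    refine hmin (i - (j + 1)) (by omega) ?_
    rw [← hie]
    conv_lhs => rw [← hj']
    rw [← Equiv.Perm.mul_apply, ← pow_add, Nat.sub_add_cancel (by omega)]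
  · have hi0 : i ≠ 0 := by
      intro h0; rw [h0, pow_zero, Equiv.Perm.one_apply] at hie; exact hne hie
    refine (Finset.sum_pos' (fun j _ => ?_) ⟨i - 1, mem_range.2 (by omega), ?_⟩).ne'
    · split_ifs <;> norm_num
    · rw [Nat.sub_add_cancel (by omega), if_pos hie]; norm_num
  · intro e he
    obtain ⟨j, -, hj⟩ := Finset.exists_ne_zero_of_sum_ne_zero he
    have : (ρ ^ (j + 1)) e₁ = e := by by_contra hcon; exact hj (if_neg hcon)
    exact ⟨((j + 1 : ℕ) : ℤ), by rw [zpow_natCast]; exact this⟩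
  · intro ψ
    simp only [Finset.sum_mul]
    rw [Finset.sum_comm]
    have : ∀ j ∈ range i, ∑ e, (if (ρ ^ (j + 1)) e₁ = e then (1 : ℚ) else 0) *
        (ψ e - ψ (ρ.symm e)) = ψ ((ρ ^ (j + 1)) e₁) - ψ ((ρ ^ j) e₁) := by
      intro j _
      simp only [ite_mul, one_mul, zero_mul, Finset.sum_ite_eq, mem_univ, if_true]
      rw [pow_succ', Equiv.Perm.mul_apply, Equiv.symm_apply_apply]
    rw [Finset.sum_congr rfl this, Finset.sum_range_sub (fun j => ψ ((ρ ^ j) e₁)), hie]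
    simp

variable {M}

/-- A dimer cover of the graph without `b` and `w` matches the remaining vertices of any union of
components. -/
theorem HasDimerCovers.card_eq (hcover : M.HasDimerCovers) (b : M.Black) (w : M.White)
    (P : M.Black → Prop) (Q : M.White → Prop)
    (h : ∀ e, M.black e ≠ b → M.white e ≠ w → (P (M.black e) ↔ Q (M.white e))) :
    Nat.card {b' // P b' ∧ b' ≠ b} = Nat.card {w' // Q w' ∧ w' ≠ w} := by
  obtain ⟨D, h1, h2, h3⟩ := hcover b w
  have k1 : Nat.card {e // e ∈ D ∧ P (M.black e)} = Nat.card {b' // P b' ∧ b' ≠ b} := by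
    refine Nat.card_eq_of_bijective
      (fun e => ⟨M.black e.1, e.2.2, (h1 e.1 e.2.1).1⟩) ⟨?_, ?_⟩
    · rintro ⟨e, he, he'⟩ ⟨e', hf, hf'⟩ heq
      have heq : M.black e = M.black e' := congrArg Subtype.val heq
      exact Subtype.ext ((h2 _ (h1 e he).1).unique ⟨he, rfl⟩ ⟨hf, heq.symm⟩)
    · rintro ⟨b', hP, hb'⟩
      obtain ⟨e, ⟨he, rfl⟩, _⟩ := h2 b' hb'
      exact ⟨⟨e, he, hP⟩, rfl⟩
  have k2 : Nat.card {e // e ∈ D ∧ P (M.black e)} = Nat.card {w' // Q w' ∧ w' ≠ w} := by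
    refine Nat.card_eq_of_bijective
      (fun e => ⟨M.white e.1, (h e.1 (h1 e.1 e.2.1).1 (h1 e.1 e.2.1).2).1 e.2.2,
        (h1 e.1 e.2.1).2⟩) ⟨?_, ?_⟩
    · rintro ⟨e, he, he'⟩ ⟨e', hf, hf'⟩ heq
      have heq : M.white e = M.white e' := congrArg Subtype.val heq
      exact Subtype.ext ((h3 _ (h1 e he).2).unique ⟨he, rfl⟩ ⟨hf, heq.symm⟩)
    · rintro ⟨w', hQ, hw'⟩
      obtain ⟨e, ⟨he, rfl⟩, _⟩ := h3 w' hw'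
      exact ⟨⟨e, he, (h e (h1 e he).1 (h1 e he).2).2 hQ⟩, rfl⟩
  rw [← k1, k2]

theorem card_subtype_and_ne {α : Type*} [Finite α] (P : α → Prop) (a : α) :
    (P a → Nat.card {x // P x ∧ x ≠ a} + 1 = Nat.card {x // P x}) ∧
    (¬ P a → Nat.card {x // P x ∧ x ≠ a} = Nat.card {x // P x}) := by
  have h0 : {x | P x ∧ x ≠ a} = {x | P x} \ {a} := rfl
  constructor
  · intro ha
    have := Set.ncard_sdiff_singleton_add_one (s := {x | P x}) ha (Set.toFinite _)
    rw [← h0] at this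
    exact this
  · intro ha
    have := Set.sdiff_singleton_eq_self (s := {x | P x}) (a := a) ha
    rw [← h0] at this
    exact congrArg Set.ncard this

theorem HasDimerCovers.card_black_eq (hcover : M.HasDimerCovers) :
    Fintype.card M.Black = Fintype.card M.White := by
  obtain ⟨e⟩ := M.nonempty_edges
  have h := hcover.card_eq (M.black e) (M.white e) (fun _ => True) (fun _ => True)
    fun _ _ _ => Iff.rfl
  have h1 := (card_subtype_and_ne (fun _ => True) (M.black e)).1 trivial
  have h2 := (card_subtype_and_ne (fun _ => True) (M.white e)).1 trivial
  have h3 : Nat.card {b : M.Black // True} = Fintype.card M.Black := by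
    rw [Nat.card_congr (Equiv.subtypeUnivEquiv fun _ => trivial), Nat.card_eq_fintype_card]
  have h4 : Nat.card {b : M.White // True} = Fintype.card M.White := by
    rw [Nat.card_congr (Equiv.subtypeUnivEquiv fun _ => trivial), Nat.card_eq_fintype_card]
  omega

/-- No face has two corners at the same black vertex. -/
theorem HasDimerCovers.corner_black_unique (hcover : M.HasDimerCovers) {e₁ e₂ : E}
    (hb : M.black e₁ = M.black e₂) (hf : M.face (e₁, false) = M.face (e₂, false)) : e₁ = e₂ := by
  by_contra hne
  obtain ⟨x, hx1, hx2, hx3, hx4⟩ := exists_arc (M.black_eq_iff.1 hb) hne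
  -- The two ends of the arc lie in the same face, so the arc is orthogonal to all gradients: it is
  -- dual to a closed curve through this face and the vertex. The potentials detect the two sides of
  -- this curve.
  obtain ⟨cb, cw, hc⟩ := M.exists_potential x fun g => by
    have := hx4 fun e => g (M.face (e, false))
    simp only [hf, sub_self] at this
    rw [← neg_eq_zero, ← Finset.sum_neg_distrib, ← this]
    refine Finset.sum_congr rfl fun e _ => ?_
    have h1 := M.face_σ_true (M.σ.symm e)
    rw [Equiv.apply_symm_apply] at h1
    rw [h1]; ring
  have hx0 : ∀ e, M.black e ≠ M.black e₁ → x e = 0 := fun e he => by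
    by_contra hcon
    exact he (M.black_eq_iff.2 (hx3 e hcon).symm)
  -- Away from the vertex the arc vanishes, so these level sets form a union of components of the
  -- graph without it. They contain the white end of `e₁` but not that of `e₂`; removing one or the
  -- other gives white counts differing by one, both matched with the same black set.
  have key := fun w => hcover.card_eq (M.black e₁) w (fun b => cb b = cb (M.black e₁))
    (fun w => cw w = -cb (M.black e₁)) fun e he _ => by
      have h1 := hc e
      rw [hx0 e he] at h1
      have h2 : cw (M.white e) = -cb (M.black e) := by linarith
      rw [h2, neg_inj]
  have c1 := hc e₁
  have c2 := hc e₂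
  rw [hx1] at c1
  rw [← hb] at c2
  have k1 := (card_subtype_and_ne (fun w => cw w = -cb (M.black e₁)) (M.white e₁)).1 (by linarith)
  have k2 := (card_subtype_and_ne (fun w => cw w = -cb (M.black e₁)) (M.white e₂)).2
    fun h => hx2 (by rw [c2, h]; ring)
  have k3 := key (M.white e₁)
  have k4 := key (M.white e₂)
  omega

/-- No face has two corners at the same white vertex. -/
theorem HasDimerCovers.corner_white_unique (hcover : M.HasDimerCovers) {e₁ e₂ : E}
    (hw : M.white e₁ = M.white e₂) (hf : M.face (e₁, true) = M.face (e₂, true)) : e₁ = e₂ := by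
  by_contra hne
  obtain ⟨x, hx1, hx2, hx3, hx4⟩ := exists_arc (M.white_eq_iff.1 hw) hne
  obtain ⟨cb, cw, hc⟩ := M.exists_potential x fun g => by
    have := hx4 fun e => g (M.face (e, true))
    simp only [hf, sub_self] at this
    rw [← this]
    refine Finset.sum_congr rfl fun e _ => ?_
    have h1 := M.face_τ_false (M.τ.symm e)
    rw [Equiv.apply_symm_apply] at h1
    rw [h1]
  have hx0 : ∀ e, M.white e ≠ M.white e₁ → x e = 0 := fun e he => by
    by_contra hcon
    exact he (M.white_eq_iff.2 (hx3 e hcon).symm)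
  have key := fun b => hcover.card_eq b (M.white e₁) (fun b => cb b = -cw (M.white e₁))
    (fun w => cw w = cw (M.white e₁)) fun e _ he => by
      have h1 := hc e
      rw [hx0 e he] at h1
      have h2 : cb (M.black e) = -cw (M.white e) := by linarith
      rw [h2, neg_inj]
  have c1 := hc e₁
  have c2 := hc e₂
  rw [hx1] at c1
  rw [← hw] at c2
  have k1 := (card_subtype_and_ne (fun b => cb b = -cw (M.white e₁)) (M.black e₁)).1 (by linarith)
  have k2 := (card_subtype_and_ne (fun b => cb b = -cw (M.white e₁)) (M.black e₂)).2
    fun h => hx2 (by rw [c2, h]; ring)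
  have k3 := key (M.black e₁)
  have k4 := key (M.black e₂)
  omega

end MarkedBipartiteMap

end

/-! ### Half-edges, vertices of the augmented dual and primitives of closed functions. -/

noncomputable section

namespace MarkedBipartiteMap

open Finset

variable {E : Type*} [Fintype E] (M : MarkedBipartiteMap E)

/-! ### Half-edges -/

@[simp] theorem opp_opp (d : E × Bool) : M.opp (M.opp d) = d := by simp [opp]

/-- The permutation `next` of the sides of edges. -/
def nextPerm : Equiv.Perm (E × Bool) where
  toFun := M.next
  invFun := M.prev
  left_inv := M.prev_next
  right_inv := M.next_prev

@[simp] theorem nextPerm_apply (d : E × Bool) : M.nextPerm d = M.next d := rfl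

/-- The rotation of half-edges around their vertices. -/
def rot : Equiv.Perm (E × Bool) where
  toFun d := M.opp (M.next d)
  invFun d := M.prev (M.opp d)
  left_inv d := by simp [M.prev_next]
  right_inv d := by simp [M.next_prev]

theorem rot_apply (d : E × Bool) : M.rot d = M.opp (M.next d) := rfl

theorem opp_rot (d : E × Bool) : M.opp (M.rot d) = M.next d := by simp [rot_apply]

@[simp] theorem rot_false (e : E) : M.rot (e, false) = (M.σ e, false) := rfl

@[simp] theorem rot_true (e : E) : M.rot (e, true) = (M.τ e, true) := rfl

/-- The vertex of the graph at a half-edge. -/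
def vert : E × Bool → M.DualFace
  | (e, false) => Sum.inl (M.black e)
  | (e, true) => Sum.inr (M.white e)

@[simp] theorem vert_false (e : E) : M.vert (e, false) = Sum.inl (M.black e) := rfl

@[simp] theorem vert_true (e : E) : M.vert (e, true) = Sum.inr (M.white e) := rfl

theorem vert_rot (d : E × Bool) : M.vert (M.rot d) = M.vert d := by
  rcases d with ⟨e, _ | _⟩ <;> simp

theorem vert_surjective (v : M.DualFace) : ∃ d, M.vert d = v := by
  rcases v with b | w
  · obtain ⟨e, rfl⟩ := M.black_surjective b; exact ⟨(e, false), rfl⟩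
  · obtain ⟨e, rfl⟩ := M.white_surjective w; exact ⟨(e, true), rfl⟩

theorem vert_opp_next (d : E × Bool) : M.vert (M.opp (M.next d)) = M.vert d := M.vert_rot d

theorem vert_prev (d : E × Bool) : M.vert (M.prev d) = M.vert (M.opp d) := by
  rw [← M.vert_opp_next, M.next_prev]

theorem snd_eq_of_vert_eq {d d' : E × Bool} (h : M.vert d = M.vert d') : d.2 = d'.2 := by
  rcases d with ⟨e, _ | _⟩ <;> rcases d' with ⟨e', _ | _⟩ <;> simp_all

theorem exists_rot_pow {d d' : E × Bool} (h : M.vert d = M.vert d') :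
    ∃ i : ℕ, (M.rot ^ i) d = d' := by
  have hb := M.snd_eq_of_vert_eq h
  rcases d with ⟨e, s⟩
  rcases d' with ⟨e', s'⟩
  obtain rfl : s = s' := hb
  cases s with
  | false =>
    have h' : M.black e = M.black e' := Sum.inl.inj h
    obtain ⟨i, _, hi⟩ := (M.black_eq_iff.1 h').exists_pow_eq'
    refine ⟨i, ?_⟩
    have : ∀ j : ℕ, (M.rot ^ j) (e, false) = ((M.σ ^ j) e, false) := by
      intro j
      induction j with
      | zero => rfl
      | succ j ih => rw [pow_succ', Equiv.Perm.mul_apply, ih, pow_succ', Equiv.Perm.mul_apply]; rfl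
    rw [this, hi]
  | true =>
    have h' : M.white e = M.white e' := Sum.inr.inj h
    obtain ⟨i, _, hi⟩ := (M.white_eq_iff.1 h').exists_pow_eq'
    refine ⟨i, ?_⟩
    have : ∀ j : ℕ, (M.rot ^ j) (e, true) = ((M.τ ^ j) e, true) := by
      intro j
      induction j with
      | zero => rfl
      | succ j ih => rw [pow_succ', Equiv.Perm.mul_apply, ih, pow_succ', Equiv.Perm.mul_apply]; rfl
    rw [this, hi]

theorem face_prev (d : E × Bool) : M.face (M.prev d) = M.face d := by
  rw [← M.face_next, M.next_prev]

/-- Invariants of `next` only depend on the face. -/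
theorem eq_of_next_invariant {α : Type*} {c : E × Bool → α} {d d' : E × Bool}
    (hc : ∀ x, M.face x = M.face d → c (M.next x) = c x)
    (h : M.face d = M.face d') : c d = c d' := by
  have key : ∀ e e' : E, M.face (e, false) = M.face d → M.face (e, false) = M.face (e', false) →
      c (e, false) = c (e', false) := by
    intro e e' h1 h2
    obtain ⟨i, _, hi⟩ := ((Quotient.eq (r := Equiv.Perm.SameCycle.setoid (M.τ * M.σ))).1
      h2).exists_pow_eq'
    rw [← hi]
    clear hi h2
    have : ∀ j : ℕ, M.face (((M.τ * M.σ) ^ j) e, false) = M.face d ∧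
        c (((M.τ * M.σ) ^ j) e, false) = c (e, false) := by
      intro j
      induction j with
      | zero => exact ⟨h1, rfl⟩
      | succ j ih =>
        have hn : (((M.τ * M.σ) ^ (j + 1)) e, false) =
            M.next (M.next (((M.τ * M.σ) ^ j) e, false)) := by
          rw [pow_succ', Equiv.Perm.mul_apply]; rfl
        rw [hn]
        refine ⟨by rw [M.face_next, M.face_next, ih.1], ?_⟩
        rw [hc _ (by rw [M.face_next, ih.1]), hc _ ih.1, ih.2]
    exact (this i).2.symm
  have red : ∀ x : E × Bool, M.face x = M.face d →
      ∃ e, M.face (e, false) = M.face d ∧ c (e, false) = c x := by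
    rintro ⟨e, _ | _⟩ hx
    · exact ⟨e, hx, rfl⟩
    · exact ⟨M.τ e, by rw [← hx]; exact M.face_next (e, true), hc _ hx⟩
  obtain ⟨e, h1, h2⟩ := red d rfl
  obtain ⟨e', h3, h4⟩ := red d' h.symm
  rw [← h2, ← h4]
  exact key e e' h1 (h1.trans h3.symm)

variable {M} in
theorem HasDimerCovers.corner_unique (hcover : M.HasDimerCovers) {d d' : E × Bool}
    (hv : M.vert d = M.vert d') (hf : M.face d = M.face d') : d = d' := by
  have hb := M.snd_eq_of_vert_eq hv
  rcases d with ⟨e, s⟩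
  rcases d' with ⟨e', s'⟩
  obtain rfl : s = s' := hb
  cases s with
  | false => rw [hcover.corner_black_unique (Sum.inl.inj hv) hf]
  | true => rw [hcover.corner_white_unique (Sum.inr.inj hv) hf]

/-! ### Vertices of the augmented dual -/

theorem vtx_of_out {d : E × Bool} (h : M.face d = M.out) : M.vtx d = Sum.inr ⟨d, h⟩ := dif_pos h

theorem vtx_of_ne {d : E × Bool} (h : M.face d ≠ M.out) : M.vtx d = Sum.inl ⟨M.face d, h⟩ :=
  dif_neg h

theorem vtx_next_of_ne {d : E × Bool} (h : M.face d ≠ M.out) : M.vtx (M.next d) = M.vtx d := by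
  have h' : M.face (M.next d) ≠ M.out := by rwa [M.face_next]
  rw [M.vtx_of_ne h, M.vtx_of_ne h']
  congr 2
  exact M.face_next d

theorem vtx_eq_iff_of_out {d d' : E × Bool} (h : M.face d = M.out) : M.vtx d = M.vtx d' ↔ d = d' := by
  refine ⟨fun h1 => ?_, fun h1 => by rw [h1]⟩
  rw [M.vtx_of_out h] at h1
  by_cases h' : M.face d' = M.out
  · rw [M.vtx_of_out h'] at h1
    exact congrArg Subtype.val (Sum.inr.inj h1)
  · rw [M.vtx_of_ne h'] at h1
    exact absurd h1 (by simp)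

theorem vtx_eq_iff_of_ne {d d' : E × Bool} (h : M.face d ≠ M.out) :
    M.vtx d = M.vtx d' ↔ M.face d = M.face d' := by
  rw [M.vtx_of_ne h]
  by_cases h' : M.face d' = M.out
  · rw [M.vtx_of_out h']
    constructor
    · intro h1; exact absurd h1 (by simp)
    · intro h1; exact absurd (h1.trans h') h
  · rw [M.vtx_of_ne h']
    constructor
    · intro h1; exact congrArg Subtype.val (Sum.inl.inj h1)
    · intro h1; congr 1; exact Subtype.ext h1

theorem vtx_surjective (v : M.DualVertex) : ∃ d, M.vtx d = v := by
  rcases v with ⟨f, hf⟩ | ⟨d, hd⟩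
  · obtain ⟨e, rfl⟩ := M.face_false_surjective f
    exact ⟨(e, false), M.vtx_of_ne hf⟩
  · exact ⟨d, M.vtx_of_out hd⟩

/-- Functions on edges which are closed at all inner vertices are gradients on the augmented dual. -/
theorem exists_primitive {k : Type*} [Field k] (f : E → k)
    (hb : ∀ b, ¬ M.IsBoundaryBlack b → ∑ e, (open Classical in if M.black e = b then f e else 0) = 0)
    (hw : ∀ w, ¬ M.IsBoundaryWhite w → ∑ e, (open Classical in if M.white e = w then f e else 0) = 0) :
    ∃ g : M.DualVertex → k, ∀ e, g (M.vtx (e, true)) - g (M.vtx (e, false)) = f e := by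
  classical
  let D : (M.DualVertex → k) →ₗ[k] (E → k) :=
    { toFun := fun g e => g (M.vtx (e, true)) - g (M.vtx (e, false))
      map_add' := fun g g' => by ext e; simp; ring
      map_smul' := fun t g => by ext e; simp; ring }
  suffices hf : f ∈ LinearMap.range D by
    obtain ⟨g, hg⟩ := hf
    exact ⟨g, fun e => congrFun hg e⟩
  by_contra hf
  -- If `f` were not a gradient, some functional would vanish on gradients but not on `f`. Its
  -- coefficients `x` turn out to be a combination of stars of inner vertices, on which `f` sums to
  -- zero.
  obtain ⟨φ, hφ, hφD⟩ := Submodule.exists_dual_map_eq_bot_of_notMem hf inferInstance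
  set x : E → k := fun e => φ (Pi.single e 1) with hx
  have hφx : ∀ y : E → k, φ y = ∑ e, x e * y e := by
    intro y
    conv_lhs => rw [pi_eq_sum_univ' y, map_sum]
    refine Finset.sum_congr rfl fun e _ => ?_
    rw [map_smul, smul_eq_mul, mul_comm]
  have hD : ∀ g : M.DualVertex → k,
      ∑ e, x e * (g (M.vtx (e, true)) - g (M.vtx (e, false))) = 0 := by
    intro g
    have h1 : φ (D g) ∈ (LinearMap.range D).map φ := ⟨D g, ⟨g, rfl⟩, rfl⟩
    rw [hφD, Submodule.mem_bot, hφx] at h1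
    exact h1
  -- A boundary vertex is an end of only one dual edge; test against its indicator.
  have hxout : ∀ d : E × Bool, M.face d = M.out → x d.1 = 0 := by
    intro d hd
    have h1 := hD fun v => if M.vtx d = v then 1 else 0
    simp only [M.vtx_eq_iff_of_out hd] at h1
    rcases d with ⟨e, _ | _⟩ <;> simpa [Prod.ext_iff] using h1
  obtain ⟨cb, cw, hc⟩ := M.exists_potential x fun g => by
    have h1 := hD (Sum.elim (fun f => g f.1) (fun _ => g M.out))
    have h2 : ∀ d, Sum.elim (fun f : {f : M.Face // f ≠ M.out} => g f.1)
        (fun _ : {d : E × Bool // M.face d = M.out} => g M.out) (M.vtx d) = g (M.face d) := by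
      intro d
      by_cases hd : M.face d = M.out
      · rw [M.vtx_of_out hd, Sum.elim_inr, hd]
      · rw [M.vtx_of_ne hd, Sum.elim_inl]
    simp only [h2] at h1
    exact h1
  obtain ⟨e₀, he₀⟩ := M.face_false_surjective M.out
  -- Since `cb + cw` vanishes on all edges of the outer face, `cb` is constant on its black vertices
  -- and `cw` is the opposite constant on its white ones. Subtracting this constant leaves only the
  -- stars of inner vertices.
  have hinv : ∀ d, M.face d = M.out → cb (M.black d.1) = cb (M.black e₀) := by
    intro d hd
    refine (M.eq_of_next_invariant (c := fun d => cb (M.black d.1)) (d := (e₀, false)) (d' := d)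
      (fun y hy => ?_) (he₀.trans hd.symm)).symm
    have h0 := hxout y (hy.trans he₀)
    have h1 := hxout (M.next y) (by rw [M.face_next, hy, he₀])
    rw [hc] at h0 h1
    rcases y with ⟨e, _ | _⟩
    · simp [next]
    · simp only [next, white_τ] at h0 h1 ⊢
      linear_combination h1 - h0
  have hB : ∀ b, M.IsBoundaryBlack b → cb b = cb (M.black e₀) := by
    rintro b ⟨e, rfl, he⟩
    exact hinv (e, false) he
  have hW : ∀ w, M.IsBoundaryWhite w → cw w = -cb (M.black e₀) := by
    rintro w ⟨e, rfl, he⟩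
    have h1 := hinv (e, true) he
    have h2 := hxout (e, true) he
    rw [hc] at h2
    simp only at h1 h2
    linear_combination h2 - h1
  refine hφ ?_
  rw [hφx]
  have h3 : ∀ e, x e * f e = (cb (M.black e) - cb (M.black e₀)) * f e +
      (cw (M.white e) + cb (M.black e₀)) * f e := fun e => by rw [hc]; ring
  simp only [h3, Finset.sum_add_distrib]
  have h4 : ∑ e, (cb (M.black e) - cb (M.black e₀)) * f e = 0 := by
    rw [← Finset.sum_fiberwise univ M.black]
    refine Finset.sum_eq_zero fun b _ => ?_
    rw [Finset.sum_congr rfl fun e he => by rw [(Finset.mem_filter.1 he).2], ← Finset.mul_sum]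
    by_cases hbb : M.IsBoundaryBlack b
    · rw [hB b hbb, sub_self, zero_mul]
    · rw [Finset.sum_filter]
      have := hb b hbb
      rw [mul_eq_zero]; right; convert this
  have h5 : ∑ e, (cw (M.white e) + cb (M.black e₀)) * f e = 0 := by
    rw [← Finset.sum_fiberwise univ M.white]
    refine Finset.sum_eq_zero fun b _ => ?_
    rw [Finset.sum_congr rfl fun e he => by rw [(Finset.mem_filter.1 he).2], ← Finset.mul_sum]
    by_cases hbb : M.IsBoundaryWhite b
    · rw [hW b hbb]; ring
    · rw [Finset.sum_filter]
      have := hw b hbb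
      rw [mul_eq_zero]; right; convert this
  rw [h4, h5, add_zero]

/-- Euler's inequality for the subgraph spanned by the edges at a connected set `S` of vertices of
one colour, all faces of the sphere in `F` being surrounded by `S`. -/
theorem card_faces_add_card_le {U V Φ : Type*} [Fintype U] [Fintype V] [Fintype Φ] [DecidableEq U]
    [DecidableEq V] [DecidableEq Φ] {u : E → U} {v : E → V}
    {l r : E → Φ} (hu : Function.Surjective u)
    (h1 : ∀ (c : U → ℚ) (g : Φ → ℚ), ∑ e, c (u e) * (g (r e) - g (l e)) = 0)
    (h2 : ∀ (c : V → ℚ) (g : Φ → ℚ), ∑ e, c (v e) * (g (r e) - g (l e)) = 0)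
    (h3 : ∀ g : Φ → ℚ, (∀ e, g (r e) = g (l e)) → ∀ f f', g f = g f')
    (S : Finset U) (hS : S.Nonempty) (F : Finset Φ) {f₀ : Φ} (hf₀ : f₀ ∉ F)
    (hF : ∀ e, l e ∈ F ∨ r e ∈ F → u e ∈ S)
    (hconn : ∀ a : U → ℚ, (∀ e e', u e ∈ S → u e' ∈ S → v e = v e' → a (u e) = a (u e')) →
      ∀ b ∈ S, ∀ b' ∈ S, a b = a b') :
    F.card + S.card + ((univ.filter fun e => u e ∈ S).image v).card ≤
      (univ.filter fun e => u e ∈ S).card + 1 := by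
  classical
  set N := (univ.filter fun e => u e ∈ S).image v with hN
  have hvN : ∀ e, u e ∈ S → v e ∈ N := fun e he => by
    rw [hN, Finset.mem_image]; exact ⟨e, by simpa using he, rfl⟩
  let ext : (F → ℚ) → Φ → ℚ := fun g f => if h : f ∈ F then g ⟨f, h⟩ else 0
  have ext_add : ∀ g g' f, ext (g + g') f = ext g f + ext g' f := by
    intro g g' f; simp only [ext]; split_ifs <;> simp
  have ext_smul : ∀ (t : ℚ) g f, ext (t • g) f = t * ext g f := by
    intro t g f; simp only [ext]; split_ifs <;> simp
  let Φm : (F → ℚ) →ₗ[ℚ] ({e // u e ∈ S} → ℚ) :=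
    { toFun := fun g e => ext g (r e.1) - ext g (l e.1)
      map_add' := fun g g' => by ext e; simp only [ext_add, Pi.add_apply]; ring
      map_smul' := fun t g => by
        ext e; simp only [ext_smul, Pi.smul_apply, smul_eq_mul, RingHom.id_apply]; ring }
  let Ψ : ((S → ℚ) × (N → ℚ)) →ₗ[ℚ] ({e // u e ∈ S} → ℚ) :=
    { toFun := fun c e => c.1 ⟨u e.1, e.2⟩ + c.2 ⟨v e.1, hvN e.1 e.2⟩
      map_add' := fun c c' => by ext e; simp; ring
      map_smul' := fun t c => by ext e; simp; ring }
  have hsupp : ∀ (g : F → ℚ) e, u e ∉ S → ext g (r e) - ext g (l e) = 0 := by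
    intro g e he
    have hl : l e ∉ F := fun h => he (hF e (Or.inl h))
    have hr : r e ∉ F := fun h => he (hF e (Or.inr h))
    simp [ext, hl, hr]
  have hΦ : Function.Injective Φm := by
    rw [← LinearMap.ker_eq_bot, LinearMap.ker_eq_bot']
    intro g hg
    have hz : ∀ e, ext g (r e) = ext g (l e) := by
      intro e
      by_cases he : u e ∈ S
      · exact sub_eq_zero.1 (congrFun hg ⟨e, he⟩)
      · exact sub_eq_zero.1 (hsupp g e he)
    ext ⟨f, hf⟩
    have := h3 (ext g) hz f f₀
    simpa [ext, hf, hf₀] using this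
  obtain ⟨b₀, hb₀⟩ := hS
  obtain ⟨e₀, rfl⟩ := hu b₀
  have hker : Module.finrank ℚ (LinearMap.ker Ψ) ≤ 1 := by
    rw [← Module.finrank_self ℚ]
    refine LinearMap.finrank_le_finrank_of_injective
      (f := ((LinearMap.proj (⟨u e₀, hb₀⟩ : S)).comp (LinearMap.fst ℚ _ _)).comp
        (LinearMap.ker Ψ).subtype) ?_
    rw [← LinearMap.ker_eq_bot, LinearMap.ker_eq_bot']
    rintro ⟨⟨a, c⟩, hac⟩ h0
    have h0 : a ⟨u e₀, hb₀⟩ = 0 := h0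
    have hac' : ∀ e (he : u e ∈ S), a ⟨u e, he⟩ + c ⟨v e, hvN e he⟩ = 0 := fun e he =>
      congrFun (LinearMap.mem_ker.1 hac) ⟨e, he⟩
    have hconst := hconn (fun b => if h : b ∈ S then a ⟨b, h⟩ else 0) fun e e' he he' hv => by
      have k1 := hac' e he
      have k2 := hac' e' he'
      have k3 : c ⟨v e, hvN e he⟩ = c ⟨v e', hvN e' he'⟩ := by congr 1; exact Subtype.ext hv
      simp only [he, he', dif_pos]
      linear_combination k1 - k2 - k3
    have ha : a = 0 := by
      ext ⟨b, hb⟩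
      have := hconst b hb (u e₀) hb₀
      simpa [hb, hb₀, h0] using this
    have hc : c = 0 := by
      ext ⟨w, hw⟩
      obtain ⟨e, he, rfl⟩ := Finset.mem_image.1 hw
      have he' : u e ∈ S := by simpa using he
      have := hac' e he'
      rw [ha] at this
      simpa using this
    simp [ha, hc]
  -- Gradients are orthogonal to sums of stars, and over ℚ this forces the two spaces to intersect
  -- trivially. Their dimensions, `#F` and at least `#S + #N - 1`, therefore add up to at most the
  -- number of edges at `S`.
  have horth : ∀ g c, ∑ e, Φm g e * Ψ c e = 0 := by
    intro g c
    have k1 := h1 (fun b => if h : b ∈ S then c.1 ⟨b, h⟩ else 0) (ext g)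
    have k2 := h2 (fun w => if h : w ∈ N then c.2 ⟨w, h⟩ else 0) (ext g)
    have k3 := congrArg₂ (· + ·) k1 k2
    simp only [← Finset.sum_add_distrib, add_zero, ← add_mul] at k3
    rw [← k3]
    symm
    rw [← Finset.sum_filter_of_ne (p := fun e => u e ∈ S), Finset.sum_subtype (p := fun e => u e ∈ S)]
    · refine Finset.sum_congr rfl fun e _ => ?_
      simp only [e.2, hvN e.1 e.2, dif_pos, Φm, Ψ, LinearMap.coe_mk, AddHom.coe_mk]
      ring
    · simp
    · intro e _ hne
      by_contra he
      exact hne (by rw [hsupp g e he, mul_zero])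
  have hdisj : Disjoint (LinearMap.range Φm) (LinearMap.range Ψ) := by
    rw [Submodule.disjoint_def]
    rintro y ⟨g, rfl⟩ ⟨c, hc⟩
    have h4 := horth g c
    rw [hc] at h4
    have h5 := (Finset.sum_eq_zero_iff_of_nonneg fun e _ => mul_self_nonneg (Φm g e)).1 h4
    ext e
    exact mul_self_eq_zero.1 (h5 e (mem_univ e))
  have d1 := Submodule.finrank_add_finrank_le_of_disjoint hdisj
  have d2 := LinearMap.finrank_range_of_inj hΦ
  have d3 := LinearMap.finrank_range_add_finrank_ker Ψ
  rw [Module.finrank_prod, Module.finrank_fintype_fun_eq_card,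
    Module.finrank_fintype_fun_eq_card] at d3
  rw [Module.finrank_fintype_fun_eq_card] at d1 d2
  simp only [Fintype.card_coe] at d2 d3
  rw [Fintype.card_subtype] at d1
  omega

end MarkedBipartiteMap

end

/-! ### Boundary polygons of the faces of the augmented dual. -/

noncomputable section

namespace MarkedBipartiteMap

open Finset PlanarPolygon

/-- The points of a cycle of a permutation, listed in order. -/
theorem exists_cycle_length {ι β : Type*} [Fintype ι] [DecidableEq β] (p : Equiv.Perm ι) (F : ι → β)
    (hF : ∀ s, F (p s) = F s) (hF' : ∀ s s', F s = F s' → ∃ i : ℕ, p^[i] s = s') (s : ι) :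
    ∃ n, 0 < n ∧ p^[n] s = s ∧ (∀ s', F s' = F s → ∃ i < n, p^[i] s = s') ∧
      (∀ i < n, ∀ j < n, p^[i] s = p^[j] s → i = j) ∧
      ∀ f : ι → ℝ, ∑ x with F x = F s, f x = ∑ i ∈ range n, f (p^[i] s) := by
  classical
  have hper : s ∈ Function.periodicPts p := Function.Injective.mem_periodicPts p.injective s
  have hn := Function.minimalPeriod_pos_of_mem_periodicPts hper
  have hFi : ∀ i, F (p^[i] s) = F s := fun i => by
    induction i with
    | zero => rfl
    | succ i ih => rw [Function.iterate_succ_apply', hF, ih]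
  have hex : ∀ s', F s' = F s → ∃ i < Function.minimalPeriod p s, p^[i] s = s' := by
    intro s' hs'
    obtain ⟨i, hi⟩ := hF' s s' hs'.symm
    exact ⟨i % Function.minimalPeriod p s, Nat.mod_lt _ hn, by
      rw [Function.iterate_mod_minimalPeriod_eq, hi]⟩
  have hinj : ∀ i < Function.minimalPeriod p s, ∀ j < Function.minimalPeriod p s,
      p^[i] s = p^[j] s → i = j := fun i hi j hj h =>
    Function.iterate_injOn_Iio_minimalPeriod hi hj h
  refine ⟨_, hn, Function.iterate_minimalPeriod, hex, hinj, fun f => ?_⟩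
  symm
  refine Finset.sum_bij (fun i _ => p^[i] s) (fun i _ => by simp [hFi]) (fun i hi j hj h => ?_)
    (fun s' hs' => ?_) fun _ _ => rfl
  · exact hinj i (mem_range.1 hi) j (mem_range.1 hj) h
  · obtain ⟨i, hi, h⟩ := hex s' (by simpa using hs')
    exact ⟨i, mem_range.2 hi, h⟩

variable {E : Type*} [Fintype E] (M : MarkedBipartiteMap E)

/-! ### Sides of the faces of the augmented dual -/

/-- The sides of edges adjacent to the outer face. -/
abbrev OutDart : Type _ := {d : E × Bool // M.face d = M.out}

/-- The directed sides of the faces of the augmented dual. -/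
abbrev Side : Type _ := (E × Bool) ⊕ M.OutDart

noncomputable instance : Fintype M.OutDart := Fintype.ofFinite _

/-- The enumeration of outer sides along the outer face. -/
def outNext : Equiv.Perm M.OutDart where
  toFun d := ⟨M.next d.1, by rw [M.face_next, d.2]⟩
  invFun d := ⟨M.prev d.1, by rw [M.face_prev, d.2]⟩
  left_inv d := Subtype.ext (M.prev_next _)
  right_inv d := Subtype.ext (M.next_prev _)

@[simp] theorem outNext_coe (d : M.OutDart) : (M.outNext d : E × Bool) = M.next d := rfl

@[simp] theorem outNext_symm_coe (d : M.OutDart) : (M.outNext.symm d : E × Bool) = M.prev d := rfl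

open Classical in
/-- The next side along the boundary of a face of the augmented dual. -/
def sideNext : Equiv.Perm M.Side where
  toFun s := match s with
    | Sum.inl d => if h : M.face d = M.out then Sum.inr ⟨d, h⟩ else Sum.inl (M.rot d)
    | Sum.inr d => Sum.inl (M.rot d.1)
  invFun s := match s with
    | Sum.inl d => if h : M.face (M.rot.symm d) = M.out then Sum.inr ⟨M.rot.symm d, h⟩
        else Sum.inl (M.rot.symm d)
    | Sum.inr d => Sum.inl d.1
  left_inv s := by
    rcases s with d | d
    · by_cases h : M.face d = M.out
      · simp [h]
      · simp [h]
    · simp [d.2]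
  right_inv s := by
    rcases s with d | d
    · by_cases h : M.face (M.rot.symm d) = M.out
      · simp [h]
      · simp [h]
    · simp [d.2]

theorem sideNext_inl_of_out {d : E × Bool} (h : M.face d = M.out) :
    M.sideNext (Sum.inl d) = Sum.inr ⟨d, h⟩ := dif_pos h

theorem sideNext_inl_of_ne {d : E × Bool} (h : M.face d ≠ M.out) :
    M.sideNext (Sum.inl d) = Sum.inl (M.rot d) := dif_neg h

@[simp] theorem sideNext_inr (d : M.OutDart) : M.sideNext (Sum.inr d) = Sum.inl (M.rot d.1) := rfl

/-- The face of the augmented dual containing a side. -/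
def sideFace : M.Side → M.DualFace
  | Sum.inl d => M.vert d
  | Sum.inr d => M.vert d.1

@[simp] theorem sideFace_inl (d : E × Bool) : M.sideFace (Sum.inl d) = M.vert d := rfl

@[simp] theorem sideFace_inr (d : M.OutDart) : M.sideFace (Sum.inr d) = M.vert d.1 := rfl

theorem sideFace_next (s : M.Side) : M.sideFace (M.sideNext s) = M.sideFace s := by
  rcases s with d | d
  · by_cases h : M.face d = M.out
    · rw [M.sideNext_inl_of_out h]; rfl
    · rw [M.sideNext_inl_of_ne h]; exact M.vert_rot d
  · exact M.vert_rot d.1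

/-- The initial vertex of a side. -/
def src : M.Side → M.DualVertex
  | Sum.inl d => M.vtx (M.opp d)
  | Sum.inr d => M.vtx d.1

/-- The terminal vertex of a side. -/
def tgt : M.Side → M.DualVertex
  | Sum.inl d => M.vtx d
  | Sum.inr d => M.vtx (M.next d.1)

@[simp] theorem src_inl (d : E × Bool) : M.src (Sum.inl d) = M.vtx (M.opp d) := rfl
@[simp] theorem src_inr (d : M.OutDart) : M.src (Sum.inr d) = M.vtx d.1 := rfl
@[simp] theorem tgt_inl (d : E × Bool) : M.tgt (Sum.inl d) = M.vtx d := rfl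
@[simp] theorem tgt_inr (d : M.OutDart) : M.tgt (Sum.inr d) = M.vtx (M.next d.1) := rfl

theorem src_sideNext (s : M.Side) : M.src (M.sideNext s) = M.tgt s := by
  rcases s with d | d
  · by_cases h : M.face d = M.out
    · rw [M.sideNext_inl_of_out h]; rfl
    · rw [M.sideNext_inl_of_ne h, src_inl, tgt_inl, opp_rot, M.vtx_next_of_ne h]
  · rw [sideNext_inr, src_inl, tgt_inr, opp_rot]

theorem exists_sideNext_iterate {s s' : M.Side} (h : M.sideFace s = M.sideFace s') :
    ∃ i : ℕ, M.sideNext^[i] s = s' := by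
  have hrot : ∀ d, ∃ i : ℕ, M.sideNext^[i] (Sum.inl d) = Sum.inl (M.rot d) := by
    intro d
    by_cases h : M.face d = M.out
    · exact ⟨2, by simp [M.sideNext_inl_of_out h]⟩
    · exact ⟨1, by simp [M.sideNext_inl_of_ne h]⟩
  have hpow : ∀ (j : ℕ) d, ∃ i : ℕ, M.sideNext^[i] (Sum.inl d) = Sum.inl ((M.rot ^ j) d) := by
    intro j d
    induction j with
    | zero => exact ⟨0, rfl⟩
    | succ j ih =>
      obtain ⟨i, hi⟩ := ih
      obtain ⟨i', hi'⟩ := hrot ((M.rot ^ j) d)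
      exact ⟨i' + i, by rw [Function.iterate_add_apply, hi, hi', pow_succ', Equiv.Perm.mul_apply]⟩
  have h1 : ∃ d, M.vert d = M.sideFace s ∧ ∃ i : ℕ, M.sideNext^[i] s = Sum.inl d := by
    rcases s with d | d
    · exact ⟨d, rfl, 0, rfl⟩
    · exact ⟨M.rot d.1, M.vert_rot d.1, 1, rfl⟩
  have h2 : ∃ d, M.vert d = M.sideFace s' ∧ ∃ i : ℕ, M.sideNext^[i] (Sum.inl d) = s' := by
    rcases s' with d | d
    · exact ⟨d, rfl, 0, rfl⟩
    · exact ⟨d.1, rfl, 1, by rw [Function.iterate_one, M.sideNext_inl_of_out d.2]⟩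
  obtain ⟨d, hd, i, hi⟩ := h1
  obtain ⟨d', hd', i', hi'⟩ := h2
  obtain ⟨j, hj⟩ := M.exists_rot_pow ((hd.trans h).trans hd'.symm)
  obtain ⟨l, hl⟩ := hpow j d
  exact ⟨i' + (l + i), by
    rw [Function.iterate_add_apply, Function.iterate_add_apply, hi, hl, hj, hi']⟩

theorem sideFace_surjective (v : M.DualFace) : ∃ s, M.sideFace s = v := by
  obtain ⟨d, hd⟩ := M.vert_surjective v
  exact ⟨Sum.inl d, hd⟩

theorem mem_faceSides_side (s : M.Side) : (M.src s, M.tgt s) ∈ M.faceSides (M.sideFace s) := by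
  rcases s with ⟨e, _ | _⟩ | ⟨⟨e, _ | _⟩, h⟩
  · exact ⟨e, rfl, Or.inl rfl⟩
  · exact ⟨e, rfl, Or.inl rfl⟩
  · exact ⟨e, rfl, Or.inr rfl⟩
  · exact ⟨e, rfl, Or.inr rfl⟩

theorem exists_side_of_mem_faceSides {v : M.DualFace} {q : M.DualVertex × M.DualVertex}
    (hq : q ∈ M.faceSides v) :
    q.1 = q.2 ∨ ∃ s, M.sideFace s = v ∧ q = (M.src s, M.tgt s) := by
  have key : ∀ d, M.vert d = v → q = (M.vtx d, M.vtx (M.next d)) →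
      q.1 = q.2 ∨ ∃ s, M.sideFace s = v ∧ q = (M.src s, M.tgt s) := by
    intro d hd hq
    by_cases h : M.face d = M.out
    · exact Or.inr ⟨Sum.inr ⟨d, h⟩, hd, hq⟩
    · left; rw [hq, M.vtx_next_of_ne h]
  rcases v with b | w
  · obtain ⟨e, he, h1 | h1⟩ := hq
    · exact Or.inr ⟨Sum.inl (e, false), by simp [he], h1⟩
    · exact key (e, false) (by simp [he]) h1
  · obtain ⟨e, he, h1 | h1⟩ := hq
    · exact Or.inr ⟨Sum.inl (e, true), by simp [he], h1⟩
    · exact key (e, true) (by simp [he]) h1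

theorem mem_faceVertices_iff {v : M.DualFace} {x : M.DualVertex} :
    x ∈ M.faceVertices v ↔ ∃ s, M.sideFace s = v ∧ x = M.src s := by
  have hopp : ∀ d, ∃ s, M.sideFace s = M.vert d ∧ M.vtx d = M.src s := fun d =>
    ⟨M.sideNext (Sum.inl d), M.sideFace_next _, (M.src_sideNext (Sum.inl d)).symm⟩
  have hdir : ∀ d, M.sideFace (Sum.inl d) = M.vert d ∧ M.vtx (M.opp d) = M.src (Sum.inl d) :=
    fun d => ⟨rfl, rfl⟩
  constructor
  · intro hx
    rcases v with b | w
    · obtain ⟨e, s, rfl, rfl⟩ := hx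
      cases s with
      | false => exact hopp (e, false)
      | true => exact ⟨_, hdir (e, false)⟩
    · obtain ⟨e, s, rfl, rfl⟩ := hx
      cases s with
      | false => exact ⟨_, hdir (e, true)⟩
      | true => exact hopp (e, true)
  · rintro ⟨s, rfl, rfl⟩
    rcases s with ⟨e, _ | _⟩ | ⟨⟨e, _ | _⟩, h⟩
    · exact ⟨e, true, rfl, rfl⟩
    · exact ⟨e, false, rfl, rfl⟩
    · exact ⟨e, false, rfl, rfl⟩
    · exact ⟨e, true, rfl, rfl⟩

/-! ### Angles -/

section Angles

variable (T : M.DualVertex → ℂ)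

/-- The vector of a side. -/
def sideVec (s : M.Side) : ℂ := T (M.tgt s) - T (M.src s)

/-- The exterior angle at the end of a side. -/
def extAngle (s : M.Side) : ℝ := Complex.arg (M.sideVec T (M.sideNext s) / M.sideVec T s)

/-- The interior angle at the end of a side. -/
def intAngle (s : M.Side) : ℝ := Complex.arg (-M.sideVec T s / M.sideVec T (M.sideNext s))

variable {T}

/-- The interior ratio is minus the inverse of the exterior one, so the two angles are supplementary
in absolute value, whichever way the corner turns. -/
theorem abs_extAngle_add (hT : ∀ s, M.sideVec T s ≠ 0) (s : M.Side) :
    |M.extAngle T s| + |M.intAngle T s| = Real.pi := by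
  have h := abs_arg_neg_inv (div_ne_zero (hT (M.sideNext s)) (hT s))
  rw [inv_div, ← neg_div] at h
  rw [intAngle, h, extAngle]; ring

theorem sideVec_inl_opp (d : E × Bool) :
    M.sideVec T (Sum.inl (M.opp d)) = -M.sideVec T (Sum.inl d) := by
  simp [sideVec]

open Classical in
/-- The sides of a face, listed in order, form a closed polygon. -/
theorem exists_polygon (hT : ∀ s, M.sideVec T s ≠ 0) (s : M.Side) :
    ∃ (n : ℕ) (z : ℕ → ℂ), (∀ i, z i = M.sideVec T (M.sideNext^[i] s)) ∧ 0 < n ∧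
      (∀ i, z i ≠ 0) ∧ ∑ i ∈ range n, z i = 0 ∧ z n = z 0 ∧
      (∀ i, turn z i = M.extAngle T (M.sideNext^[i] s)) ∧
      (∀ s', M.sideFace s' = M.sideFace s → ∃ i < n, M.sideNext^[i] s = s') ∧
      (∀ i < n, ∀ j < n, M.sideNext^[i] s = M.sideNext^[j] s → i = j) ∧
      (∀ j, ∑ i ∈ range j, z i = T (M.src (M.sideNext^[j] s)) - T (M.src s)) ∧
      ∀ f : M.Side → ℝ, ∑ x with M.sideFace x = M.sideFace s, f x =
        ∑ i ∈ range n, f (M.sideNext^[i] s) := by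
  obtain ⟨n, hn, hns, hex, hinj, hsum⟩ := exists_cycle_length M.sideNext M.sideFace M.sideFace_next
    (fun s s' h => M.exists_sideNext_iterate h) s
  have hps : ∀ j, ∑ i ∈ range j, M.sideVec T (M.sideNext^[i] s) =
      T (M.src (M.sideNext^[j] s)) - T (M.src s) := by
    intro j
    have h0 := Finset.sum_range_sub (fun i => T (M.src (M.sideNext^[i] s))) j
    simp only [Function.iterate_zero, id] at h0
    rw [← h0]
    refine Finset.sum_congr rfl fun i _ => ?_
    rw [Function.iterate_succ_apply', M.src_sideNext, sideVec]
  refine ⟨n, fun i => M.sideVec T (M.sideNext^[i] s), fun _ => rfl, hn, fun i => hT _, ?_, ?_, ?_,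
    hex, hinj, hps, hsum⟩
  · rw [hps, hns, sub_self]
  · simp [hns]
  · intro i
    rw [turn, extAngle, Function.iterate_succ_apply']

open Classical in
theorem two_pi_le_sum_extAngle (hT : ∀ s, M.sideVec T s ≠ 0) (v : M.DualFace) :
    2 * Real.pi ≤ ∑ s with M.sideFace s = v, |M.extAngle T s| := by
  obtain ⟨s, rfl⟩ := M.sideFace_surjective v
  obtain ⟨n, z, -, hn, hz, hz0, hzn, ht, -, -, -, hsum⟩ := M.exists_polygon hT s
  rw [hsum]
  simpa only [ht] using two_pi_le_sum_abs_turn hz hn hz0 hzn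

/-- All sides of the face are parallel. -/
def IsFlat (T : M.DualVertex → ℂ) (v : M.DualFace) : Prop :=
  ∀ s s', M.sideFace s = v → M.sideFace s' = v →
    (conj (M.sideVec T s') * M.sideVec T s).im = 0

open Classical in
theorem turning_cases (hT : ∀ s, M.sideVec T s ≠ 0) {v : M.DualFace}
    (h : ∑ s with M.sideFace s = v, |M.extAngle T s| = 2 * Real.pi) :
    ((∀ s, M.sideFace s = v → 0 ≤ M.extAngle T s) ∧
      ∑ s with M.sideFace s = v, M.extAngle T s = 2 * Real.pi) ∨
    (∀ s, M.sideFace s = v → M.extAngle T s ≤ 0) ∨ M.IsFlat T v := by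
  obtain ⟨s, rfl⟩ := M.sideFace_surjective v
  obtain ⟨n, z, hzdef, hn, hz, hz0, hzn, ht, hex, -, -, hsum⟩ := M.exists_polygon hT s
  rw [hsum] at h ⊢
  simp only [← ht] at h
  rcases turning_eq_two_pi hz hn hz0 hzn h with ⟨h1, h2⟩ | ⟨h1, _⟩ | h1
  · refine Or.inl ⟨fun s' hs' => ?_, ?_⟩
    · obtain ⟨i, hi, rfl⟩ := hex s' hs'
      rw [← ht]; exact h1 i hi
    · simp only [← ht]; exact h2
  · refine Or.inr (Or.inl fun s' hs' => ?_)
    obtain ⟨i, hi, rfl⟩ := hex s' hs'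
    rw [← ht]; exact h1 i hi
  · refine Or.inr (Or.inr fun s₁ s₂ h₁ h₂ => ?_)
    obtain ⟨i, hi, rfl⟩ := hex s₁ h₁
    obtain ⟨j, hj, rfl⟩ := hex s₂ h₂
    rw [← hzdef, ← hzdef]; exact h1 i hi j hj

open Classical in
theorem isFlat_of_extAngle_eq_pi (hT : ∀ s, M.sideVec T s ≠ 0) {s : M.Side}
    (h : ∑ s' with M.sideFace s' = M.sideFace s, |M.extAngle T s'| = 2 * Real.pi)
    (hs : M.extAngle T s = Real.pi) : M.IsFlat T (M.sideFace s) := by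
  obtain ⟨n, z, hzdef, hn, hz, hz0, hzn, ht, hex, -, -, hsum⟩ := M.exists_polygon hT s
  rw [hsum] at h
  simp only [← ht] at h
  have h1 := collinear_of_turn_eq_pi hz hn hz0 hzn h hn (by rw [ht]; exact hs)
  intro s₁ s₂ h₁ h₂
  obtain ⟨i, hi, rfl⟩ := hex s₁ h₁
  obtain ⟨j, hj, rfl⟩ := hex s₂ h₂
  rw [← hzdef, ← hzdef]; exact h1 i hi j hj

end Angles

end MarkedBipartiteMap

end

noncomputable section

namespace MarkedBipartiteMap

open Finset PlanarPolygon

variable {E : Type*} [Fintype E] (M : MarkedBipartiteMap E)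

/-! ### The sums of angles at inner faces -/

section AngleSums

variable {M} {χ K : E → ℝ} {Fb : M.Black → ℂ} {Fw : M.White → ℂ} {T : M.DualVertex → ℂ}

theorem IsTRealisation.sideVec_true (hT : M.IsTRealisation K Fb Fw T) (e : E) :
    M.sideVec T (Sum.inl (e, true)) = Fb (M.black e) * K e * Fw (M.white e) := hT e

theorem IsTRealisation.sideVec_false (hT : M.IsTRealisation K Fb Fw T) (e : E) :
    M.sideVec T (Sum.inl (e, false)) = -(Fb (M.black e) * K e * Fw (M.white e)) := by
  rw [← hT.sideVec_true e, ← M.sideVec_inl_opp]; rfl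

theorem IsKasteleyn.ne_zero (hK : M.IsKasteleyn χ K) (hχ : ∀ e, 0 < χ e) (e : E) : K e ≠ 0 := by
  have := hχ e
  rw [← hK.1 e] at this
  exact abs_pos.1 this

theorem IsTRealisation.sideVec_inl_ne_zero (hT : M.IsTRealisation K Fb Fw T) (hK0 : ∀ e, K e ≠ 0)
    (hb : ∀ b, Fb b ≠ 0) (hw : ∀ w, Fw w ≠ 0) (d : E × Bool) : M.sideVec T (Sum.inl d) ≠ 0 := by
  have h : ∀ e, Fb (M.black e) * K e * Fw (M.white e) ≠ 0 := fun e =>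
    mul_ne_zero (mul_ne_zero (hb _) (by exact_mod_cast hK0 e)) (hw _)
  rcases d with ⟨e, _ | _⟩
  · rw [hT.sideVec_false]; exact neg_ne_zero.2 (h e)
  · rw [hT.sideVec_true]; exact h e

open Classical in
/-- The edges at the black corners of a face are permuted by `τ * σ`. -/
theorem prod_face_comp {β : Type*} [CommMonoid β] (f : M.Face) (g : E → β) :
    ∏ e with M.face (e, false) = f, g (M.τ (M.σ e)) =
      ∏ e with M.face (e, false) = f, g e := by
  classical
  refine Finset.prod_bij (fun e _ => M.τ (M.σ e)) ?_ ?_ ?_ fun _ _ => rfl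
  · intro e he
    simpa using he
  · intro e _ e' _ h
    exact M.σ.injective (M.τ.injective h)
  · intro e he
    refine ⟨M.σ.symm (M.τ.symm e), ?_, by simp⟩
    have h1 : M.face (M.σ.symm (M.τ.symm e), false) = M.face (e, false) := by
      have h2 := M.face_σ_true (M.σ.symm (M.τ.symm e))
      have h3 := M.face_τ_false (M.τ.symm e)
      rw [Equiv.apply_symm_apply] at h2 h3
      rw [← h2, ← h3]
    simpa [h1] using he

-- At a face of degree `2m` the minus signs contribute `(-1) ^ m` and the Kasteleyn condition `(-1)
-- ^ (m - 1)`; together they give `-1`.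
open Classical in
theorem IsKasteleyn.exists_pos_prod (hK : M.IsKasteleyn χ K) (hχ : ∀ e, 0 < χ e) {f : M.Face}
    (hf : f ≠ M.out) : ∃ r : ℝ, 0 < r ∧
      ∏ e with M.face (e, false) = f, -(K e / K (M.σ e)) = -r := by
  classical
  have h0 : ∀ e, K e ≠ 0 := hK.ne_zero hχ
  have h1 := hK.2 f hf
  set C := univ.filter fun e : E => M.face (e, false) = f with hC
  have hcard : 0 < C.card := by
    obtain ⟨e, he⟩ := M.face_false_surjective f
    exact Finset.card_pos.2 ⟨e, by simp [hC, he]⟩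
  refine ⟨∏ e ∈ C, |K e / K (M.σ e)|, Finset.prod_pos fun e _ =>
    abs_pos.2 (div_ne_zero (h0 _) (h0 _)), ?_⟩
  have h2 : ∀ e, -(K e / K (M.σ e)) =
      (-1) * (Real.sign (K e) * Real.sign (K (M.σ e))) * |K e / K (M.σ e)| := by
    intro e
    rcases lt_or_gt_of_ne (h0 e) with h | h <;> rcases lt_or_gt_of_ne (h0 (M.σ e)) with h' | h' <;>
      simp only [Real.sign_of_neg, Real.sign_of_pos, h, h', abs_div, abs_of_neg, abs_of_pos] <;>
      ring
  rw [Finset.prod_congr rfl fun e _ => h2 e, Finset.prod_mul_distrib, Finset.prod_mul_distrib,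
    Finset.prod_const]
  have h4 : ((-1 : ℝ)) ^ C.card * (-1) ^ (C.card - 1) = -1 := by
    rw [← pow_add]
    exact Odd.neg_one_pow ⟨C.card - 1, by omega⟩
  rw [h1, h4]; ring

-- The black gauge function cancels within each corner and the white one cyclically around the face,
-- so only the real numbers of the Kasteleyn matrix remain.
open Classical in
theorem IsTRealisation.arg_prod_false (hT : M.IsTRealisation K Fb Fw T) (hK : M.IsKasteleyn χ K)
    (hχ : ∀ e, 0 < χ e) (hb : ∀ b, Fb b ≠ 0) (hw : ∀ w, Fw w ≠ 0) {f : M.Face}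
    (hf : f ≠ M.out) : ∃ r : ℝ, 0 < r ∧
      ∏ e with M.face (e, false) = f, (-M.sideVec T (Sum.inl (e, false)) /
        M.sideVec T (Sum.inl (M.σ e, false))) = -(r : ℂ) := by
  obtain ⟨r, hr, h⟩ := hK.exists_pos_prod hχ hf
  have h0 : ∀ e, (K e : ℂ) ≠ 0 := fun e => by exact_mod_cast hK.ne_zero hχ e
  refine ⟨r, hr, ?_⟩
  have h1 : ∀ e, -M.sideVec T (Sum.inl (e, false)) / M.sideVec T (Sum.inl (M.σ e, false)) =
      ((-(K e / K (M.σ e)) : ℝ) : ℂ) * (Fw (M.white e) / Fw (M.white (M.τ (M.σ e)))) := by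
    intro e
    rw [hT.sideVec_false, hT.sideVec_false, M.black_σ, M.white_τ]
    have := hb (M.black e)
    have := hw (M.white (M.σ e))
    have := h0 (M.σ e)
    push_cast
    field_simp
  rw [Finset.prod_congr rfl fun e _ => h1 e, Finset.prod_mul_distrib, Finset.prod_div_distrib,
    prod_face_comp f fun e => Fw (M.white e), div_self, mul_one, ← Complex.ofReal_prod, h]
  · simp
  · exact Finset.prod_ne_zero_iff.2 fun e _ => hw _

open Classical in
theorem sum_face_true {β : Type*} [AddCommMonoid β] (f : M.Face) (g : E → β) :
    ∑ e with M.face (e, true) = f, g e = ∑ e with M.face (e, false) = f, g (M.σ e) := by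
  symm
  refine Finset.sum_bij (fun e _ => M.σ e) ?_ ?_ ?_ fun _ _ => rfl
  · intro e he
    simpa using he
  · intro e _ e' _ h
    exact M.σ.injective h
  · intro e he
    refine ⟨M.σ.symm e, ?_, by simp⟩
    have h2 := M.face_σ_true (M.σ.symm e)
    rw [Equiv.apply_symm_apply] at h2
    simpa [← h2] using he

theorem intAngle_inl_of_ne {d : E × Bool} (h : M.face d ≠ M.out) :
    M.intAngle T (Sum.inl d) =
      Complex.arg (-M.sideVec T (Sum.inl d) / M.sideVec T (Sum.inl (M.rot d))) := by
  rw [intAngle, M.sideNext_inl_of_ne h]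

open Classical in
/-- At an inner face, the interior angles of one colour are the arguments of numbers with a
negative product. -/
theorem IsTRealisation.exists_arg_eq_intAngle (hT : M.IsTRealisation K Fb Fw T)
    (hK : M.IsKasteleyn χ K) (hχ : ∀ e, 0 < χ e) (hb : ∀ b, Fb b ≠ 0) (hw : ∀ w, Fw w ≠ 0)
    {f : M.Face} (hf : f ≠ M.out) (s : Bool) : ∃ ρ : E → ℂ,
      (∀ e ∈ univ.filter fun e => M.face (e, s) = f, ρ e ≠ 0) ∧
      (∀ e ∈ univ.filter fun e => M.face (e, s) = f,
        M.intAngle T (Sum.inl (e, s)) = Complex.arg (ρ e)) ∧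
      Complex.arg (∏ e with M.face (e, s) = f, ρ e) = Real.pi := by
  obtain ⟨r, hr, h⟩ := hT.arg_prod_false hK hχ hb hw hf
  have hne := hT.sideVec_inl_ne_zero (hK.ne_zero hχ) hb hw
  have harg : ∀ r : ℝ, 0 < r → Complex.arg (-(r : ℂ)) = Real.pi := fun r hr =>
    Complex.arg_eq_pi_iff.2 ⟨by simpa using hr, by simp⟩
  refine ⟨fun e => -M.sideVec T (Sum.inl (e, s)) / M.sideVec T (Sum.inl (M.rot (e, s))),
    fun e _ => div_ne_zero (neg_ne_zero.2 (hne _)) (hne _), fun e he => ?_, ?_⟩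
  · refine intAngle_inl_of_ne ?_
    rw [(Finset.mem_filter.1 he).2]; exact hf
  · cases s with
    | false => simp only [rot_false]; rw [h, harg r hr]
    | true =>
      simp only [rot_true]
      have hflip : ∀ e, M.sideVec T (Sum.inl (e, true)) = -M.sideVec T (Sum.inl (e, false)) :=
        fun e => M.sideVec_inl_opp (e, false)
      -- Passing from black to white corners exchanges the incoming and outgoing sides of the same
      -- dual edges, so the product is inverted.
      have h1 : ∏ e with M.face (e, true) = f, (-M.sideVec T (Sum.inl (e, true)) /
          M.sideVec T (Sum.inl (M.τ e, true))) = (-(r : ℂ))⁻¹ := by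
        rw [← h, ← Finset.prod_inv_distrib]
        have h2 := sum_face_true (β := Additive ℂ) f fun e => Additive.ofMul
          (-M.sideVec T (Sum.inl (e, true)) / M.sideVec T (Sum.inl (M.τ e, true)))
        rw [← ofMul_prod, ← ofMul_prod] at h2
        rw [Additive.ofMul.injective h2]
        simp only [inv_div]
        rw [Finset.prod_div_distrib, Finset.prod_div_distrib, Finset.prod_neg, Finset.prod_neg]
        simp only [hflip]
        rw [Finset.prod_neg, Finset.prod_neg,
          prod_face_comp f fun e => M.sideVec T (Sum.inl (e, false))]
        have hsq : ((-1 : ℂ) ^ (univ.filter fun e => M.face (e, false) = f).card) ^ 2 = 1 := by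
          rw [← pow_mul, mul_comm, pow_mul]; simp
        have hp : ∏ e with M.face (e, false) = f, M.sideVec T (Sum.inl (e, false)) ≠ 0 :=
          Finset.prod_ne_zero_iff.2 fun e _ => hne _
        have h1 : ((-1 : ℂ) ^ (univ.filter fun e => M.face (e, false) = f).card) ≠ 0 :=
          pow_ne_zero _ (by norm_num)
        field_simp
        rw [hsq, one_mul]
      rw [h1, ← neg_inv, ← Complex.ofReal_inv, harg _ (inv_pos.2 hr)]

open Classical in
/-- The count of all angles: if the sum of the angles at the outer boundary is large enough, then
the sums of angles at inner faces and the total turning of the boundaries of faces are minimal. -/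
theorem angle_sums_eq (hT : ∀ s, M.sideVec T s ≠ 0)
    (hin : ∀ f : M.Face, f ≠ M.out → ∀ s, Real.pi ≤ ∑ e with M.face (e, s) = f,
      |M.intAngle T (Sum.inl (e, s))|)
    (hbd : Fintype.card M.OutDart * Real.pi - 2 * Real.pi ≤
      ∑ d : M.OutDart, (|M.intAngle T (Sum.inl d.1)| + |M.intAngle T (Sum.inr d)|)) :
    (∀ f : M.Face, f ≠ M.out → ∀ s, ∑ e with M.face (e, s) = f, |M.intAngle T (Sum.inl (e, s))| =
      Real.pi) ∧
    ∀ v, ∑ s with M.sideFace s = v, |M.extAngle T s| = 2 * Real.pi := by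
  have hext := fun v => M.two_pi_le_sum_extAngle hT v
  -- Let `N` be the number of boundary vertices. There are `2#E + N` sides, each carrying the total
  -- angle π. The lower bounds are 2π for every face of the augmented dual, π for every colour at
  -- every inner vertex, and `Nπ - 2π` at the boundary; by Euler's formula they already add up to
  -- the total, so each is attained.
  have htot : ∑ v, ∑ s with M.sideFace s = v, |M.extAngle T s| + ∑ s, |M.intAngle T s| =
      (2 * Fintype.card E + Fintype.card M.OutDart) * Real.pi := by
    rw [Finset.sum_fiberwise univ M.sideFace, ← Finset.sum_add_distrib,
      Finset.sum_congr rfl fun s _ => M.abs_extAngle_add hT s, Finset.sum_const, nsmul_eq_mul,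
      Finset.card_univ, Fintype.card_sum, Fintype.card_prod, Fintype.card_bool]
    push_cast; ring
  have hsplit : ∑ d : E × Bool, |M.intAngle T (Sum.inl d)| =
      ∑ q ∈ (univ.erase M.out) ×ˢ (univ : Finset Bool), ∑ e with M.face (e, q.2) = q.1,
        |M.intAngle T (Sum.inl (e, q.2))| + ∑ d : M.OutDart, |M.intAngle T (Sum.inl d.1)| := by
    have h1 : ∑ d : M.OutDart, |M.intAngle T (Sum.inl d.1)| =
        ∑ d with M.face d = M.out, |M.intAngle T (Sum.inl d)| :=
      (Finset.sum_subtype _ (by simp) fun d => |M.intAngle T (Sum.inl d)|).symm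
    rw [h1, Finset.sum_product, ← Finset.sum_fiberwise univ M.face,
      ← Finset.sum_erase_add univ _ (mem_univ M.out)]
    congr 1
    refine Finset.sum_congr rfl fun f _ => ?_
    rw [Finset.sum_filter, Fintype.sum_prod_type_right]
    refine Finset.sum_congr rfl fun s _ => ?_
    rw [Finset.sum_filter]
  have hin' : ∀ q ∈ (univ.erase M.out) ×ˢ (univ : Finset Bool), Real.pi ≤
      ∑ e with M.face (e, q.2) = q.1, |M.intAngle T (Sum.inl (e, q.2))| := fun q hq =>
    hin q.1 (Finset.ne_of_mem_erase (Finset.mem_product.1 hq).1) q.2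
  have hsum1 := Finset.sum_le_sum hin'
  have hsum2 := Finset.sum_le_sum fun v (_ : v ∈ univ) => hext v
  rw [Finset.sum_const, nsmul_eq_mul, Finset.card_product, Finset.card_erase_of_mem (mem_univ _),
    Finset.card_univ, Finset.card_univ, Fintype.card_bool] at hsum1
  rw [Finset.sum_const, nsmul_eq_mul, Finset.card_univ, Fintype.card_sum] at hsum2
  have hsum : ∑ s, |M.intAngle T s| = ∑ d : E × Bool, |M.intAngle T (Sum.inl d)| +
      ∑ d, |M.intAngle T (Sum.inr d)| := Fintype.sum_sum_type _
  rw [hsum, hsplit] at htot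
  rw [Finset.sum_add_distrib] at hbd
  have heuler : (Fintype.card M.Black : ℝ) + Fintype.card M.White + Fintype.card M.Face =
      Fintype.card E + 2 := by exact_mod_cast M.card_add_card_add_card
  have hF : 1 ≤ Fintype.card M.Face := Fintype.card_pos_iff.2 ⟨M.out⟩
  push_cast [Nat.cast_sub hF] at hsum1 hsum2
  have hmul : ((Fintype.card M.Black : ℝ) + Fintype.card M.White + Fintype.card M.Face) * Real.pi =
      (Fintype.card E + 2) * Real.pi := by rw [heuler]
  constructor
  · intro f hf s
    have h1 := (Finset.sum_eq_sum_iff_of_le hin').1 (by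
      rw [Finset.sum_const, nsmul_eq_mul, Finset.card_product,
        Finset.card_erase_of_mem (mem_univ _), Finset.card_univ, Finset.card_univ,
        Fintype.card_bool]
      push_cast [Nat.cast_sub hF]
      linarith) (f, s) (by simp [hf])
    exact h1.symm
  · intro v
    have h1 := (Finset.sum_eq_sum_iff_of_le fun v (_ : v ∈ univ) => hext v).1 (by
      rw [Finset.sum_const, nsmul_eq_mul, Finset.card_univ, Fintype.card_sum]
      push_cast
      linarith) v (mem_univ v)
    exact h1.symm

end AngleSums

end MarkedBipartiteMap

end

noncomputable section

namespace MarkedBipartiteMap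

open Finset PlanarPolygon

variable {E : Type*} [Fintype E] {M : MarkedBipartiteMap E} {T : M.DualVertex → ℂ}

/-! ### Non-degeneracy and orientation of faces -/

theorem IsFlat.extAngle_eq {v : M.DualFace} (h : M.IsFlat T v) {s : M.Side}
    (hs : M.sideFace s = v) : M.extAngle T s = 0 ∨ M.extAngle T s = Real.pi := by
  have h1 := h (M.sideNext s) s (by rw [M.sideFace_next, hs]) hs
  have h2 : (M.sideVec T (M.sideNext s) / M.sideVec T s).im = 0 := by
    have h3 : M.sideVec T (M.sideNext s) / M.sideVec T s =
        ((Complex.normSq (M.sideVec T s))⁻¹ : ℝ) *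
          (conj (M.sideVec T s) * M.sideVec T (M.sideNext s)) := by
      rw [div_eq_mul_inv, Complex.inv_def]; push_cast; ring
    rw [h3, Complex.im_ofReal_mul, h1, mul_zero]
  rcases le_or_gt 0 (M.sideVec T (M.sideNext s) / M.sideVec T s).re with h3 | h3
  · exact Or.inl (Complex.arg_eq_zero_iff.2 ⟨h3, h2⟩)
  · exact Or.inr (Complex.arg_eq_pi_iff.2 ⟨h3, h2⟩)

open Classical in
theorem isFlat_of_intAngle_eq_zero (hne : ∀ s, M.sideVec T s ≠ 0) {s : M.Side}
    (h : ∑ s' with M.sideFace s' = M.sideFace s, |M.extAngle T s'| = 2 * Real.pi)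
    (hs : M.intAngle T s = 0) : M.IsFlat T (M.sideFace s) := by
  classical
  refine M.isFlat_of_extAngle_eq_pi hne (by convert h) ?_
  have h1 := M.abs_extAngle_add hne s
  rw [hs, abs_zero, add_zero] at h1
  rcases abs_eq Real.pi_pos.le |>.1 h1 with h2 | h2
  · exact h2
  · exact absurd h2 (Complex.neg_pi_lt_arg _).ne'

open Classical in
theorem eq_zero_of_intAngle_eq_pi {s : Bool} {f : M.Face}
    (hin : ∑ e with M.face (e, s) = f, |M.intAngle T (Sum.inl (e, s))| = Real.pi)
    {e e' : E} (he : M.face (e, s) = f) (he' : M.face (e', s) = f) (hne : e ≠ e')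
    (hpi : |M.intAngle T (Sum.inl (e, s))| = Real.pi) : M.intAngle T (Sum.inl (e', s)) = 0 := by
  classical
  have h1 : |M.intAngle T (Sum.inl (e, s))| + |M.intAngle T (Sum.inl (e', s))| ≤
      ∑ e with M.face (e, s) = f, |M.intAngle T (Sum.inl (e, s))| := by
    rw [← Finset.sum_pair hne (f := fun e => |M.intAngle T (Sum.inl (e, s))|)]
    refine Finset.sum_le_sum_of_subset_of_nonneg ?_ fun _ _ _ => abs_nonneg _
    intro x hx
    rcases Finset.mem_insert.1 hx with rfl | hx
    · simpa using he
    · rw [Finset.mem_singleton.1 hx]; simpa using he'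
  have h2 : |M.intAngle T (Sum.inl (e', s))| ≤ 0 := by
    have h3 : ∑ e with M.face (e, s) = f, |M.intAngle T (Sum.inl (e, s))| = Real.pi := by
      convert hin
    linarith
  exact abs_eq_zero.1 (le_antisymm h2 (abs_nonneg _))

-- Take a cluster of flat faces of one colour, connected through common neighbours. Every corner of
-- a flat face is straight or a U-turn, and total turning 2π allows at most two U-turns. At an inner
-- vertex of the dual a straight corner uses up the whole angle π of its colour: it is the only
-- straight one there, and all other corners of that colour are U-turns of flat faces, so the vertex
-- is surrounded by the cluster. Thus the number of edges at the cluster `S` is at most `#F + 2#S`,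
-- where `F` is the set of these vertices. Euler's inequality `#F + #S + #N ≤ #edges + 1` leaves at
-- most `#S + 1` neighbours, against the assumed `#S + 2`.
open Classical in
theorem not_isFlat_of_spread {U V : Type*} [Fintype U] [Fintype V] (s : Bool) {u : E → U}
    {v : E → V} (hu : Function.Surjective u)
    (hus : ∀ e e', u e = u e' ↔ M.vert (e, s) = M.vert (e', s))
    (hvs : ∀ e e', v e = v e' ↔ M.vert (e, !s) = M.vert (e', !s))
    (h1 : ∀ (c : U → ℚ) (g : M.Face → ℚ),
      ∑ e, c (u e) * (g (M.face (e, true)) - g (M.face (e, false))) = 0)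
    (h2 : ∀ (c : V → ℚ) (g : M.Face → ℚ),
      ∑ e, c (v e) * (g (M.face (e, true)) - g (M.face (e, false))) = 0)
    (hspread : ∀ S : Set U, S.Nonempty → (∀ b ∈ S, ¬ ∃ e, u e = b ∧ M.face (e, s) = M.out) →
      S.ncard + 2 ≤ {w | ∃ e, u e ∈ S ∧ v e = w}.ncard)
    (hne : ∀ s, M.sideVec T s ≠ 0)
    (hin : ∀ f : M.Face, f ≠ M.out → ∑ e with M.face (e, s) = f,
      |M.intAngle T (Sum.inl (e, s))| = Real.pi)
    (hext : ∀ v, ∑ s with M.sideFace s = v, |M.extAngle T s| = 2 * Real.pi)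
    (hbd : ∀ e, M.face (e, s) = M.out → ¬ M.IsFlat T (M.vert (e, s))) (e₀ : E) :
    ¬ M.IsFlat T (M.vert (e₀, s)) := by
  classical
  intro hfl₀
  set fl : E → Prop := fun e => M.IsFlat T (M.vert (e, s)) with hfl
  let R : E → E → Prop := fun e e' => fl e ∧ fl e' ∧ (u e = u e' ∨ v e = v e')
  let A : E → Prop := fun e => fl e ∧ Relation.EqvGen R e₀ e
  have flu : ∀ {e e'}, u e = u e' → fl e → fl e' := by
    intro e e' h hf
    simp only [hfl] at hf ⊢
    rwa [← (hus e e').1 h]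
  have hAR : ∀ {e e'}, R e e' → (A e ↔ A e') := by
    intro e e' h
    exact ⟨fun hA => ⟨h.2.1, hA.2.trans _ _ _ (Relation.EqvGen.rel _ _ h)⟩,
      fun hA => ⟨h.1, hA.2.trans _ _ _ ((Relation.EqvGen.rel _ _ h).symm _ _)⟩⟩
  have hAu : ∀ {e e'}, u e = u e' → A e → A e' := fun h hA =>
    (hAR ⟨hA.1, flu h hA.1, Or.inl h⟩).1 hA
  have hA₀ : A e₀ := ⟨hfl₀, Relation.EqvGen.refl _⟩
  set S : Finset U := (univ.filter A).image u with hS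
  have hmem : ∀ e, u e ∈ S ↔ A e := by
    intro e
    constructor
    · intro h
      obtain ⟨e', he', h'⟩ := Finset.mem_image.1 h
      exact hAu h' (Finset.mem_filter.1 he').2
    · intro h
      exact Finset.mem_image.2 ⟨e, by simpa using h, rfl⟩
  have hinner : ∀ e, A e → M.face (e, s) ≠ M.out := fun e hA ho => hbd e ho hA.1
  set P := univ.filter fun e => A e ∧ |M.intAngle T (Sum.inl (e, s))| = Real.pi with hP
  set F := P.image fun e => M.face (e, s) with hF
  have hflat : ∀ e ∈ P, ∀ e', M.face (e', s) = M.face (e, s) → fl e' := by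
    intro e he e' hf
    obtain ⟨hA, hpi⟩ := (Finset.mem_filter.1 he).2
    by_cases hee : e = e'
    · rw [← hee]; exact hA.1
    · have h0 := eq_zero_of_intAngle_eq_pi (hin _ (hinner e hA)) rfl hf hee hpi
      exact isFlat_of_intAngle_eq_zero hne (hext _) h0
  have hcard : F.card = P.card := by
    refine Finset.card_image_of_injOn fun e he e' he' h => ?_
    by_contra hee
    have h0 := eq_zero_of_intAngle_eq_pi (hin _ (hinner e' (Finset.mem_filter.1 he').2.1)) h rfl hee
      (Finset.mem_filter.1 he).2.2
    have h3 := (Finset.mem_filter.1 he').2.2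
    rw [h0, abs_zero] at h3
    exact Real.pi_pos.ne h3
  -- An edge seen from its other end is handled through the preceding half-edge on the same face,
  -- which sits at the vertex of the required colour.
  have hflat' : ∀ e ∈ P, ∀ x, M.face x = M.face (e, s) → fl x.1 := by
    intro e he x hx
    have hs : x.2 = s ∨ x.2 = !s := by cases x.2 <;> cases s <;> simp
    rcases hs with hs | hs
    · exact hflat e he x.1 (by rw [← hx, ← hs])
    · have h3 : (M.prev x).2 = s := by
        rcases x with ⟨x, _ | _⟩ <;> cases s <;> simp_all [prev]
      have h4 := hflat e he (M.prev x).1 (by rw [← hx, ← M.face_prev x, ← h3])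
      have h5 : M.opp x = (x.1, s) := by simp [opp, hs]
      have h6 := M.vert_prev x
      rw [h5] at h6
      have h7 : M.prev x = ((M.prev x).1, s) := by rw [← h3]
      rw [h7] at h6
      exact flu ((hus _ _).2 h6) h4
  have hAf : ∀ e ∈ P, ∀ x, M.face x = M.face (e, s) → A x.1 := by
    intro e he x hx
    have h3 := M.eq_of_next_invariant (c := fun x => A x.1) (d := (e, s)) (d' := x)
      (fun y hy => propext (hAR ?_).symm) hx.symm
    · rw [← h3]; exact (Finset.mem_filter.1 he).2.1
    · refine ⟨hflat' e he y hy, hflat' e he _ (by rw [M.face_next, hy]), ?_⟩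
      have h4 := M.vert_opp_next y
      have h5 : M.opp (M.next y) = ((M.next y).1, y.2) := by
        rcases y with ⟨y, _ | _⟩ <;> simp [next, opp]
      rw [h5] at h4
      have hs : y.2 = s ∨ y.2 = !s := by cases y.2 <;> cases s <;> simp
      rcases hs with hs | hs
      · left; rw [hus, ← hs]; exact h4.symm
      · right; rw [hvs, ← hs]; exact h4.symm
  have heuler := card_faces_add_card_le (l := fun e => M.face (e, false))
    (r := fun e => M.face (e, true)) hu h1 h2 (fun g hg => M.eq_of_gradient_eq_zero hg) S
    ⟨u e₀, (hmem e₀).2 hA₀⟩ F (f₀ := M.out) (fun h => by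
      obtain ⟨e, he, h⟩ := Finset.mem_image.1 h
      exact hinner e (Finset.mem_filter.1 he).2.1 h) (fun e he => by
      rw [hmem]
      rcases he with he | he
      · obtain ⟨e', he', h⟩ := Finset.mem_image.1 he
        exact hAf e' he' (e, false) h.symm
      · obtain ⟨e', he', h⟩ := Finset.mem_image.1 he
        exact hAf e' he' (e, true) h.symm) (fun a ha b hb b' hb' => by
      have h3 : ∀ e, Relation.EqvGen R e₀ e → a (u e) = a (u e₀) := by
        intro e he
        have h4 : ∀ e e', R e e' → A e → a (u e) = a (u e') := by
          intro e e' hR hA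
          rcases hR.2.2 with h | h
          · rw [h]
          · exact ha e e' ((hmem e).2 hA) ((hmem e').2 ((hAR hR).1 hA)) h
        have h5 : ∀ e e', Relation.EqvGen R e e' → (A e ↔ A e') ∧ (A e → a (u e) = a (u e')) := by
          intro e e' h
          induction h with
          | rel _ _ h => exact ⟨hAR h, h4 _ _ h⟩
          | refl => exact ⟨Iff.rfl, fun _ => rfl⟩
          | symm _ _ _ ih => exact ⟨ih.1.symm, fun hA => (ih.2 (ih.1.2 hA)).symm⟩
          | trans _ _ _ _ _ ih ih' =>
            exact ⟨ih.1.trans ih'.1, fun hA => (ih.2 hA).trans (ih'.2 (ih.1.1 hA))⟩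
        exact ((h5 _ _ he).2 hA₀).symm
      obtain ⟨e, rfl⟩ := hu b
      obtain ⟨e', rfl⟩ := hu b'
      rw [h3 e ((hmem e).1 hb).2, h3 e' ((hmem e').1 hb').2])
  have hfilter : (univ.filter fun e => u e ∈ S) = univ.filter A := by ext e; simp [hmem]
  rw [hfilter] at heuler
  -- Corners of the cluster outside `P` are U-turns, at most two for each face.
  have hcount : (univ.filter A).card ≤ P.card + 2 * S.card := by
    have h3 : univ.filter A = P ∪ (univ.filter A \ P) :=
      (Finset.union_sdiff_of_subset fun e he =>
        Finset.mem_filter.2 ⟨mem_univ _, (Finset.mem_filter.1 he).2.1⟩).symm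
    rw [h3]
    refine (Finset.card_union_le _ _).trans (Nat.add_le_add_left ?_ _)
    refine Finset.card_le_mul_card_image_of_maps_to (f := u) (fun e he => (hmem e).2
      (Finset.mem_filter.1 (Finset.mem_sdiff.1 he).1).2) 2 fun b hb => ?_
    obtain ⟨e, rfl⟩ := hu b
    have hA := (hmem e).1 hb
    set Q := (univ.filter A \ P).filter fun e' => u e' = u e with hQ
    have h4 : ∀ e' ∈ Q, |M.extAngle T (Sum.inl (e', s))| = Real.pi := by
      intro e' he'
      obtain ⟨h5, h6⟩ := Finset.mem_filter.1 he'
      obtain ⟨h7, h8⟩ := Finset.mem_sdiff.1 h5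
      have h9 := (Finset.mem_filter.1 h7).2
      rcases (IsFlat.extAngle_eq h9.1 (s := Sum.inl (e', s)) rfl) with h | h
      · exfalso
        refine h8 (Finset.mem_filter.2 ⟨mem_univ _, h9, ?_⟩)
        have := M.abs_extAngle_add hne (Sum.inl (e', s))
        rwa [h, abs_zero, zero_add] at this
      · rw [h, abs_of_pos Real.pi_pos]
    have h5 : ∑ e' ∈ Q, |M.extAngle T (Sum.inl (e', s))| ≤ 2 * Real.pi := by
      rw [← hext (M.vert (e, s)), ← Finset.sum_image (s := Q)
        (g := fun e' => (Sum.inl (e', s) : M.Side)) (f := fun x => |M.extAngle T x|)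
        (fun a _ b _ h => (Prod.ext_iff.1 (Sum.inl.inj h)).1)]
      refine Finset.sum_le_sum_of_subset_of_nonneg ?_ fun _ _ _ => abs_nonneg _
      intro x hx
      obtain ⟨e', he', rfl⟩ := Finset.mem_image.1 hx
      have h6 := (hus e' e).1 (Finset.mem_filter.1 he').2
      simpa using h6
    rw [Finset.sum_congr rfl h4, Finset.sum_const, nsmul_eq_mul] at h5
    have := le_of_mul_le_mul_right h5 Real.pi_pos
    exact_mod_cast this
  have hsp := hspread S ⟨u e₀, by exact_mod_cast (hmem e₀).2 hA₀⟩ (by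
    rintro b hb ⟨e, rfl, he⟩
    exact hinner e ((hmem e).1 (by exact_mod_cast hb)) he)
  have hN : {w | ∃ e, u e ∈ (S : Set U) ∧ v e = w} =
      ((univ.filter A).image v : Finset V) := by
    ext w
    simp only [Set.mem_ofPred_eq, Finset.mem_coe, hmem, Finset.mem_image, Finset.mem_filter,
      mem_univ, true_and]
  rw [hN, Set.ncard_coe_finset, Set.ncard_coe_finset] at hsp
  omega

open Classical in
/-- All faces of the augmented dual are (locally) convex and positively oriented. -/
def IsLocallyConvex (M : MarkedBipartiteMap E) (T : M.DualVertex → ℂ) : Prop :=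
  (∀ s, M.sideVec T s ≠ 0) ∧ (∀ s, 0 ≤ M.extAngle T s) ∧ (∀ s, M.extAngle T s < Real.pi) ∧
    ∀ v, ∑ s with M.sideFace s = v, M.extAngle T s = 2 * Real.pi

open Classical in
theorem not_isFlat (hspread : M.IsSpread) (hne : ∀ s, M.sideVec T s ≠ 0)
    (hin : ∀ f : M.Face, f ≠ M.out → ∀ s, ∑ e with M.face (e, s) = f,
      |M.intAngle T (Sum.inl (e, s))| = Real.pi)
    (hext : ∀ v, ∑ s with M.sideFace s = v, |M.extAngle T s| = 2 * Real.pi)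
    (hbd : ∀ d, M.face d = M.out → ¬ M.IsFlat T (M.vert d)) (v : M.DualFace) :
    ¬ M.IsFlat T v := by
  obtain ⟨⟨e, s⟩, rfl⟩ := M.vert_surjective v
  cases s with
  | false =>
    refine not_isFlat_of_spread false M.black_surjective (v := M.white) (by simp) (by simp)
      M.sum_black_gradient_eq_zero M.sum_white_gradient_eq_zero hspread.1 hne
      (fun f hf => hin f hf false) hext (fun e he => hbd _ he) e
  | true =>
    refine not_isFlat_of_spread true M.white_surjective (v := M.black) (by simp) (by simp)
      M.sum_white_gradient_eq_zero M.sum_black_gradient_eq_zero hspread.2 hne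
      (fun f hf => hin f hf true) hext (fun e he => hbd _ he) e

theorem im_neg_inv (r : ℂ) : (-r⁻¹).im = r.im / Complex.normSq r := by
  rw [Complex.neg_im, Complex.inv_im]; ring

theorem intAngle_eq (s : M.Side) : M.intAngle T s =
    Complex.arg (-(M.sideVec T (M.sideNext s) / M.sideVec T s)⁻¹) := by
  rw [intAngle, inv_div, ← neg_div]

theorem extAngle_neg_iff (hne : ∀ s, M.sideVec T s ≠ 0) (s : M.Side) :
    M.extAngle T s < 0 ↔ M.intAngle T s < 0 := by
  have h0 : 0 < Complex.normSq (M.sideVec T (M.sideNext s) / M.sideVec T s) :=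
    Complex.normSq_pos.2 (div_ne_zero (hne _) (hne _))
  rw [intAngle_eq, extAngle, Complex.arg_neg_iff, Complex.arg_neg_iff, im_neg_inv, div_lt_iff₀ h0,
    zero_mul]

-- Flatness being excluded, each face turns in one direction only. Faces of the same colour at an
-- inner vertex of the dual turn in the same direction, and the faces at the boundary turn left, so
-- connectedness carries the positive orientation everywhere.
open Classical in
theorem isLocallyConvex_of_angle_sums {χ K : E → ℝ} {Fb : M.Black → ℂ} {Fw : M.White → ℂ}
    (hspread : M.IsSpread) (hT : M.IsTRealisation K Fb Fw T)
    (hK : M.IsKasteleyn χ K) (hχ : ∀ e, 0 < χ e) (hb : ∀ b, Fb b ≠ 0) (hw : ∀ w, Fw w ≠ 0)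
    (hne : ∀ s, M.sideVec T s ≠ 0)
    (hin : ∀ f : M.Face, f ≠ M.out → ∀ s, ∑ e with M.face (e, s) = f,
      |M.intAngle T (Sum.inl (e, s))| = Real.pi)
    (hext : ∀ v, ∑ s with M.sideFace s = v, |M.extAngle T s| = 2 * Real.pi)
    (hbd : ∀ d : M.OutDart, ∃ s, M.sideFace s = M.vert d.1 ∧ 0 < M.extAngle T s ∧
      M.extAngle T s < Real.pi) :
    M.IsLocallyConvex T := by
  classical
  have hflat := not_isFlat hspread hne hin hext fun d hd hf => by
    obtain ⟨s, h1, h2, h3⟩ := hbd ⟨d, hd⟩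
    rcases hf.extAngle_eq h1 with h | h
    · exact h2.ne' h
    · exact h3.ne h
  have hlt : ∀ s, M.extAngle T s < Real.pi := fun s =>
    lt_of_le_of_ne (Complex.arg_le_pi _) fun h =>
      hflat _ (M.isFlat_of_extAngle_eq_pi hne (by convert hext _) h)
  set pos : M.DualFace → Prop := fun v => (∀ s, M.sideFace s = v → 0 ≤ M.extAngle T s) ∧
    ∑ s with M.sideFace s = v, M.extAngle T s = 2 * Real.pi with hpos
  have hcases : ∀ v, pos v ∨ ∀ s, M.sideFace s = v → M.extAngle T s ≤ 0 := by
    intro v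
    rcases M.turning_cases hne (by convert hext v) with h | h | h
    · exact Or.inl h
    · exact Or.inr h
    · exact absurd h (hflat v)
  have hpos_of : ∀ s, 0 < M.extAngle T s → pos (M.sideFace s) := by
    intro s hs
    rcases hcases (M.sideFace s) with h | h
    · exact h
    · exact absurd (h s rfl) (not_le.2 hs)
  have hneg_of : ∀ s, M.extAngle T s < 0 → ¬ pos (M.sideFace s) := fun s hs h =>
    absurd (h.1 s rfl) (not_le.2 hs)
  -- If one of two distinct corners were straight, the other would have angle zero and its face
  -- would be flat. So the orientation of both faces can be read off their corners here, and the
  -- equality case for a negative product gives these interior angles a common sign.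
  have hcorner : ∀ (s : Bool) e e', M.face (e, s) ≠ M.out → M.face (e', s) = M.face (e, s) →
      (pos (M.vert (e, s)) ↔ pos (M.vert (e', s))) := by
    intro s e e' ho hf
    by_cases hee : e = e'
    · rw [hee]
    have hint0 : ∀ x, M.intAngle T x ≠ 0 := fun x hx =>
      hflat _ (isFlat_of_intAngle_eq_zero hne (hext _) hx)
    have hext0 : ∀ a b, M.face (a, s) = M.face (e, s) → M.face (b, s) = M.face (e, s) → a ≠ b →
        M.extAngle T (Sum.inl (a, s)) ≠ 0 := by
      intro a b ha hb hab h0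
      have h1 := M.abs_extAngle_add hne (Sum.inl (a, s))
      rw [h0, abs_zero, zero_add] at h1
      exact hint0 _ (eq_zero_of_intAngle_eq_pi (hin _ ho s) ha hb hab h1)
    obtain ⟨ρ, hρ0, hρ, hprod⟩ := hT.exists_arg_eq_intAngle hK hχ hb hw ho s
    have hm : ∀ a, M.face (a, s) = M.face (e, s) →
        a ∈ univ.filter fun a => M.face (a, s) = M.face (e, s) := fun a ha => by simpa using ha
    have hsame := same_sign_of_sum_abs_arg_eq_pi _ ρ hρ0 hprod (by
      rw [← hin _ ho s]
      exact Finset.sum_congr rfl fun a ha => by rw [hρ a ha])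
    have e0 := hext0 e e' rfl hf hee
    have e0' := hext0 e' e hf rfl (Ne.symm hee)
    have sgn : ∀ a, M.extAngle T (Sum.inl (a, s)) ≠ 0 → ∀ p, (p ↔ pos (M.vert (a, s))) →
        (0 < M.extAngle T (Sum.inl (a, s)) ↔ p) := by
      intro a ha p hp
      rw [hp]
      refine ⟨fun h => hpos_of _ h, fun h => ?_⟩
      by_contra hcon
      exact hneg_of _ (lt_of_le_of_ne (not_lt.1 hcon) ha) h
    rw [← sgn e e0 _ Iff.rfl, ← sgn e' e0' _ Iff.rfl]
    have hneg : ∀ a, M.extAngle T (Sum.inl (a, s)) ≠ 0 →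
        (0 < M.extAngle T (Sum.inl (a, s)) ↔ 0 < M.intAngle T (Sum.inl (a, s))) := by
      intro a ha
      rw [← not_iff_not, not_lt, not_lt, le_iff_lt_or_eq, le_iff_lt_or_eq,
        extAngle_neg_iff hne]
      simp [ha, hint0]
    rw [hneg e e0, hneg e' e0', hρ e (hm e rfl), hρ e' (hm e' hf)]
    have i0 := hint0 (Sum.inl (e, s))
    have i0' := hint0 (Sum.inl (e', s))
    rw [hρ e (hm e rfl)] at i0
    rw [hρ e' (hm e' hf)] at i0'
    rcases hsame with h | h
    · exact iff_of_true (lt_of_le_of_ne (h e (hm e rfl)) i0.symm)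
        (lt_of_le_of_ne (h e' (hm e' hf)) i0'.symm)
    · exact iff_of_false (not_lt.2 (h e (hm e rfl))) (not_lt.2 (h e' (hm e' hf)))
  have hout : ∀ d, M.face d = M.out → pos (M.vert d) := by
    intro d hd
    obtain ⟨s, h1, h2, -⟩ := hbd ⟨d, hd⟩
    have := hpos_of s h2
    rwa [h1] at this
  have hall : ∀ e, pos (M.vert (e, false)) ∧ pos (M.vert (e, true)) := by
    intro e
    obtain ⟨e₀, he₀⟩ := M.face_false_surjective M.out
    obtain ⟨e₁, he₁⟩ := M.face_true_surjective M.out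
    constructor
    · have := M.eq_of_invariant (c := fun e => pos (M.vert (e, false))) (fun e => by simp)
        (fun e => ?_) e₀ e
      · rw [← this]; exact hout _ he₀
      · have hv : M.vert (M.σ.symm e, false) = M.vert (e, false) := by
          have := M.black_σ (M.σ.symm e)
          rw [Equiv.apply_symm_apply] at this
          simp [this]
        have hf : M.face (M.σ.symm e, false) = M.face (M.τ e, false) := by
          have := M.face_σ_true (M.σ.symm e)
          rw [Equiv.apply_symm_apply] at this
          rw [← this, M.face_τ_false]
        refine propext ?_
        rw [← hv]
        by_cases ho : M.face (M.σ.symm e, false) = M.out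
        · exact iff_of_true (hout _ (hf ▸ ho)) (hout _ ho)
        · exact (hcorner false _ _ ho hf.symm).symm
    · have := M.eq_of_invariant (c := fun e => pos (M.vert (e, true))) (fun e => ?_)
        (fun e => by simp) e₁ e
      · rw [← this]; exact hout _ he₁
      · have hv : M.vert (M.τ.symm e, true) = M.vert (e, true) := by
          have := M.white_τ (M.τ.symm e)
          rw [Equiv.apply_symm_apply] at this
          simp [this]
        have hf : M.face (M.τ.symm e, true) = M.face (M.σ e, true) := by
          have := M.face_τ_false (M.τ.symm e)
          rw [Equiv.apply_symm_apply] at this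
          rw [← this, M.face_σ_true]
        refine propext ?_
        rw [← hv]
        by_cases ho : M.face (M.τ.symm e, true) = M.out
        · exact iff_of_true (hout _ (hf ▸ ho)) (hout _ ho)
        · exact (hcorner true _ _ ho hf.symm).symm
  have hall' : ∀ v, pos v := by
    intro v
    obtain ⟨⟨e, s⟩, rfl⟩ := M.vert_surjective v
    cases s with
    | false => exact (hall e).1
    | true => exact (hall e).2
  refine ⟨hne, fun s => (hall' (M.sideFace s)).1 s rfl, hlt, fun v => ?_⟩
  convert (hall' v).2

end MarkedBipartiteMap

end

noncomputable section

namespace MarkedBipartiteMap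

open Finset PlanarPolygon

variable {E : Type*} [Fintype E] {M : MarkedBipartiteMap E} {T : M.DualVertex → ℂ}

/-! ### Embeddings -/

namespace IsLocallyConvex

theorem left (h : M.IsLocallyConvex T) {s s' : M.Side} (hs : M.sideFace s' = M.sideFace s) :
    0 ≤ (conj (T (M.tgt s) - T (M.src s)) * (T (M.src s') - T (M.src s))).im := by
  classical
  obtain ⟨hne, h0, -, hsum⟩ := h
  obtain ⟨n, z, hz, hn, hz0, hzs, -, hturn, hex, -, hps, hfs⟩ := M.exists_polygon hne s
  obtain ⟨i, hi, rfl⟩ := hex s' hs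
  have h1 : dir z n = 2 * Real.pi := by
    rw [← hsum (M.sideFace s), dir, Finset.sum_congr rfl fun i _ => hturn i, ← hfs]
  have h2 := left_of_first_side hz0 hzs (fun i _ => by rw [hturn]; exact h0 _) h1 hi.le
  rw [hps, hz] at h2
  exact h2

theorem exists_left (h : M.IsLocallyConvex T) (s : M.Side) :
    ∃ s', M.sideFace s' = M.sideFace s ∧
      0 < (conj (T (M.tgt s) - T (M.src s)) * (T (M.src s') - T (M.src s))).im := by
  classical
  obtain ⟨hne, h0, hlt, hsum⟩ := h
  obtain ⟨n, z, hz, hn, hz0, hzs, -, hturn, hex, -, hps, hfs⟩ := M.exists_polygon hne s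
  have h1 : dir z n = 2 * Real.pi := by
    rw [← hsum (M.sideFace s), dir, Finset.sum_congr rfl fun i _ => hturn i, ← hfs]
  obtain ⟨j, -, h2⟩ := exists_left_of_first_side hz0 (fun i _ => by rw [hturn]; exact h0 _)
    (fun i _ => by rw [hturn]; exact hlt _) h1
  rw [hps, hz] at h2
  refine ⟨M.sideNext^[j] s, ?_, h2⟩
  clear h2
  induction j with
  | zero => rfl
  | succ j ih => rw [Function.iterate_succ_apply', M.sideFace_next, ih]

theorem disjoint_sides (h : M.IsLocallyConvex T) {s s' : M.Side}
    (hs : M.sideFace s' = M.sideFace s) (hss : s ≠ s') {t t' : ℝ}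
    (ht : 0 < t) (ht1 : t ≤ 1) (ht' : 0 < t') (ht1' : t' ≤ 1) :
    T (M.src s) + t * (T (M.tgt s) - T (M.src s)) ≠
      T (M.src s') + t' * (T (M.tgt s') - T (M.src s')) := by
  classical
  obtain ⟨hne, h0, hlt, hsum⟩ := h
  obtain ⟨n, z, hz, hn, hz0, hzs, -, hturn, hex, -, hps, hfs⟩ := M.exists_polygon hne s
  obtain ⟨i, hi, rfl⟩ := hex s' hs
  have h1 : dir z n = 2 * Real.pi := by
    rw [← hsum (M.sideFace s), dir, Finset.sum_congr rfl fun i _ => hturn i, ← hfs]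
  have hi0 : 0 < i := Nat.pos_of_ne_zero fun h => hss (by rw [h]; rfl)
  have h2 := sides_disjoint hz0 hzs (fun i _ => by rw [hturn]; exact h0 _)
    (fun i _ => by rw [hturn]; exact hlt _) h1 hi0 hi ht ht1 ht' ht1'
  rw [hps, hz, hz] at h2
  intro h3
  refine h2 ?_
  simp only [sideVec, Function.iterate_zero, id]
  linear_combination h3

theorem isConvexFace (h : M.IsLocallyConvex T) (v : M.DualFace) : M.IsConvexFace T v := by
  constructor
  · intro q hq x hx
    obtain ⟨s', hs', rfl⟩ := M.mem_faceVertices_iff.1 hx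
    rcases M.exists_side_of_mem_faceSides hq with h1 | ⟨s, hs, rfl⟩
    · rw [h1]; simp
    · exact h.left (hs'.trans hs.symm)
  · obtain ⟨s, rfl⟩ := M.sideFace_surjective v
    obtain ⟨s', hs', h1⟩ := h.exists_left s
    exact ⟨_, M.mem_faceSides_side s, _, M.mem_faceVertices_iff.2 ⟨s', hs', rfl⟩, h1⟩

theorem intAngle_pos (h : M.IsLocallyConvex T) (s : M.Side) : 0 < M.intAngle T s := by
  have h1 := (not_congr (extAngle_neg_iff h.1 s)).1 (not_lt.2 (h.2.1 s))
  refine lt_of_le_of_ne (not_lt.1 h1) fun h0 => ?_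
  have h2 := M.abs_extAngle_add h.1 s
  rw [← h0, abs_zero, add_zero, abs_of_nonneg (h.2.1 s)] at h2
  exact (h.2.2.1 s).ne h2

end IsLocallyConvex

open Classical in
/-- The angle of a face seen from a point. -/
def faceView (T : M.DualVertex → ℂ) (v : M.DualFace) (w : ℂ) : ℝ :=
  ∑ s with M.sideFace s = v, view (T (M.src s)) (T (M.tgt s)) w

/-- Every dual edge is a side of one black and one white face, in opposite directions, so only the
boundary sides survive. -/
theorem sum_faceView (T : M.DualVertex → ℂ) (w : ℂ) :
    ∑ v, faceView T v w = outerView M.outNext (fun d => T (M.vtx d.1)) w := by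
  classical
  have h1 : ∑ v, faceView T v w = ∑ s, view (T (M.src s)) (T (M.tgt s)) w :=
    Finset.sum_fiberwise univ M.sideFace _
  have h2 : ∑ s, view (T (M.src s)) (T (M.tgt s)) w =
      ∑ d : E × Bool, view (T (M.src (Sum.inl d))) (T (M.tgt (Sum.inl d))) w +
      ∑ d, view (T (M.src (Sum.inr d))) (T (M.tgt (Sum.inr d))) w := Fintype.sum_sum_type _
  rw [h1, h2, Fintype.sum_prod_type]
  have h3 : ∀ e : E, ∑ s : Bool, view (T (M.src (Sum.inl (e, s)))) (T (M.tgt (Sum.inl (e, s)))) w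
      = 0 := by
    intro e
    rw [Fintype.sum_bool]
    simp only [src_inl, tgt_inl, opp, Bool.not_true, Bool.not_false]
    rw [view_swap]; ring
  rw [Finset.sum_congr rfl fun e _ => h3 e, Finset.sum_const_zero, zero_add]
  rfl

open Classical in
/-- A lower bound on the angle of a face seen from a point of its boundary. -/
def visitWeight (T : M.DualVertex → ℂ) (w : ℂ) (s : M.Side) : ℝ :=
  if T (M.tgt s) = w then M.intAngle T s
  else if ∃ t : ℝ, 0 < t ∧ t < 1 ∧ w = T (M.src s) + t * (T (M.tgt s) - T (M.src s)) then Real.pi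
  else 0

namespace IsLocallyConvex

theorem faceView_nonneg (h : M.IsLocallyConvex T) (v : M.DualFace) (w : ℂ) :
    0 ≤ faceView T v w := by
  classical
  refine sum_view_nonneg (p := M.sideNext) (fun s => by simp [M.sideFace_next])
    (fun s => by rw [M.src_sideNext]) (fun s hs s' hs' => ?_) w
  exact h.left ((Finset.mem_filter.1 hs').2.trans (Finset.mem_filter.1 hs).2.symm)

theorem visitWeight_nonneg (h : M.IsLocallyConvex T) (w : ℂ) (s : M.Side) :
    0 ≤ visitWeight T w s := by
  rw [visitWeight]
  split_ifs
  · exact (h.intAngle_pos s).le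
  · exact Real.pi_pos.le
  · exact le_rfl

theorem exists_of_visitWeight_ne_zero {w : ℂ} {s : M.Side} (hs : visitWeight T w s ≠ 0) :
    ∃ t : ℝ, 0 < t ∧ t ≤ 1 ∧ w = T (M.src s) + t * (T (M.tgt s) - T (M.src s)) := by
  rw [visitWeight] at hs
  split_ifs at hs with h1 h2
  · exact ⟨1, one_pos, le_rfl, by rw [← h1]; push_cast; ring⟩
  · obtain ⟨t, h3, h4, h5⟩ := h2
    exact ⟨t, h3, h4.le, h5⟩
  · exact absurd rfl hs

theorem visitWeight_pos (h : M.IsLocallyConvex T) {w : ℂ} {s : M.Side} {t : ℝ} (h0 : 0 < t)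
    (h1 : t ≤ 1) (hw : w = T (M.src s) + t * (T (M.tgt s) - T (M.src s))) :
    0 < visitWeight T w s := by
  rw [visitWeight]
  split_ifs with h2 h3
  · exact h.intAngle_pos s
  · exact Real.pi_pos
  · exfalso
    rcases h1.lt_or_eq with h4 | h4
    · exact h3 ⟨t, h0, h4, hw⟩
    · refine h2 ?_
      rw [hw, h4]; push_cast; ring

theorem visitWeight_open (h : M.IsLocallyConvex T) {w : ℂ} {s : M.Side} {t : ℝ} (h0 : 0 < t)
    (h1 : t < 1) (hw : w = T (M.src s) + t * (T (M.tgt s) - T (M.src s))) :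
    T (M.tgt s) ≠ w ∧ visitWeight T w s = Real.pi := by
  have h2 : T (M.tgt s) ≠ w := by
    intro h2
    have h3 : (1 - (t : ℂ)) * M.sideVec T s = 0 := by
      rw [sideVec]; linear_combination h2 + hw
    rcases mul_eq_zero.1 h3 with h4 | h4
    · have : (t : ℂ) = 1 := by linear_combination -h4
      exact h1.ne (by exact_mod_cast this)
    · exact h.1 s h4
  refine ⟨h2, ?_⟩
  rw [visitWeight, if_neg h2, if_pos ⟨t, h0, h1, hw⟩]

theorem visitWeight_vertex (s : M.Side) :
    visitWeight T (T (M.tgt s)) s = M.intAngle T s := by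
  rw [visitWeight, if_pos rfl]

/-- The half-open sides of a face are disjoint, so at most one of them passes through `w`; the view
of the face then dominates the weight of that side. Faces not passing through `w` have nonnegative
view. -/
theorem sum_visitWeight_le (h : M.IsLocallyConvex T) (w : ℂ) :
    ∑ s, visitWeight T w s ≤ outerView M.outNext (fun d => T (M.vtx d.1)) w := by
  classical
  rw [← sum_faceView, ← Finset.sum_fiberwise univ M.sideFace]
  refine Finset.sum_le_sum fun v _ => ?_
  by_cases hv : ∃ s, M.sideFace s = v ∧ visitWeight T w s ≠ 0
  · obtain ⟨s, rfl, hs⟩ := hv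
    have hC : ∀ s', M.sideNext s' ∈ univ.filter (fun s' => M.sideFace s' = M.sideFace s) ↔
        s' ∈ univ.filter (fun s' => M.sideFace s' = M.sideFace s) := fun s' => by
      simp [M.sideFace_next]
    have hdis : ∀ a ∈ univ.filter (fun s' => M.sideFace s' = M.sideFace s),
        ∀ b ∈ univ.filter (fun s' => M.sideFace s' = M.sideFace s), a ≠ b → ∀ t t' : ℝ,
        0 < t → t ≤ 1 → 0 < t' → t' ≤ 1 → T (M.src a) + t * (T (M.tgt a) - T (M.src a)) ≠
          T (M.src b) + t' * (T (M.tgt b) - T (M.src b)) := by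
      intro a ha b hb hab t t' h1 h2 h3 h4
      exact h.disjoint_sides ((Finset.mem_filter.1 hb).2.trans (Finset.mem_filter.1 ha).2.symm) hab
        h1 h2 h3 h4
    have hleft : ∀ a ∈ univ.filter (fun s' => M.sideFace s' = M.sideFace s),
        ∀ b ∈ univ.filter (fun s' => M.sideFace s' = M.sideFace s),
        0 ≤ (conj (T (M.tgt a) - T (M.src a)) * (T (M.src b) - T (M.src a))).im := fun a ha b hb =>
      h.left ((Finset.mem_filter.1 hb).2.trans (Finset.mem_filter.1 ha).2.symm)
    have hne : ∀ a ∈ univ.filter (fun s' => M.sideFace s' = M.sideFace s),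
        T (M.src a) ≠ T (M.tgt a) := fun a _ hc => h.1 a (by rw [sideVec, hc, sub_self])
    have hmem : s ∈ univ.filter (fun s' => M.sideFace s' = M.sideFace s) := by simp
    rw [Finset.sum_eq_single_of_mem s hmem]
    · rw [visitWeight]
      split_ifs with h1 h2
      · have := interior_angle_le_sum_view hdis hC (fun s => by rw [M.src_sideNext]) hne hleft hmem
        rw [h1] at this
        refine le_trans (le_of_eq ?_) this
        rw [intAngle, sideVec, sideVec, h1]
      · obtain ⟨t, h3, h4, h5⟩ := h2
        exact pi_le_sum_view_of_mem_side hdis hC (fun s => by rw [M.src_sideNext]) hne hleft hmem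
          h3 h4 h5
      · exact h.faceView_nonneg _ w
    · intro b hb hbs
      by_contra hb0
      obtain ⟨t, h1, h2, h3⟩ := exists_of_visitWeight_ne_zero hb0
      obtain ⟨t', h4, h5, h6⟩ := exists_of_visitWeight_ne_zero hs
      exact hdis b hb s hmem hbs t t' h1 h2 h4 h5 (h3.symm.trans h6)
  · push Not at hv
    rw [Finset.sum_eq_zero fun s hs => hv s (Finset.mem_filter.1 hs).2]
    exact h.faceView_nonneg v w

end IsLocallyConvex

theorem exists_tgt_eq (x : M.DualVertex) : ∃ s, M.tgt s = x := by
  obtain ⟨d, rfl⟩ := M.vtx_surjective x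
  exact ⟨Sum.inl d, rfl⟩

/-- The points of the interior of a convex polygon lie strictly on the left of all its sides. -/
theorem im_pos_of_mem_interior {S : Set ℂ} {a z w : ℂ} (hz : z ≠ 0)
    (hS : ∀ x ∈ S, 0 ≤ (conj z * (x - a)).im) (hw : w ∈ interior (convexHull ℝ S)) :
    0 < (conj z * (w - a)).im := by
  have hconv : Convex ℝ {x : ℂ | 0 ≤ (conj z * (x - a)).im} := by
    intro x hx y hy p q hp hq hpq
    simp only [Set.mem_ofPred_eq] at hx hy ⊢
    have h1 : conj z * (p • x + q • y - a) =
        (p : ℂ) * (conj z * (x - a)) + (q : ℂ) * (conj z * (y - a)) := by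
      have : (p : ℂ) + q = 1 := by exact_mod_cast hpq
      rw [Complex.real_smul, Complex.real_smul]
      linear_combination conj z * a * this
    rw [h1, Complex.add_im, Complex.im_ofReal_mul, Complex.im_ofReal_mul]
    positivity
  have hsub : convexHull ℝ S ⊆ {x : ℂ | 0 ≤ (conj z * (x - a)).im} := convexHull_min hS hconv
  -- A small displacement of `w` to the right of the line stays in the convex hull, which makes the
  -- inequality at `w` strict.
  have htend : Filter.Tendsto (fun t : ℝ => w - t * (Complex.I * z)) (nhds 0) (nhds w) := by
    have : Continuous fun t : ℝ => w - t * (Complex.I * z) := by fun_prop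
    simpa using this.tendsto 0
  have hev := htend.eventually (mem_interior_iff_mem_nhds.1 hw)
  obtain ⟨t, ht, ht0⟩ := ((hev.filter_mono nhdsWithin_le_nhds).and
    (self_mem_nhdsWithin (a := (0 : ℝ)) (s := Set.Ioi 0))).exists
  have h1 := hsub ht
  simp only [Set.mem_ofPred_eq] at h1
  have h2 : conj z * (w - t * (Complex.I * z) - a) =
      conj z * (w - a) - ((t * Complex.normSq z : ℝ) : ℂ) * Complex.I := by
    push_cast
    rw [Complex.normSq_eq_conj_mul_self]; ring
  rw [h2, Complex.sub_im, Complex.im_ofReal_mul, Complex.I_im, mul_one] at h1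
  have h3 : 0 < t * Complex.normSq z := mul_pos ht0 (Complex.normSq_pos.2 hz)
  linarith

open Classical in
/-- Locally convex realisations with a star-shaped boundary are proper embeddings. -/
theorem IsLocallyConvex.isProperEmbedding (h : M.IsLocallyConvex T)
    (hin : ∀ f : M.Face, f ≠ M.out → ∀ s, ∑ e with M.face (e, s) = f,
      |M.intAngle T (Sum.inl (e, s))| = Real.pi)
    (hstar : ∀ d : M.OutDart, 0 < (conj (T (M.vtx d.1)) * T (M.vtx (M.next d.1))).im)
    (hsum : ∑ d : M.OutDart, Complex.arg (T (M.vtx (M.next d.1)) / T (M.vtx d.1)) = 2 * Real.pi)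
    (hangle : ∀ d : M.OutDart, outerView M.outNext (fun d => T (M.vtx d.1)) (T (M.vtx d.1)) ≤
      M.intAngle T (Sum.inl d.1) + M.intAngle T (Sum.inr (M.outNext.symm d))) :
    M.IsProperEmbedding T := by
  set W := outerView M.outNext (fun d => T (M.vtx d.1)) with hW
  have hW2 : ∀ w, W w ≤ 2 * Real.pi :=
    outerView_le_two_pi (nx := M.outNext) (T := fun d => T (M.vtx d.1)) hstar hsum
  have hle : ∀ (w : ℂ) (A : Finset M.Side), ∑ s ∈ A, visitWeight T w s ≤ W w := fun w A =>
    (Finset.sum_le_sum_of_subset_of_nonneg (Finset.subset_univ A)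
      fun s _ _ => h.visitWeight_nonneg w s).trans (h.sum_visitWeight_le w)
  -- the total angle at a vertex
  have hvert : ∀ x, ∃ A : Finset M.Side, (∀ s ∈ A, M.tgt s = x) ∧
      (W (T x) ≤ ∑ s ∈ A, visitWeight T (T x) s) := by
    intro x
    obtain ⟨d, rfl⟩ := M.vtx_surjective x
    by_cases hd : M.face d = M.out
    · refine ⟨{Sum.inl d, Sum.inr (M.outNext.symm ⟨d, hd⟩)}, ?_, ?_⟩
      · intro s hs
        rcases Finset.mem_insert.1 hs with rfl | hs
        · rfl
        · rw [Finset.mem_singleton.1 hs, tgt_inr, outNext_symm_coe, M.next_prev]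
      · rw [Finset.sum_pair (by simp)]
        refine (hangle ⟨d, hd⟩).trans (le_of_eq ?_)
        congr 1
        · exact (IsLocallyConvex.visitWeight_vertex (Sum.inl d)).symm
        · have h1 := IsLocallyConvex.visitWeight_vertex (T := T)
            (Sum.inr (M.outNext.symm ⟨d, hd⟩) : M.Side)
          rw [tgt_inr, outNext_symm_coe, M.next_prev] at h1
          exact h1.symm
    · refine ⟨(univ.filter fun d' => M.face d' = M.face d).image Sum.inl, ?_, ?_⟩
      · intro s hs
        obtain ⟨d', hd', rfl⟩ := Finset.mem_image.1 hs
        exact ((M.vtx_eq_iff_of_ne hd).2 (Finset.mem_filter.1 hd').2.symm).symm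
      · rw [Finset.sum_image fun a _ b _ hab => Sum.inl.inj hab]
        have h1 : ∑ d' with M.face d' = M.face d, visitWeight T (T (M.vtx d)) (Sum.inl d') =
            ∑ d' with M.face d' = M.face d, |M.intAngle T (Sum.inl d')| := by
          refine Finset.sum_congr rfl fun d' hd' => ?_
          rw [(M.vtx_eq_iff_of_ne hd).2 (Finset.mem_filter.1 hd').2.symm,
            abs_of_pos (h.intAngle_pos _)]
          exact IsLocallyConvex.visitWeight_vertex (Sum.inl d')
        rw [h1, Finset.sum_filter, Fintype.sum_prod_type_right, Fintype.sum_bool]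
        rw [← Finset.sum_filter, ← Finset.sum_filter, hin _ hd, hin _ hd]
        exact (hW2 _).trans (by linarith)
  -- The sides ending at `x` already use up `W (T x)`; a second vertex at the same point would add a
  -- positive interior angle.
  have hinj : Function.Injective T := by
    intro x y hxy
    by_contra hne
    obtain ⟨A, hA, hA'⟩ := hvert x
    obtain ⟨s, hs⟩ := exists_tgt_eq y
    have hsA : s ∉ A := fun hc => hne ((hA s hc).symm.trans hs)
    have h1 := hle (T x) (insert s A)
    rw [Finset.sum_insert hsA] at h1
    have h2 : 0 < visitWeight T (T x) s := h.visitWeight_pos one_pos le_rfl (by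
      rw [hs, hxy]; push_cast; ring)
    linarith
  -- sides of an edge
  let sides : M.DualEdge → Finset M.Side := fun ε => match ε with
    | Sum.inl e => {Sum.inl (e, false), Sum.inl (e, true)}
    | Sum.inr d => {Sum.inr d}
  -- At an interior point of an edge each of its sides weighs π. Two sides use up the bound 2π; the
  -- single side of a boundary edge uses up the bound π valid there.
  have hopen : ∀ (ε : M.DualEdge) (t : ℝ) w, 0 < t → t < 1 →
      w = T (M.ends ε).1 + t * (T (M.ends ε).2 - T (M.ends ε).1) →
      (∀ s ∈ sides ε, T (M.tgt s) ≠ w) ∧ W w ≤ ∑ s ∈ sides ε, visitWeight T w s := by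
    intro ε t w h0 h1 hw
    rcases ε with e | d
    · have h2 := h.visitWeight_open (s := Sum.inl (e, true)) h0 h1 hw
      have h3 := h.visitWeight_open (s := Sum.inl (e, false)) (t := 1 - t) (w := w) (by linarith)
        (by linarith) (by
          rw [hw]; simp only [ends, src_inl, tgt_inl, opp, Bool.not_false]; push_cast; ring)
      refine ⟨?_, ?_⟩
      · intro s hs
        rcases Finset.mem_insert.1 hs with rfl | hs
        · exact h3.1
        · rw [Finset.mem_singleton.1 hs]; exact h2.1
      · have h4 : ∑ s ∈ sides (Sum.inl e), visitWeight T w s =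
            visitWeight T w (Sum.inl (e, false)) + visitWeight T w (Sum.inl (e, true)) :=
          Finset.sum_pair (by simp)
        rw [h4, h2.2, h3.2]
        linarith [hW2 w]
    · have h2 := h.visitWeight_open (s := Sum.inr d) h0 h1 hw
      refine ⟨fun s hs => by rw [Finset.mem_singleton.1 hs]; exact h2.1, ?_⟩
      have h4 : ∑ s ∈ sides (Sum.inr d), visitWeight T w s = visitWeight T w (Sum.inr d) :=
        Finset.sum_singleton _ _
      rw [h4, h2.2]
      exact outerView_le_pi_of_mem_side (nx := M.outNext) (T := fun d => T (M.vtx d.1)) hstar hsum d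
        h0 h1 hw
  have hother : ∀ (ε : M.DualEdge) (t : ℝ) w, 0 < t → t < 1 →
      w = T (M.ends ε).1 + t * (T (M.ends ε).2 - T (M.ends ε).1) →
      ∀ s, s ∉ sides ε → ¬ ∃ t' : ℝ, 0 ≤ t' ∧ t' ≤ 1 ∧
        w = T (M.src s) + t' * (T (M.tgt s) - T (M.src s)) := by
    rintro ε t w h0 h1 hw s hs ⟨t', h2, h3, h4⟩
    obtain ⟨h5, h6⟩ := hopen ε t w h0 h1 hw
    have hzero : ∀ s, s ∉ sides ε → ¬ 0 < visitWeight T w s := by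
      intro s hs hpos
      have h7 := hle w (insert s (sides ε))
      rw [Finset.sum_insert hs] at h7
      linarith
    rcases h2.lt_or_eq with h7 | h7
    · exact hzero s hs (h.visitWeight_pos h7 h3 h4)
    · have h8 : T (M.tgt (M.sideNext.symm s)) = w := by
        rw [← M.src_sideNext, Equiv.apply_symm_apply, h4, ← h7]; push_cast; ring
      by_cases h9 : M.sideNext.symm s ∈ sides ε
      · exact h5 _ h9 h8
      · exact hzero _ h9 (h.visitWeight_pos one_pos le_rfl (by rw [← h8]; push_cast; ring))
  have hside : ∀ ε ε' : M.DualEdge, ε ≠ ε' → ∃ s, s ∉ sides ε ∧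
      (M.src s, M.tgt s) = M.ends ε' := by
    rintro (e | d) (e' | d') hne
    · refine ⟨Sum.inl (e', true), ?_, rfl⟩
      intro hs
      rcases Finset.mem_insert.1 hs with hs | hs
      · simp at hs
      · have := Sum.inl.inj (Finset.mem_singleton.1 hs)
        exact hne (congrArg Sum.inl (Prod.ext_iff.1 this).1.symm)
    · refine ⟨Sum.inr d', ?_, rfl⟩
      intro hs
      rcases Finset.mem_insert.1 hs with hs | hs
      · simp at hs
      · simp at hs
    · refine ⟨Sum.inl (e', true), ?_, rfl⟩
      intro hs
      exact absurd (Finset.mem_singleton.1 hs) (by simp)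
    · refine ⟨Sum.inr d', ?_, rfl⟩
      intro hs
      exact hne (by rw [Sum.inr.inj (Finset.mem_singleton.1 hs)])
  have hseg : ∀ a b w : ℂ, w ∈ segment ℝ a b →
      ∃ t : ℝ, 0 ≤ t ∧ t ≤ 1 ∧ w = a + t * (b - a) := by
    intro a b w hw
    rw [segment_eq_image'] at hw
    obtain ⟨t, ht, rfl⟩ := hw
    exact ⟨t, ht.1, ht.2, by simp only [Complex.real_smul]⟩
  have hmeet : ∀ ε ε' : M.DualEdge, ε ≠ ε' → ∀ w,
      w ∈ segment ℝ (T (M.ends ε).1) (T (M.ends ε).2) →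
      w ∈ segment ℝ (T (M.ends ε').1) (T (M.ends ε').2) →
      ∃ x ∈ ({(M.ends ε).1, (M.ends ε).2} : Set M.DualVertex), T x = w := by
    intro ε ε' hne w hw hw'
    obtain ⟨t, h0, h1, h2⟩ := hseg _ _ _ hw
    obtain ⟨t', h0', h1', h2'⟩ := hseg _ _ _ hw'
    rcases h0.lt_or_eq with h3 | h3
    · rcases h1.lt_or_eq with h4 | h4
      · exfalso
        obtain ⟨s, hs, hs'⟩ := hside ε ε' hne
        refine hother ε t w h3 h4 h2 s hs ⟨t', h0', h1', ?_⟩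
        rw [h2', ← hs']
      · exact ⟨_, Or.inr rfl, by rw [h2, h4]; push_cast; ring⟩
    · exact ⟨_, Or.inl rfl, by rw [h2, ← h3]; push_cast; ring⟩
  refine ⟨hinj, ?_, h.isConvexFace, ?_⟩
  · rintro ε ε' hne w ⟨hw, hw'⟩
    obtain ⟨x, hx, hxw⟩ := hmeet ε ε' hne w hw hw'
    obtain ⟨y, hy, hyw⟩ := hmeet ε' ε hne.symm w hw' hw
    have hxy : x = y := hinj (hxw.trans hyw.symm)
    exact ⟨x, ⟨hx, hxy ▸ hy⟩, hxw⟩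
  · intro v v' hvv
    rw [Set.disjoint_left]
    intro w hw hw'
    -- An interior point of two faces would be seen at total angle at least 4π.
    have key : ∀ v, w ∈ interior (convexHull ℝ (T '' M.faceVertices v)) →
        2 * Real.pi ≤ faceView T v w := by
      intro v hw
      refine two_pi_le_sum_view (p := M.sideNext) (fun s => by simp [M.sideFace_next])
        (fun s => by rw [M.src_sideNext]) ?_ fun s hs => ?_
      · obtain ⟨s, hs⟩ := M.sideFace_surjective v
        exact ⟨s, by simpa using hs⟩
      · refine im_pos_of_mem_interior (h.1 s) ?_ hw
        rintro _ ⟨x, hx, rfl⟩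
        obtain ⟨s', hs', rfl⟩ := M.mem_faceVertices_iff.1 hx
        exact h.left (hs'.trans (Finset.mem_filter.1 hs).2.symm)
    have h1 : ∑ u ∈ {v, v'}, faceView T u w ≤ ∑ u, faceView T u w :=
      Finset.sum_le_sum_of_subset_of_nonneg (Finset.subset_univ _)
        fun u _ _ => h.faceView_nonneg u w
    rw [Finset.sum_pair hvv, sum_faceView] at h1
    have := key v hw
    have := key v' hw'
    have := hW2 w
    have := Real.pi_pos
    linarith

theorem angle_black_corner {e : E} (he : M.face (e, false) ≠ M.out)
    (hne : ∀ s, M.sideVec T s ≠ 0) :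
    EuclideanGeometry.angle (T (M.vtx (e, true))) (T (M.vtx (e, false)))
      (T (M.vtx (M.σ e, false))) = |M.intAngle T (Sum.inl (e, false))| := by
  have h1 : T (M.vtx (e, true)) -ᵥ T (M.vtx (e, false)) = -M.sideVec T (Sum.inl (e, false)) := by
    simp [sideVec, opp]
  have h2 : T (M.vtx (M.σ e, false)) -ᵥ T (M.vtx (e, false)) =
      M.sideVec T (Sum.inl (M.σ e, false)) := by
    rw [← M.vtx_next_of_ne he]; rfl
  rw [EuclideanGeometry.angle, h1, h2, intAngle_inl_of_ne he, rot_false,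
    Complex.angle_eq_abs_arg (neg_ne_zero.2 (hne _)) (hne _)]

open Classical in
theorem angleCondition_of_intAngle
    (hin : ∀ f : M.Face, f ≠ M.out → ∑ e with M.face (e, false) = f,
      |M.intAngle T (Sum.inl (e, false))| = Real.pi)
    (hne : ∀ s, M.sideVec T s ≠ 0) : M.AngleCondition T := by
  intro f hf
  rw [← hin f hf]
  refine Finset.sum_congr rfl fun e he => angle_black_corner ?_ hne
  rw [(Finset.mem_filter.1 he).2]; exact hf

theorem IsTRealisation.hasGaugeEquivalentLengths {χ K : E → ℝ} {Fb : M.Black → ℂ}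
    {Fw : M.White → ℂ} (hT : M.IsTRealisation K Fb Fw T) (hK : M.IsKasteleyn χ K)
    (hb : ∀ b, Fb b ≠ 0) (hw : ∀ w, Fw w ≠ 0) : M.HasGaugeEquivalentLengths χ T := by
  refine ⟨fun b => ‖Fb b‖, fun w => ‖Fw w‖, fun b => norm_pos_iff.2 (hb b),
    fun w => norm_pos_iff.2 (hw w), fun e => ?_⟩
  rw [hT e, norm_mul, norm_mul, Complex.norm_real, Real.norm_eq_abs, hK.1]

end MarkedBipartiteMap

end

noncomputable section

namespace MarkedBipartiteMap

open Finset PlanarPolygon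

/-! ### Null vectors -/

theorem norm_sq_eq (z : ℂ) : ‖z‖ ^ 2 = z.re ^ 2 + z.im ^ 2 := by
  rw [Complex.sq_norm, Complex.normSq_apply]; ring

theorem im_eq_zero_of_sq {z : ℂ} {r : ℝ} (hr : 0 < r) (h : z ^ 2 = r) : z.im = 0 := by
  have h1 := congrArg Complex.re h
  have h2 := congrArg Complex.im h
  rw [sq] at h1 h2
  simp only [Complex.mul_re, Complex.mul_im, Complex.ofReal_re, Complex.ofReal_im] at h1 h2
  by_contra h0
  have h3 : z.re = 0 := by
    have : z.re * z.im = 0 := by linarith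
    exact (mul_eq_zero.1 this).resolve_right h0
  rw [h3] at h1
  nlinarith [mul_self_nonneg z.im]

/-- The increment `(ρ a², ρ |a|²)` is null for the form `|T|² - |O|²`, so two points of the
hyperboloid differ by it only if it is orthogonal to the first of them; this is the real part. The
imaginary part then follows from `|T|² = 1 + o²`. -/
theorem re_im_of_hyperboloid {T a : ℂ} {o ρ : ℝ} (hρ : ρ ≠ 0) (h1 : ‖T‖ ^ 2 - o ^ 2 = 1)
    (h2 : ‖T + ρ * a ^ 2‖ ^ 2 - (o + ρ * ‖a‖ ^ 2) ^ 2 = 1) :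
    (conj T * a ^ 2).re = o * ‖a‖ ^ 2 ∧ ((conj T * a ^ 2).im) ^ 2 = (‖a‖ ^ 2) ^ 2 := by
  have h3 : ‖T + ρ * a ^ 2‖ ^ 2 = ‖T‖ ^ 2 + 2 * ρ * (conj T * a ^ 2).re + ρ ^ 2 * (‖a‖ ^ 2) ^ 2 := by
    have h4 : (‖a‖ ^ 2) ^ 2 = ‖a ^ 2‖ ^ 2 := by rw [norm_pow]
    rw [h4]
    generalize a ^ 2 = b
    simp only [norm_sq_eq, Complex.add_re, Complex.add_im, Complex.mul_re, Complex.mul_im,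
      Complex.conj_re, Complex.conj_im, Complex.ofReal_re, Complex.ofReal_im]
    ring
  have h5 : (conj T * a ^ 2).re = o * ‖a‖ ^ 2 := by
    have : ρ * ((conj T * a ^ 2).re - o * ‖a‖ ^ 2) = 0 := by nlinarith
    have := (mul_eq_zero.1 this).resolve_left hρ
    linarith
  refine ⟨h5, ?_⟩
  have h6 := norm_sq_eq (conj T * a ^ 2)
  rw [h5, norm_mul, Complex.norm_conj, norm_pow, mul_pow] at h6
  have h7 : ‖T‖ ^ 2 = 1 + o ^ 2 := by linarith
  rw [h7] at h6
  nlinarith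

/-- The edge emanating from a boundary vertex is radial. -/
theorem im_eq_zero_of_hyperboloid {T a b : ℂ} {o ρ ρ' k : ℝ} (ha : a ≠ 0) (hb : b ≠ 0)
    (hk : k ≠ 0) (hρ : ρ ≠ 0)
    (hρ' : ρ' ≠ 0) (h1 : ‖T‖ ^ 2 - o ^ 2 = 1)
    (h2 : ‖T + ρ * a ^ 2‖ ^ 2 - (o + ρ * ‖a‖ ^ 2) ^ 2 = 1)
    (h3 : ‖T + ρ' * b ^ 2‖ ^ 2 - (o + ρ' * ‖b‖ ^ 2) ^ 2 = 1)
    (h4 : (ρ * a ^ 2 * conj (k * (a * b))).im ≠ 0) : (conj T * (k * (a * b))).im = 0 := by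
  obtain ⟨hu, hu'⟩ := re_im_of_hyperboloid hρ h1 h2
  obtain ⟨hv, hv'⟩ := re_im_of_hyperboloid hρ' h1 h3
  have hp : 0 < ‖a‖ ^ 2 := by positivity
  have hp' : 0 < ‖b‖ ^ 2 := by positivity
  have hT : 0 < ‖T‖ ^ 2 := by nlinarith [sq_nonneg o]
  set p := ‖a‖ ^ 2
  set p' := ‖b‖ ^ 2
  have huv : (conj T * a ^ 2).im * p' = -((conj T * b ^ 2).im * p) ∨
      (conj T * a ^ 2).im * p' = (conj T * b ^ 2).im * p := by
    have : ((conj T * a ^ 2).im * p') ^ 2 = ((conj T * b ^ 2).im * p) ^ 2 := by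
      rw [mul_pow, mul_pow, hu', hv']; ring
    rcases sq_eq_sq_iff_eq_or_eq_neg.1 this with h | h
    · exact Or.inr h
    · exact Or.inl h
  -- Up to positive factors, `conj T * a²` and `conj T * b²` have the same real part and equal or
  -- opposite imaginary parts. If opposite, they are conjugate and their product, essentially the
  -- square of the number in question, is positive. If equal, `a` and `b` are parallel, and the edge
  -- is parallel to the boundary side, contrary to `h4`.
  rcases huv with h | h
  · refine im_eq_zero_of_sq (r := k ^ 2 * ((1 + o ^ 2) * p * p'))
      (mul_pos (by positivity) (by positivity)) ?_
    have h5 : (conj T * (k * (a * b))) ^ 2 =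
        ((k ^ 2 : ℝ) : ℂ) * ((conj T * a ^ 2) * (conj T * b ^ 2)) := by push_cast; ring
    rw [h5, Complex.ofReal_mul]
    congr 1
    generalize conj T * a ^ 2 = u at *
    generalize conj T * b ^ 2 = v at *
    apply Complex.ext
    · rw [Complex.mul_re, Complex.ofReal_re, hu, hv]
      have h7 : u.im * v.im = -(p * p') := by
        have : p' * (u.im * v.im + p * p') = 0 := by
          have h8 : p' * (u.im * v.im) = -(v.im ^ 2 * p) := by linear_combination v.im * h
          rw [hv'] at h8; linear_combination h8
        have := (mul_eq_zero.1 this).resolve_left hp'.ne'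
        linarith
      rw [h7]; ring
    · rw [Complex.mul_im, Complex.ofReal_im, hu, hv]
      linear_combination o * h
  · exfalso
    refine h4 ?_
    have h5 : (a * conj b).im = 0 := by
      refine im_eq_zero_of_sq (r := p * p') (by positivity) ?_
      have h6 : ((‖T‖ ^ 2 : ℝ) : ℂ) * (a * conj b) ^ 2 =
          (conj T * a ^ 2) * conj (conj T * b ^ 2) := by
        rw [map_mul, map_pow, Complex.conj_conj]
        push_cast
        rw [← Complex.conj_mul']; ring
      have h7 : (conj T * a ^ 2) * conj (conj T * b ^ 2) = ((‖T‖ ^ 2 : ℝ) : ℂ) * (p * p' : ℝ) := by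
        have h9 : ‖T‖ ^ 2 = 1 + o ^ 2 := by linarith
        rw [h9]
        generalize conj T * a ^ 2 = u at *
        generalize conj T * b ^ 2 = v at *
        rw [← Complex.ofReal_mul]
        apply Complex.ext
        · rw [Complex.mul_re, Complex.ofReal_re, Complex.conj_re, Complex.conj_im, hu, hv]
          have h7 : u.im * v.im = p * p' := by
            have : p' * (u.im * v.im - p * p') = 0 := by
              have h8 : p' * (u.im * v.im) = v.im ^ 2 * p := by linear_combination v.im * h
              rw [hv'] at h8; linear_combination h8
            have := (mul_eq_zero.1 this).resolve_left hp'.ne'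
            linarith
          linear_combination h7
        · rw [Complex.mul_im, Complex.ofReal_im, Complex.conj_re, Complex.conj_im, hu, hv]
          linear_combination o * h
      rw [h7] at h6
      exact mul_left_cancel₀ (by exact_mod_cast hT.ne') h6
    have h6 : (ρ : ℂ) * a ^ 2 * conj (k * (a * b)) = ((ρ * k * p : ℝ) : ℂ) * (a * conj b) := by
      rw [map_mul, map_mul, Complex.conj_ofReal]
      simp only [p]
      push_cast
      rw [← Complex.conj_mul']; ring
    rw [h6, Complex.im_ofReal_mul, h5, mul_zero]

variable {E : Type*} [Fintype E] {M : MarkedBipartiteMap E}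

/-! ### Boundary sides -/

open Classical in
theorem sum_sideVec (T : M.DualVertex → ℂ) (v : M.DualFace) :
    ∑ s with M.sideFace s = v, M.sideVec T s = 0 := by
  simp only [sideVec]
  rw [Finset.sum_sub_distrib, sub_eq_zero]
  have := sum_comp_perm (p := M.sideNext) (C := univ.filter fun s => M.sideFace s = v)
    (fun s => by simp [M.sideFace_next]) fun s => T (M.src s)
  rw [← this]
  exact Finset.sum_congr rfl fun s _ => by rw [M.src_sideNext]

-- Since the outer face has at most one corner at each vertex of the graph, a face of the augmented
-- dual has at most one boundary side, and this side closes up the dual edges. Its increment is thus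
-- a gauge value times the value of `K Fw` or `Kᵀ Fb`.
open Classical in
theorem HasDimerCovers.outer_side_eq (hcover : M.HasDimerCovers) (T : M.DualVertex → ℂ)
    {d : E × Bool} (hd : M.face d = M.out) :
    T (M.vtx (M.next d)) - T (M.vtx d) =
      -∑ e with M.vert (e, d.2) = M.vert d, M.sideVec T (Sum.inl (e, d.2)) := by
  have h1 := sum_sideVec T (M.vert d)
  rw [Finset.sum_filter] at h1
  have h2 : ∑ s : M.Side, (if M.sideFace s = M.vert d then M.sideVec T s else 0) =
      ∑ d' : E × Bool, (if M.vert d' = M.vert d then M.sideVec T (Sum.inl d') else 0) +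
      ∑ d' : M.OutDart, (if M.vert d'.1 = M.vert d then M.sideVec T (Sum.inr d') else 0) :=
    Fintype.sum_sum_type _
  rw [h2] at h1
  have h3 : ∑ d' : M.OutDart, (if M.vert d'.1 = M.vert d then M.sideVec T (Sum.inr d') else 0) =
      T (M.vtx (M.next d)) - T (M.vtx d) := by
    rw [Finset.sum_eq_single_of_mem (⟨d, hd⟩ : M.OutDart) (mem_univ _), if_pos rfl]
    · rfl
    · intro d' _ hne
      refine if_neg fun hv => hne (Subtype.ext ?_)
      exact hcover.corner_unique hv (d'.2.trans hd.symm)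
  have h4 : ∑ d' : E × Bool, (if M.vert d' = M.vert d then M.sideVec T (Sum.inl d') else 0) =
      ∑ e with M.vert (e, d.2) = M.vert d, M.sideVec T (Sum.inl (e, d.2)) := by
    rw [Fintype.sum_prod_type_right, Finset.sum_filter, Finset.sum_eq_single_of_mem d.2 (mem_univ _)]
    intro s _ hs
    refine Finset.sum_eq_zero fun e _ => if_neg fun hv => hs (M.snd_eq_of_vert_eq hv)
  rw [h3, h4] at h1
  linear_combination h1

section Gauge

variable {χ K : E → ℝ} {Fb : M.Black → ℂ} {Fw : M.White → ℂ} {T O : M.DualVertex → ℂ}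

theorem IsOrigami.sideVec_true (hO : M.IsOrigami K Fb Fw O) (e : E) :
    M.sideVec O (Sum.inl (e, true)) = Fb (M.black e) * K e * conj (Fw (M.white e)) := hO e

theorem IsOrigami.sideVec_false (hO : M.IsOrigami K Fb Fw O) (e : E) :
    M.sideVec O (Sum.inl (e, false)) = -(Fb (M.black e) * K e * conj (Fw (M.white e))) := by
  rw [← hO.sideVec_true e, ← M.sideVec_inl_opp]; rfl

open Classical in
theorem IsTRealisation.outer_black (hcover : M.HasDimerCovers) (hT : M.IsTRealisation K Fb Fw T)
    {e : E} (he : M.face (e, false) = M.out) :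
    T (M.vtx (M.next (e, false))) - T (M.vtx (e, false)) =
      Fb (M.black e) * M.applyMatrix K Fw (M.black e) := by
  rw [hcover.outer_side_eq T he, applyMatrix, Finset.mul_sum, ← Finset.sum_neg_distrib]
  refine Finset.sum_congr (by
    ext x
    exact ⟨fun h => Finset.mem_filter.2 ⟨mem_univ _, Sum.inl.inj (Finset.mem_filter.1 h).2⟩,
      fun h => Finset.mem_filter.2 ⟨mem_univ _, congrArg Sum.inl (Finset.mem_filter.1 h).2⟩⟩) fun e' he' => ?_
  rw [hT.sideVec_false, (Finset.mem_filter.1 he').2]; ring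

open Classical in
theorem IsTRealisation.outer_white (hcover : M.HasDimerCovers) (hT : M.IsTRealisation K Fb Fw T)
    {e : E} (he : M.face (e, true) = M.out) :
    T (M.vtx (M.next (e, true))) - T (M.vtx (e, true)) =
      -(Fw (M.white e) * M.applyTranspose K Fb (M.white e)) := by
  rw [hcover.outer_side_eq T he, applyTranspose, Finset.mul_sum]
  congr 1
  refine Finset.sum_congr (by
    ext x
    exact ⟨fun h => Finset.mem_filter.2 ⟨mem_univ _, Sum.inr.inj (Finset.mem_filter.1 h).2⟩,
      fun h => Finset.mem_filter.2 ⟨mem_univ _, congrArg Sum.inr (Finset.mem_filter.1 h).2⟩⟩) fun e' he' => ?_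
  rw [hT.sideVec_true, (Finset.mem_filter.1 he').2]; ring

open Classical in
theorem IsOrigami.outer_black (hcover : M.HasDimerCovers) (hO : M.IsOrigami K Fb Fw O)
    {e : E} (he : M.face (e, false) = M.out) :
    O (M.vtx (M.next (e, false))) - O (M.vtx (e, false)) =
      Fb (M.black e) * conj (M.applyMatrix K Fw (M.black e)) := by
  rw [hcover.outer_side_eq O he, applyMatrix, map_sum, Finset.mul_sum, ← Finset.sum_neg_distrib]
  refine Finset.sum_congr (by
    ext x
    exact ⟨fun h => Finset.mem_filter.2 ⟨mem_univ _, Sum.inl.inj (Finset.mem_filter.1 h).2⟩,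
      fun h => Finset.mem_filter.2 ⟨mem_univ _, congrArg Sum.inl (Finset.mem_filter.1 h).2⟩⟩) fun e' he' => ?_
  rw [hO.sideVec_false, (Finset.mem_filter.1 he').2, map_mul, Complex.conj_ofReal]; ring

open Classical in
theorem IsOrigami.outer_white (hcover : M.HasDimerCovers) (hO : M.IsOrigami K Fb Fw O)
    {e : E} (he : M.face (e, true) = M.out) :
    O (M.vtx (M.next (e, true))) - O (M.vtx (e, true)) =
      -(conj (Fw (M.white e)) * M.applyTranspose K Fb (M.white e)) := by
  rw [hcover.outer_side_eq O he, applyTranspose, Finset.mul_sum]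
  congr 1
  refine Finset.sum_congr (by
    ext x
    exact ⟨fun h => Finset.mem_filter.2 ⟨mem_univ _, Sum.inr.inj (Finset.mem_filter.1 h).2⟩,
      fun h => Finset.mem_filter.2 ⟨mem_univ _, congrArg Sum.inr (Finset.mem_filter.1 h).2⟩⟩) fun e' he' => ?_
  rw [hO.sideVec_true, (Finset.mem_filter.1 he').2]; ring

/-- The gauge functions, as a function on all vertices of the graph. -/
def gauge (Fb : M.Black → ℂ) (Fw : M.White → ℂ) : M.DualFace → ℂ := Sum.elim Fb Fw

theorem IsNondegenerate.gauge_ne_zero (hnd : M.IsNondegenerate K Fb Fw) (v : M.DualFace) :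
    gauge Fb Fw v ≠ 0 := by
  rcases v with b | w
  · exact hnd.1 b
  · exact hnd.2.2.1 w

theorem IsNondegenerate.outer_ne_zero (hcover : M.HasDimerCovers) (hnd : M.IsNondegenerate K Fb Fw)
    (hT : M.IsTRealisation K Fb Fw T) {d : E × Bool} (hd : M.face d = M.out) :
    T (M.vtx (M.next d)) - T (M.vtx d) ≠ 0 := by
  rcases d with ⟨e, _ | _⟩
  · rw [hT.outer_black hcover hd]
    exact mul_ne_zero (hnd.1 _) (hnd.2.2.2 _ ⟨e, rfl, hd⟩)
  · rw [hT.outer_white hcover hd]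
    exact neg_ne_zero.2 (mul_ne_zero (hnd.2.2.1 _) (hnd.2.1 _ ⟨e, rfl, hd⟩))

theorem exists_radial_eq (hK0 : ∀ e, K e ≠ 0) (hT : M.IsTRealisation K Fb Fw T) (d : E × Bool) :
    ∃ k : ℝ, k ≠ 0 ∧ M.sideVec T (Sum.inl d) =
      k * (gauge Fb Fw (M.vert d) * gauge Fb Fw (M.vert (M.opp d))) := by
  rcases d with ⟨e, _ | _⟩
  · refine ⟨-K e, neg_ne_zero.2 (hK0 e), ?_⟩
    rw [hT.sideVec_false]
    simp only [gauge, opp, vert_false, vert_true, Sum.elim_inl, Sum.elim_inr, Bool.not_false]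
    push_cast; ring
  · refine ⟨K e, hK0 e, ?_⟩
    rw [hT.sideVec_true]
    simp only [gauge, opp, vert_false, vert_true, Sum.elim_inl, Sum.elim_inr, Bool.not_true]
    ring

/-- If the origami map has real increments along the outer boundary, then the increments of the
t-realisation are real multiples of the squares of the gauge functions. -/
theorem exists_outer_eq (hcover : M.HasDimerCovers) (hnd : M.IsNondegenerate K Fb Fw)
    (hT : M.IsTRealisation K Fb Fw T) (hO : M.IsOrigami K Fb Fw O) {d : E × Bool}
    (hd : M.face d = M.out) (him : (O (M.vtx (M.next d)) - O (M.vtx d)).im = 0) :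
    ∃ ρ : ℝ, ρ ≠ 0 ∧ T (M.vtx (M.next d)) - T (M.vtx d) = ρ * gauge Fb Fw (M.vert d) ^ 2 ∧
      O (M.vtx (M.next d)) - O (M.vtx d) = (ρ * ‖gauge Fb Fw (M.vert d)‖ ^ 2 : ℝ) := by
  have hF := hnd.gauge_ne_zero (M.vert d)
  have hF' : (‖gauge Fb Fw (M.vert d)‖ : ℂ) ≠ 0 := by simpa using hF
  have hy := hnd.outer_ne_zero hcover hT hd
  set q := O (M.vtx (M.next d)) - O (M.vtx d) with hq
  have hqr : q = (q.re : ℂ) := Complex.ext rfl (by simpa using him)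
  have key : T (M.vtx (M.next d)) - T (M.vtx d) =
      ((q.re / ‖gauge Fb Fw (M.vert d)‖ ^ 2 : ℝ) : ℂ) * gauge Fb Fw (M.vert d) ^ 2 := by
    push_cast
    rw [← hqr, div_mul_eq_mul_div, eq_div_iff (pow_ne_zero 2 hF'), ← Complex.conj_mul']
    rcases d with ⟨e, _ | _⟩
    · have h1 : conj q = q := by rw [hqr, Complex.conj_ofReal]
      have h2 := hO.outer_black hcover hd
      rw [← hq] at h2
      rw [← h1, h2, hT.outer_black hcover hd]
      simp only [gauge, vert_false, Sum.elim_inl, map_mul, Complex.conj_conj]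
      ring
    · have h2 := hO.outer_white hcover hd
      rw [← hq] at h2
      rw [h2, hT.outer_white hcover hd]
      simp only [gauge, vert_true, Sum.elim_inr]
      ring
  refine ⟨q.re / ‖gauge Fb Fw (M.vert d)‖ ^ 2, ?_, key, ?_⟩
  · intro h0
    rw [h0, Complex.ofReal_zero, zero_mul] at key
    exact hy key
  · have : q.re / ‖gauge Fb Fw (M.vert d)‖ ^ 2 * ‖gauge Fb Fw (M.vert d)‖ ^ 2 = q.re :=
      div_mul_cancel₀ _ (pow_ne_zero 2 (norm_ne_zero_iff.2 hF))
    rw [this]; exact hqr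

end Gauge

end MarkedBipartiteMap

end

noncomputable section

/-- The distance from the origin to a line through two points. -/
theorem infDist_line_mul {A B : ℂ} (hAB : A ≠ B) :
    Metric.infDist (0 : ℂ) (line[ℝ, A, B] : Set ℂ) * ‖B - A‖ = |(conj A * (B - A)).im| := by
  have hy0 : 0 < ‖B - A‖ := norm_pos_iff.2 (sub_ne_zero.2 hAB.symm)
  have hy : 0 < ‖B - A‖ ^ 2 := by positivity
  have key : ∀ s : ℝ, ‖A + s * (B - A)‖ ^ 2 * ‖B - A‖ ^ 2 =
      ((conj A * (B - A)).re + s * ‖B - A‖ ^ 2) ^ 2 + (conj A * (B - A)).im ^ 2 := by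
    intro s
    generalize B - A = y
    simp only [MarkedBipartiteMap.norm_sq_eq, Complex.add_re, Complex.add_im, Complex.mul_re,
      Complex.mul_im, Complex.conj_re, Complex.conj_im, Complex.ofReal_re, Complex.ofReal_im]
    ring
  have hline : ∀ p, p ∈ (line[ℝ, A, B] : Set ℂ) ↔ ∃ s : ℝ, A + s * (B - A) = p := by
    intro p
    rw [SetLike.mem_coe, mem_affineSpan_pair_iff_exists_lineMap_eq]
    refine exists_congr fun s => ?_
    rw [AffineMap.lineMap_apply, vsub_eq_sub, vadd_eq_add, Complex.real_smul, add_comm]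
  -- This parameter gives the foot of the perpendicular from the origin.
  have h1 := key (-(conj A * (B - A)).re / ‖B - A‖ ^ 2)
  rw [div_mul_cancel₀ _ hy.ne', add_neg_cancel, zero_pow two_ne_zero, zero_add] at h1
  set P := A + ((-(conj A * (B - A)).re / ‖B - A‖ ^ 2 : ℝ) : ℂ) * (B - A) with hP
  have h2 : Metric.infDist (0 : ℂ) (line[ℝ, A, B] : Set ℂ) = ‖P‖ := by
    refine le_antisymm ?_ ?_
    · rw [← dist_zero_left]
      exact Metric.infDist_le_dist_of_mem ((hline _).2 ⟨_, rfl⟩)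
    · rw [Metric.le_infDist ⟨A, (hline A).2 ⟨0, by simp⟩⟩]
      intro p hp
      obtain ⟨s, rfl⟩ := (hline p).1 hp
      rw [dist_zero_left]
      refine (sq_le_sq₀ (norm_nonneg _) (norm_nonneg _)).1 ?_
      refine le_of_mul_le_mul_right ?_ hy
      rw [h1, key s]
      nlinarith [sq_nonneg ((conj A * (B - A)).re + s * ‖B - A‖ ^ 2)]
  rw [h2, ← abs_of_nonneg (mul_nonneg (norm_nonneg P) hy0.le)]
  exact sq_eq_sq_iff_abs_eq_abs _ _ |>.1 (by rw [mul_pow, h1])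

theorem OnBisector.of_pos_mul {p v q x : ℂ} (h : OnBisector p v q x) {t : ℝ} (ht : 0 < t) {x' : ℂ}
    (hx : x' - v = t * (x - v)) : OnBisector p v q x' := by
  have h1 : (x' - v) / (q - v) = t * ((x - v) / (q - v)) := by rw [hx]; ring
  have h2 : (p - v) / (x' - v) = ((t⁻¹ : ℝ) : ℂ) * ((p - v) / (x - v)) := by
    rw [hx, Complex.ofReal_inv, ← div_div, div_right_comm, div_eq_inv_mul _ (t : ℂ)]
  unfold OnBisector
  rw [h1, h2, Complex.arg_real_mul _ ht, Complex.arg_real_mul _ (inv_pos.2 ht)]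
  exact h

namespace MarkedBipartiteMap

open Finset PlanarPolygon

variable {E : Type*} [Fintype E] {M : MarkedBipartiteMap E}

theorem im_div_of_conj_mul (a b : ℂ) : (b / a).im = (conj a * b).im / Complex.normSq a := by
  rw [div_eq_mul_inv, Complex.inv_def, ← mul_assoc, mul_comm b, Complex.im_mul_ofReal,
    div_eq_mul_inv]

section Gauge

variable {χ K : E → ℝ} {Fb : M.Black → ℂ} {Fw : M.White → ℂ} {T O : M.DualVertex → ℂ}

/-- Edges emanating from boundary vertices point towards the origin. -/
def IsRadial (M : MarkedBipartiteMap E) (T : M.DualVertex → ℂ) : Prop :=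
  ∀ d : E × Bool, M.face d = M.out → ∃ t : ℝ, 0 < t ∧ M.sideVec T (Sum.inl d) = t * T (M.vtx d)

/-- The boundary is star-shaped with respect to the origin. -/
def IsStar (M : MarkedBipartiteMap E) (T : M.DualVertex → ℂ) : Prop :=
  ∀ d : E × Bool, M.face d = M.out → 0 < (conj (T (M.vtx d)) * T (M.vtx (M.next d))).im

theorem BoundaryIndexOne.sum_arg (h : M.BoundaryIndexOne T) :
    ∑ d : M.OutDart, Complex.arg (T (M.vtx (M.next d.1)) / T (M.vtx d.1)) = 2 * Real.pi := by
  classical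
  have h1 := h.2
  rw [div_eq_one_iff_eq (by positivity)] at h1
  rw [← h1]
  symm
  convert (Finset.sum_subtype (p := fun d => M.face d = M.out)
    (univ.filter fun d : E × Bool => M.face d = M.out) (by simp)
    fun d => Complex.arg (T (M.vtx (M.next d)) / T (M.vtx d)))

theorem norm_boundary (hH : M.BoundaryOnHyperboloid T O) {d : E × Bool} (hd : M.face d = M.out) :
    ‖T (M.vtx d)‖ ^ 2 - (O (M.vtx d)).re ^ 2 = 1 ∧ O (M.vtx d) = ((O (M.vtx d)).re : ℂ) := by
  obtain ⟨h1, h2⟩ := hH d hd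
  have h3 : O (M.vtx d) = ((O (M.vtx d)).re : ℂ) := Complex.ext rfl (by simpa using h2)
  refine ⟨?_, h3⟩
  rw [h3, Complex.norm_real, Real.norm_eq_abs, sq_abs] at h1
  exact h1

theorem boundary_ne_zero (hH : M.BoundaryOnHyperboloid T O) {d : E × Bool}
    (hd : M.face d = M.out) : T (M.vtx d) ≠ 0 := by
  intro h0
  have := (norm_boundary hH hd).1
  rw [h0, norm_zero] at this
  nlinarith [sq_nonneg (O (M.vtx d)).re]

/-- The description of sides of the boundary in terms of the gauge functions. -/
theorem exists_outer_eq_of_hyperboloid (hcover : M.HasDimerCovers)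
    (hnd : M.IsNondegenerate K Fb Fw) (hT : M.IsTRealisation K Fb Fw T)
    (hO : M.IsOrigami K Fb Fw O) (hH : M.BoundaryOnHyperboloid T O) {d : E × Bool}
    (hd : M.face d = M.out) :
    ∃ ρ : ℝ, ρ ≠ 0 ∧ T (M.vtx (M.next d)) - T (M.vtx d) = ρ * gauge Fb Fw (M.vert d) ^ 2 ∧
      (O (M.vtx (M.next d))).re - (O (M.vtx d)).re = ρ * ‖gauge Fb Fw (M.vert d)‖ ^ 2 := by
  have hd' : M.face (M.next d) = M.out := by rw [M.face_next, hd]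
  obtain ⟨ρ, h1, h2, h3⟩ := exists_outer_eq hcover hnd hT hO hd (by
    rw [Complex.sub_im, (hH d hd).2, (hH _ hd').2, sub_zero])
  refine ⟨ρ, h1, h2, ?_⟩
  have := congrArg Complex.re h3
  rwa [Complex.sub_re, Complex.ofReal_re] at this

/-- The null-vector identity determines the imaginary part up to sign. After division by the length
of the side, this says that its line is at distance 1 from the origin. -/
theorem sq_im_boundary (hcover : M.HasDimerCovers)
    (hnd : M.IsNondegenerate K Fb Fw) (hT : M.IsTRealisation K Fb Fw T)
    (hO : M.IsOrigami K Fb Fw O) (hH : M.BoundaryOnHyperboloid T O) {d : E × Bool}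
    (hd : M.face d = M.out) :
    ((conj (T (M.vtx d)) * (T (M.vtx (M.next d)) - T (M.vtx d))).im) ^ 2 =
      ‖T (M.vtx (M.next d)) - T (M.vtx d)‖ ^ 2 := by
  have hd' : M.face (M.next d) = M.out := by rw [M.face_next, hd]
  obtain ⟨ρ, h1, h2, h3⟩ := exists_outer_eq_of_hyperboloid hcover hnd hT hO hH hd
  have h4 := (re_im_of_hyperboloid h1 (norm_boundary hH hd).1 (a := gauge Fb Fw (M.vert d)) (by
    rw [← h2, ← h3, add_sub_cancel, add_sub_cancel]; exact (norm_boundary hH hd').1)).2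
  rw [h2, mul_left_comm, Complex.im_ofReal_mul, mul_pow, h4, norm_mul, norm_pow, mul_pow,
    Complex.norm_real, Real.norm_eq_abs, sq_abs]

/-- The two boundary sides at the vertex are real multiples of the squares of the gauge values at
the two ends of the edge, and the edge itself is a real multiple of their product;
`im_eq_zero_of_hyperboloid` applies. The preceding side is traversed backwards, whence the
coefficient `-ρ'`. -/
theorem im_conj_mul_sideVec (hcover : M.HasDimerCovers) (hK0 : ∀ e, K e ≠ 0)
    (hnd : M.IsNondegenerate K Fb Fw) (hT : M.IsTRealisation K Fb Fw T)
    (hO : M.IsOrigami K Fb Fw O) (hH : M.BoundaryOnHyperboloid T O) (hor : M.BoundaryOriented T)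
    {d : E × Bool} (hd : M.face d = M.out) :
    (conj (T (M.vtx d)) * M.sideVec T (Sum.inl d)).im = 0 := by
  have hdn : M.face (M.next d) = M.out := by rw [M.face_next, hd]
  have hdp : M.face (M.prev d) = M.out := by rw [M.face_prev, hd]
  obtain ⟨ρ, h1, h2, h3⟩ := exists_outer_eq_of_hyperboloid hcover hnd hT hO hH hd
  obtain ⟨ρ', h1', h2', h3'⟩ := exists_outer_eq_of_hyperboloid hcover hnd hT hO hH hdp
  rw [M.next_prev, M.vert_prev] at h2' h3'
  obtain ⟨k, hk, hx⟩ := exists_radial_eq hK0 hT d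
  rw [hx]
  refine im_eq_zero_of_hyperboloid (ρ := ρ) (ρ' := -ρ') (hnd.gauge_ne_zero _)
    (hnd.gauge_ne_zero _) hk h1 (neg_ne_zero.2 h1') (norm_boundary hH hd).1 ?_ ?_ ?_
  · rw [← h2, ← h3, add_sub_cancel, add_sub_cancel]; exact (norm_boundary hH hdn).1
  · rw [Complex.ofReal_neg, neg_mul, neg_mul, ← h2', ← h3', ← sub_eq_add_neg, ← sub_eq_add_neg,
      sub_sub_cancel, sub_sub_cancel]
    exact (norm_boundary hH hdp).1
  · rw [← h2, ← hx]; exact (hor d hd).1.ne'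

/-- Write the edge at `vtx d` as `t d * T`. The two orientation inequalities say that the oriented
area `I d` of the triangle over a boundary side has the signs of both `t d` and `t (next d)`, so all
these signs agree. Positive index excludes that all of them are negative. -/
theorem isRadial_and_isStar (hcover : M.HasDimerCovers) (hK0 : ∀ e, K e ≠ 0)
    (hnd : M.IsNondegenerate K Fb Fw) (hT : M.IsTRealisation K Fb Fw T)
    (hO : M.IsOrigami K Fb Fw O) (hH : M.BoundaryOnHyperboloid T O) (hor : M.BoundaryOriented T)
    (hidx : M.BoundaryIndexOne T) : M.IsRadial T ∧ M.IsStar T := by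
  classical
  have hex : ∀ d : E × Bool, ∃ t : ℝ, M.face d = M.out →
      M.sideVec T (Sum.inl d) = t * T (M.vtx d) := by
    intro d
    by_cases hd : M.face d = M.out
    · refine ⟨(conj (T (M.vtx d)) * M.sideVec T (Sum.inl d)).re / ‖T (M.vtx d)‖ ^ 2, fun _ => ?_⟩
      have h0 := boundary_ne_zero hH hd
      have h1 : (((conj (T (M.vtx d)) * M.sideVec T (Sum.inl d)).re : ℝ) : ℂ) =
          conj (T (M.vtx d)) * M.sideVec T (Sum.inl d) :=
        Complex.ext rfl (by
          rw [im_conj_mul_sideVec hcover hK0 hnd hT hO hH hor hd, Complex.ofReal_im])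
      have h2 : (‖T (M.vtx d)‖ : ℂ) ≠ 0 := by simpa using h0
      push_cast
      rw [h1, div_mul_eq_mul_div, eq_div_iff (pow_ne_zero 2 h2), ← Complex.conj_mul']
      ring
    · exact ⟨0, fun h => absurd h hd⟩
  choose t ht using hex
  set I : E × Bool → ℝ := fun d => (conj (T (M.vtx d)) * T (M.vtx (M.next d))).im with hI
  have h1 : ∀ d, M.face d = M.out → 0 < t d * I d := by
    intro d hd
    have h2 := (hor d hd).1
    have h3 : T (M.vtx d) - T (M.vtx (M.opp d)) = t d * T (M.vtx d) := ht d hd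
    rw [h3] at h2
    have h4 : (T (M.vtx (M.next d)) - T (M.vtx d)) * conj (t d * T (M.vtx d)) =
        t d * (conj (T (M.vtx d)) * T (M.vtx (M.next d)) -
          Complex.normSq (T (M.vtx d))) := by
      rw [map_mul, Complex.conj_ofReal, Complex.normSq_eq_conj_mul_self]; ring
    rwa [h4, Complex.im_ofReal_mul, Complex.sub_im, Complex.ofReal_im, sub_zero] at h2
  have h2 : ∀ d, M.face d = M.out → 0 < t (M.next d) * I d := by
    intro d hd
    have hdn : M.face (M.next d) = M.out := by rw [M.face_next, hd]
    have h2 := (hor _ hdn).2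
    have h3 : T (M.vtx (M.next d)) - T (M.vtx (M.opp (M.next d))) =
        t (M.next d) * T (M.vtx (M.next d)) := ht _ hdn
    rw [h3, M.prev_next] at h2
    have h4 : (T (M.vtx d) - T (M.vtx (M.next d))) * conj (t (M.next d) * T (M.vtx (M.next d))) =
        t (M.next d) * (conj (conj (T (M.vtx d)) * T (M.vtx (M.next d))) -
          Complex.normSq (T (M.vtx (M.next d)))) := by
      rw [map_mul, map_mul, Complex.conj_conj, Complex.conj_ofReal,
        Complex.normSq_eq_conj_mul_self]; ring
    rw [h4, Complex.im_ofReal_mul, Complex.sub_im, Complex.ofReal_im, sub_zero,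
      Complex.conj_im] at h2
    linarith
  have hsum := hidx.sum_arg
  obtain ⟨d₀, hd₀⟩ : ∃ d : M.OutDart,
      0 < Complex.arg (T (M.vtx (M.next d.1)) / T (M.vtx d.1)) := by
    by_contra hcon
    push Not at hcon
    have := Finset.sum_nonpos fun d (_ : d ∈ univ) => hcon d
    have := Real.pi_pos
    linarith
  have hpos : ∀ d, M.face d = M.out → (0 < t d ↔ 0 < I d) := by
    intro d hd
    rcases mul_pos_iff.1 (h1 d hd) with h | h
    · exact iff_of_true h.1 h.2
    · exact iff_of_false (not_lt.2 h.1.le) (not_lt.2 h.2.le)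
  have hpos' : ∀ d, M.face d = M.out → (0 < t (M.next d) ↔ 0 < I d) := by
    intro d hd
    rcases mul_pos_iff.1 (h2 d hd) with h | h
    · exact iff_of_true h.1 h.2
    · exact iff_of_false (not_lt.2 h.1.le) (not_lt.2 h.2.le)
  have hI₀ : 0 < I d₀.1 := by
    have h3 := Complex.arg_nonneg_iff.1 hd₀.le
    rw [im_div_of_conj_mul] at h3
    have h4 : 0 < Complex.normSq (T (M.vtx d₀.1)) :=
      Complex.normSq_pos.2 (boundary_ne_zero hH d₀.2)
    have h5 : 0 ≤ I d₀.1 := by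
      by_contra hcon
      exact absurd h3 (not_le.2 (div_neg_of_neg_of_pos (not_le.1 hcon) h4))
    refine lt_of_le_of_ne h5 fun h0 => ?_
    have := h1 d₀.1 d₀.2
    rw [← h0, mul_zero] at this
    exact lt_irrefl _ this
  have hall : ∀ d, M.face d = M.out → 0 < t d := by
    intro d hd
    have h3 := M.eq_of_next_invariant (c := fun d => 0 < t d) (d := d₀.1) (d' := d)
      (fun x hx => propext ((hpos' x (hx.trans d₀.2)).trans (hpos x (hx.trans d₀.2)).symm))
      (d₀.2.trans hd.symm)
    rw [← h3]
    exact (hpos _ d₀.2).2 hI₀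
  exact ⟨fun d hd => ⟨t d, hall d hd, ht d hd⟩, fun d hd => (hpos d hd).1 (hall d hd)⟩

theorem IsStar.ne_zero (hs : M.IsStar T) {d : E × Bool} (hd : M.face d = M.out) :
    T (M.vtx d) ≠ 0 := by
  intro h
  have := hs d hd
  simp [h] at this

theorem IsRadial.intAngle_inl (hr : M.IsRadial T) {d : E × Bool} (hd : M.face d = M.out) :
    M.intAngle T (Sum.inl d) =
      Complex.arg (-T (M.vtx d) / (T (M.vtx (M.next d)) - T (M.vtx d))) := by
  obtain ⟨t, ht, h⟩ := hr d hd
  rw [intAngle, M.sideNext_inl_of_out hd, h]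
  have : -(t * T (M.vtx d)) / M.sideVec T (Sum.inr ⟨d, hd⟩) =
      t * (-T (M.vtx d) / (T (M.vtx (M.next d)) - T (M.vtx d))) := by
    rw [sideVec, tgt_inr, src_inr]; ring
  rw [this, Complex.arg_real_mul _ ht]

theorem IsRadial.intAngle_inr (hr : M.IsRadial T) (d : M.OutDart) :
    M.intAngle T (Sum.inr d) =
      Complex.arg ((T (M.vtx d.1) - T (M.vtx (M.next d.1))) / -T (M.vtx (M.next d.1))) := by
  obtain ⟨t, ht, h⟩ := hr (M.next d.1) (by rw [M.face_next, d.2])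
  have h1 : M.sideVec T (Sum.inl (M.rot d.1)) = -(t * T (M.vtx (M.next d.1))) := by
    rw [← h, ← M.sideVec_inl_opp, rot_apply]
  rw [intAngle, sideNext_inr, h1]
  have : -M.sideVec T (Sum.inr d) / -(t * T (M.vtx (M.next d.1))) = ((t⁻¹ : ℝ) : ℂ) *
      ((T (M.vtx d.1) - T (M.vtx (M.next d.1))) / -T (M.vtx (M.next d.1))) := by
    rw [sideVec, tgt_inr, src_inr, neg_sub, ← mul_neg, div_mul_eq_div_div, Complex.ofReal_inv,
      div_right_comm, div_eq_inv_mul _ (t : ℂ)]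
  rw [this, Complex.arg_real_mul _ (inv_pos.2 ht)]

/-- The vertex `v` is a real multiple of `a * b`, while the two adjacent sides are real multiples of
`a²` and `b²`. Hence the two ratios defining the half-angles differ by a real factor, which is
positive because both have positive imaginary part. -/
theorem onBisector_zero (hcover : M.HasDimerCovers) (hK0 : ∀ e, K e ≠ 0)
    (hnd : M.IsNondegenerate K Fb Fw) (hT : M.IsTRealisation K Fb Fw T)
    (hO : M.IsOrigami K Fb Fw O) (hH : M.BoundaryOnHyperboloid T O) (hr : M.IsRadial T)
    (hs : M.IsStar T) {d : E × Bool} (hd : M.face d = M.out) :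
    OnBisector (T (M.vtx (M.prev d))) (T (M.vtx d)) (T (M.vtx (M.next d))) 0 := by
  have hdp : M.face (M.prev d) = M.out := by rw [M.face_prev, hd]
  obtain ⟨ρ, h1, h2, -⟩ := exists_outer_eq_of_hyperboloid hcover hnd hT hO hH hd
  obtain ⟨ρ', h1', h2', -⟩ := exists_outer_eq_of_hyperboloid hcover hnd hT hO hH hdp
  rw [M.next_prev, M.vert_prev] at h2'
  obtain ⟨k, hk, hx⟩ := exists_radial_eq hK0 hT d
  obtain ⟨t, ht, htx⟩ := hr d hd
  have hstar := hs d hd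
  have hstar' := hs _ hdp
  rw [M.next_prev] at hstar'
  have hT0 := hs.ne_zero hd
  have ha := hnd.gauge_ne_zero (M.vert d)
  have hb := hnd.gauge_ne_zero (M.vert (M.opp d))
  set a := gauge Fb Fw (M.vert d)
  set b := gauge Fb Fw (M.vert (M.opp d))
  set v := T (M.vtx d)
  have hy : T (M.vtx (M.next d)) - v ≠ 0 := by
    rw [h2]; exact mul_ne_zero (by exact_mod_cast h1) (pow_ne_zero 2 ha)
  have him : 0 < ((0 - v) / (T (M.vtx (M.next d)) - v)).im := by
    rw [im_div_of_conj_mul]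
    refine div_pos ?_ (Complex.normSq_pos.2 hy)
    have : conj (T (M.vtx (M.next d)) - v) * (0 - v) =
        -conj (conj v * T (M.vtx (M.next d))) + Complex.normSq v := by
      rw [Complex.normSq_eq_conj_mul_self, map_mul, map_sub, Complex.conj_conj]; ring
    rw [this, Complex.add_im, Complex.neg_im, Complex.conj_im, Complex.ofReal_im, neg_neg, add_zero]
    exact hstar
  have him' : 0 < ((T (M.vtx (M.prev d)) - v) / (0 - v)).im := by
    rw [im_div_of_conj_mul]
    refine div_pos ?_ (Complex.normSq_pos.2 (by simpa using hT0))
    have : conj (0 - v) * (T (M.vtx (M.prev d)) - v) =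
        -conj (conj (T (M.vtx (M.prev d))) * v) + Complex.normSq v := by
      rw [Complex.normSq_eq_conj_mul_self, map_mul, map_sub, Complex.conj_conj, map_zero]; ring
    rw [this, Complex.add_im, Complex.neg_im, Complex.conj_im, Complex.ofReal_im, neg_neg, add_zero]
    exact hstar'
  have hratio : (T (M.vtx (M.prev d)) - v) / (0 - v) = ((-(ρ * ρ' * t ^ 2 / k ^ 2) : ℝ) : ℂ) *
      ((0 - v) / (T (M.vtx (M.next d)) - v)) := by
    have h3 : T (M.vtx (M.prev d)) - v = -(ρ' * b ^ 2) := by rw [← h2']; ring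
    have hk' : (k : ℂ) ≠ 0 := by exact_mod_cast hk
    have hρ : (ρ : ℂ) ≠ 0 := by exact_mod_cast h1
    have h4 : (t : ℂ) * v = k * (a * b) := by rw [← htx, hx]
    have ht' : (t : ℂ) ≠ 0 := by exact_mod_cast ht.ne'
    have hv : v = k * (a * b) / t := by rw [eq_div_iff ht', mul_comm, h4]
    rw [h3, h2, hv]
    push_cast
    field_simp
    ring
  have hpos : 0 < -(ρ * ρ' * t ^ 2 / k ^ 2) := by
    rw [hratio, Complex.im_ofReal_mul] at him'
    exact (pos_iff_pos_of_mul_pos him').2 him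
  obtain ⟨h5, h6⟩ := arg_mem_of_im_pos him
  refine ⟨h5, h6, ?_⟩
  rw [hratio, Complex.arg_real_mul _ hpos]

/-- T-realisations satisfying the boundary conditions are perfect t-embeddings. -/
theorem isPerfectTEmbedding_of_boundary (hcover : M.HasDimerCovers) (hspread : M.IsSpread)
    (hχ : ∀ e, 0 < χ e) (hK : M.IsKasteleyn χ K)
    (hnd : M.IsNondegenerate K Fb Fw) (hT : M.IsTRealisation K Fb Fw T)
    (hO : M.IsOrigami K Fb Fw O) (hH : M.BoundaryOnHyperboloid T O) (hor : M.BoundaryOriented T)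
    (hidx : M.BoundaryIndexOne T) : M.IsPerfectTEmbedding χ T := by
  classical
  have hK0 := hK.ne_zero hχ
  obtain ⟨hr, hs⟩ := isRadial_and_isStar hcover hK0 hnd hT hO hH hor hidx
  have hb := hnd.1
  have hw := hnd.2.2.1
  have hne : ∀ s, M.sideVec T s ≠ 0 := by
    rintro (d | d)
    · exact hT.sideVec_inl_ne_zero hK0 hb hw d
    · exact hnd.outer_ne_zero hcover hT d.2
  have hin : ∀ f : M.Face, f ≠ M.out → ∀ s, Real.pi ≤ ∑ e with M.face (e, s) = f,
      |M.intAngle T (Sum.inl (e, s))| := by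
    intro f hf s
    obtain ⟨r, h1, h2, h3⟩ := hT.exists_arg_eq_intAngle hK hχ hb hw hf s
    rw [Finset.sum_congr rfl fun e he => by rw [h2 e he]]
    exact pi_le_sum_abs_arg _ r h1 h3
  have hsum := hidx.sum_arg
  -- The angles at the ends of a boundary side are those of the triangle with apex at the origin,
  -- and the apex angles add up to 2π by the index condition.
  have hout : Fintype.card M.OutDart * Real.pi - 2 * Real.pi ≤
      ∑ d : M.OutDart, (|M.intAngle T (Sum.inl d.1)| + |M.intAngle T (Sum.inr d)|) := by
    have h1 : ∀ d : M.OutDart, Real.pi -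
        Complex.arg (T (M.vtx (M.next d.1)) / T (M.vtx d.1)) ≤
        |M.intAngle T (Sum.inl d.1)| + |M.intAngle T (Sum.inr d)| := by
      intro d
      rw [← sum_angles_triangle (hs d.1 d.2), hr.intAngle_inl d.2, hr.intAngle_inr d]
      exact add_le_add (le_abs_self _) (le_abs_self _)
    refine le_trans (le_of_eq ?_) (Finset.sum_le_sum fun d _ => h1 d)
    rw [Finset.sum_sub_distrib, hsum, Finset.sum_const, nsmul_eq_mul, Finset.card_univ]
  obtain ⟨hin', hext⟩ := angle_sums_eq hne hin hout
  have hconv : M.IsLocallyConvex T := by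
    refine isLocallyConvex_of_angle_sums hspread hT hK hχ hb hw hne hin' hext fun d => ?_
    -- The orientation inequality is a strict left turn at this corner; it fixes the orientation of
    -- the boundary faces.
    refine ⟨Sum.inl d.1, rfl, ?_⟩
    refine arg_mem_of_im_pos ?_
    rw [M.sideNext_inl_of_out d.2, im_div_of_conj_mul]
    refine div_pos ?_ (Complex.normSq_pos.2 (hne _))
    rw [mul_comm]
    exact (hor d.1 d.2).1
  refine ⟨⟨?_, ?_⟩, hT.hasGaugeEquivalentLengths hK hb hw, ?_, ?_⟩
  · refine hconv.isProperEmbedding hin' (fun d => hs d.1 d.2) hsum fun d => ?_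
    have h1 := outerView_vertex (nx := M.outNext) (T := fun d : M.OutDart => T (M.vtx d.1))
      (fun d => hs d.1 d.2) hsum (M.outNext.symm d)
    simp only [Equiv.apply_symm_apply, outNext_coe] at h1
    rw [h1, hr.intAngle_inl d.2, hr.intAngle_inr, outNext_symm_coe, M.next_prev, add_comm]
  · exact angleCondition_of_intAngle (fun f hf => hin' f hf false) hne
  · intro d hd
    refine ⟨?_, onBisector_zero hcover hK0 hnd hT hO hH hr hs hd⟩
    have hy := hnd.outer_ne_zero hcover hT hd
    have h1 := infDist_line_mul (sub_ne_zero.1 hy).symm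
    rw [(sq_eq_sq_iff_abs_eq_abs _ _).1 (sq_im_boundary hcover hnd hT hO hH hd), abs_norm] at h1
    exact (mul_eq_right₀ (norm_ne_zero_iff.2 hy)).1 h1
  · intro d hd
    obtain ⟨t, ht, h⟩ := hr d hd
    refine (onBisector_zero hcover hK0 hnd hT hO hH hr hs hd).of_pos_mul ht ?_
    rw [zero_sub, mul_neg, ← h, sideVec]
    simp

end Gauge

end MarkedBipartiteMap

end

noncomputable section

namespace MarkedBipartiteMap

open Finset PlanarPolygon

variable {E : Type*} [Fintype E] {M : MarkedBipartiteMap E} {T : M.DualVertex → ℂ}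

/-! ### Convex polygons have total turning `2π` -/

/-- A vertex of a convex polygon at which a linear function has a local minimum is the strict
minimum of this function. -/
theorem nonneg_of_cone {a b u w : ℂ} (hau : 0 < (conj a * u).im) (hub : 0 < (conj u * b).im)
    (hab : 0 < (conj a * b).im) (ha : 0 ≤ (conj a * w).im) (hb : 0 ≤ (conj b * w).im) :
    0 ≤ (conj u * w).im ∧ ((conj u * w).im = 0 → w = 0) := by
  have key : (conj a * b).im * (conj u * w).im =
      (conj b * w).im * (conj a * u).im + (conj a * w).im * (conj u * b).im := by
    simp only [Complex.mul_im, Complex.conj_re, Complex.conj_im]; ring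
  have h1 : 0 ≤ (conj a * b).im * (conj u * w).im := by rw [key]; positivity
  refine ⟨nonneg_of_mul_nonneg_right h1 hab, fun h0 => ?_⟩
  rw [h0, mul_zero] at key
  have h2 : 0 ≤ (conj b * w).im * (conj a * u).im := by positivity
  have h3 : 0 ≤ (conj a * w).im * (conj u * b).im := by positivity
  have h4 : (conj b * w).im = 0 := by
    have : (conj b * w).im * (conj a * u).im = 0 := by linarith
    exact (mul_eq_zero.1 this).resolve_right hau.ne'
  have h5 : (conj a * w).im = 0 := by
    have : (conj a * w).im * (conj u * b).im = 0 := by linarith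
    exact (mul_eq_zero.1 this).resolve_right hub.ne'
  have h6 : ((conj a * b).im : ℂ) * w = (conj a * w).im * b - (conj b * w).im * a := by
    apply Complex.ext <;>
      simp only [Complex.mul_im, Complex.conj_re, Complex.conj_im, Complex.mul_re, Complex.sub_re,
        Complex.sub_im, Complex.ofReal_re, Complex.ofReal_im] <;> ring
  rw [h4, h5, Complex.ofReal_zero, zero_mul, zero_mul, sub_zero] at h6
  exact (mul_eq_zero.1 h6).resolve_left (by exact_mod_cast hab.ne')

/-- Uniqueness of corners covers sides of the same kind. A dual edge and a boundary side of one face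
cannot end at the same vertex because `next` changes the colour. -/
theorem HasDimerCovers.tgt_injective (hcover : M.HasDimerCovers) {s s' : M.Side}
    (hf : M.sideFace s = M.sideFace s') (ht : M.tgt s = M.tgt s') : s = s' := by
  have hmix : ∀ (d : E × Bool) (d' : M.OutDart), M.vert d = M.vert d'.1 →
      M.vtx d ≠ M.vtx (M.next d'.1) := by
    intro d d' hv ht
    have hd' : M.face (M.next d'.1) = M.out := by rw [M.face_next, d'.2]
    have h1 := (M.vtx_eq_iff_of_out hd').1 ht.symm
    have h2 := M.snd_eq_of_vert_eq hv
    rw [← h1] at h2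
    rcases d' with ⟨⟨e, _ | _⟩, _⟩ <;> simp [next] at h2
  rcases s with d | d <;> rcases s' with d' | d'
  · refine congrArg Sum.inl (hcover.corner_unique hf ?_)
    have ht : M.vtx d = M.vtx d' := ht
    by_cases hd : M.face d = M.out
    · rw [(M.vtx_eq_iff_of_out hd).1 ht]
    · exact (M.vtx_eq_iff_of_ne hd).1 ht
  · exact absurd ht (hmix d d' hf)
  · exact absurd ht.symm (hmix d' d hf.symm)
  · have hd : M.face (M.next d.1) = M.out := by rw [M.face_next, d.2]
    have h1 := (M.vtx_eq_iff_of_out hd).1 ht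
    exact congrArg Sum.inr (Subtype.ext (M.nextPerm.injective h1))

/-- Convex faces with distinct vertices are simple polygons. -/
theorem isLocallyConvex_of_isConvexFace (hcover : M.HasDimerCovers)
    (hinj : Function.Injective T) (hne : ∀ s, M.sideVec T s ≠ 0)
    (hconv : ∀ v, M.IsConvexFace T v) : M.IsLocallyConvex T := by
  classical
  have hleft : ∀ s s', M.sideFace s' = M.sideFace s →
      0 ≤ (conj (M.sideVec T s) * (T (M.tgt s') - T (M.tgt s))).im := by
    intro s s' hs
    have h1 := (hconv (M.sideFace s)).1 _ (M.mem_faceSides_side s) (M.tgt s')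
      (M.mem_faceVertices_iff.2 ⟨M.sideNext s', by rw [M.sideFace_next, hs],
        (M.src_sideNext s').symm⟩)
    have h2 : conj (M.sideVec T s) * (T (M.tgt s') - T (M.tgt s)) =
        conj (T (M.tgt s) - T (M.src s)) * (T (M.tgt s') - T (M.src s)) -
          Complex.normSq (M.sideVec T s) := by
      rw [Complex.normSq_eq_conj_mul_self, sideVec]; ring
    rw [h2, Complex.sub_im, Complex.ofReal_im, sub_zero]
    exact h1
  have hnext : ∀ s, 0 ≤ (conj (M.sideVec T s) * M.sideVec T (M.sideNext s)).im := by
    intro s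
    have := hleft s (M.sideNext s) (M.sideFace_next s)
    rwa [← M.src_sideNext s] at this
  have hext0 : ∀ s, 0 ≤ M.extAngle T s := by
    intro s
    rw [extAngle, Complex.arg_nonneg_iff, im_div_of_conj_mul]
    exact div_nonneg (hnext s) (Complex.normSq_nonneg _)
  have hleft' : ∀ s s', M.sideFace s' = M.sideFace s →
      0 ≤ (conj (M.sideVec T (M.sideNext s)) * (T (M.tgt s') - T (M.tgt s))).im := by
    intro s s' hs
    have h1 := hleft (M.sideNext s) s' (by rw [M.sideFace_next, hs])
    have h2 : conj (M.sideVec T (M.sideNext s)) * (T (M.tgt s') - T (M.tgt s)) =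
        conj (M.sideVec T (M.sideNext s)) * (T (M.tgt s') - T (M.tgt (M.sideNext s))) +
          Complex.normSq (M.sideVec T (M.sideNext s)) := by
      rw [Complex.normSq_eq_conj_mul_self]
      conv_rhs => arg 2; arg 2; rw [sideVec, M.src_sideNext]
      ring
    rw [h2, Complex.add_im, Complex.ofReal_im, add_zero]
    exact h1
  -- A U-turn would place all vertices of the face on both sides of one line, that is on the line
  -- itself, contrary to non-degeneracy.
  have hextpi : ∀ s, M.extAngle T s < Real.pi := by
    intro s
    refine lt_of_le_of_ne (Complex.arg_le_pi _) fun hpi => ?_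
    obtain ⟨hre, him⟩ := Complex.arg_eq_pi_iff.1 hpi
    have hr : M.sideVec T (M.sideNext s) =
        ((M.sideVec T (M.sideNext s) / M.sideVec T s).re : ℂ) * M.sideVec T s := by
      rw [← div_eq_iff (hne s)]
      exact Complex.ext rfl (by rw [Complex.ofReal_im, him])
    generalize (M.sideVec T (M.sideNext s) / M.sideVec T s).re = r at hr hre
    have hzero : ∀ s', M.sideFace s' = M.sideFace s →
        (conj (M.sideVec T s) * (T (M.tgt s') - T (M.tgt s))).im = 0 := by
      intro s' hs'
      have h1 := hleft' s s' hs'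
      rw [hr, map_mul, Complex.conj_ofReal, mul_assoc, Complex.im_ofReal_mul] at h1
      refine le_antisymm ?_ (hleft s s' hs')
      exact nonpos_of_mul_nonneg_right h1 hre
    have hpar : ∀ s', M.sideFace s' = M.sideFace s →
        (conj (M.sideVec T s) * M.sideVec T s').im = 0 := by
      intro s' hs'
      have h1 := hzero s' hs'
      have h2 := hzero (M.sideNext.symm s') (by
        rw [← M.sideFace_next, Equiv.apply_symm_apply, hs'])
      rw [← M.src_sideNext, Equiv.apply_symm_apply] at h2
      have h3 : conj (M.sideVec T s) * M.sideVec T s' =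
          conj (M.sideVec T s) * (T (M.tgt s') - T (M.tgt s)) -
          conj (M.sideVec T s) * (T (M.src s') - T (M.tgt s)) := by
        conv_lhs => arg 2; rw [sideVec]
        ring
      rw [h3, Complex.sub_im, h1, h2, sub_zero]
    obtain ⟨q, hq, x, hx, hpos⟩ := (hconv (M.sideFace s)).2
    rcases M.exists_side_of_mem_faceSides hq with h | ⟨s₁, hs₁, rfl⟩
    · rw [h] at hpos; simp at hpos
    obtain ⟨s₂, hs₂, rfl⟩ := M.mem_faceVertices_iff.1 hx
    have h1 := hpar s₁ hs₁
    have h2 := hzero (M.sideNext.symm s₂) (by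
      rw [← M.sideFace_next, Equiv.apply_symm_apply, hs₂])
    have h3 := hzero (M.sideNext.symm s₁) (by
      rw [← M.sideFace_next, Equiv.apply_symm_apply, hs₁])
    rw [← M.src_sideNext, Equiv.apply_symm_apply] at h2 h3
    have hreal : ∀ y : ℂ, (conj (M.sideVec T s) * y).im = 0 →
        ∃ r : ℝ, y = r * M.sideVec T s := by
      intro y hy
      refine ⟨(y / M.sideVec T s).re, ?_⟩
      rw [← div_eq_iff (hne s)]
      exact Complex.ext rfl (by rw [im_div_of_conj_mul, hy, zero_div, Complex.ofReal_im])
    obtain ⟨r₁, hr₁⟩ := hreal _ h1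
    obtain ⟨r₂, hr₂⟩ := hreal _ h2
    obtain ⟨r₃, hr₃⟩ := hreal _ h3
    rw [sideVec] at hr₁
    have h4 : T (M.src s₂) - T (M.src s₁) = (r₂ - r₃) * M.sideVec T s := by
      linear_combination hr₂ - hr₃
    have h5 : conj (T (M.tgt s₁) - T (M.src s₁)) * (T (M.src s₂) - T (M.src s₁)) =
        ((r₁ * (r₂ - r₃) * Complex.normSq (M.sideVec T s) : ℝ) : ℂ) := by
      rw [h4, hr₁, map_mul, Complex.conj_ofReal]
      push_cast
      rw [Complex.normSq_eq_conj_mul_self]; ring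
    simp only at hpos
    rw [h5, Complex.ofReal_im] at hpos
    exact lt_irrefl _ hpos
  refine ⟨hne, hext0, hextpi, fun v => ?_⟩
  obtain ⟨s, rfl⟩ := M.sideFace_surjective v
  have hge := M.two_pi_le_sum_extAngle hne (M.sideFace s)
  rw [Finset.sum_congr rfl fun s' _ => abs_of_nonneg (hext0 s')] at hge
  obtain ⟨n, z, hz, hn, hz0, hzs, hzn, hturn, hex, hinj', hps, hfs⟩ := M.exists_polygon hne s
  have hface : ∀ i, M.sideFace (M.sideNext^[i] s) = M.sideFace s := by
    intro i
    induction i with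
    | zero => rfl
    | succ i ih => rw [Function.iterate_succ_apply', M.sideFace_next, ih]
  have hdir : ∑ s' with M.sideFace s' = M.sideFace s, M.extAngle T s' = dir z n := by
    rw [hfs, dir]
    exact Finset.sum_congr rfl fun i _ => (hturn i).symm
  rw [hdir] at hge ⊢
  obtain ⟨k, hk⟩ := exists_dir_eq hz0 hzn
  have hpi := Real.pi_pos
  -- The total turning is `2πk` with `k ≥ 1`. If `k ≥ 2`, two different corners share a supporting
  -- direction; each is the strict minimum of the same linear function, so the two vertices
  -- coincide, against injectivity.
  by_contra hcon
  have hk2 : 2 ≤ k := by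
    by_contra hlt
    rcases (by omega : k ≤ 0 ∨ k = 1) with h | h
    · have : (k : ℝ) ≤ 0 := by exact_mod_cast h
      nlinarith
    · exact hcon (by rw [hk, h]; simp)
  have hk2' : (2 : ℝ) ≤ k := by exact_mod_cast hk2
  obtain ⟨i, hi, j, hj, hij, u, h1, h2, h3, h4⟩ := exists_common_direction hz0
    (fun i _ => by rw [hturn]; exact hext0 _) (fun i _ => by rw [hturn]; exact hextpi _)
    (n := n) (by rw [hk]; nlinarith)
  have hcross : ∀ l, 0 < (conj (z l) * u).im → 0 < (conj u * z (l + 1)).im →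
      0 < (conj (z l) * z (l + 1)).im := by
    intro l h1 h2
    have h0 := hnext (M.sideNext^[l] s)
    rw [← Function.iterate_succ_apply' M.sideNext, ← hz, ← hz] at h0
    refine lt_of_le_of_ne h0 fun h0 => ?_
    have h5 := hextpi (M.sideNext^[l] s)
    rw [extAngle, ← Function.iterate_succ_apply' M.sideNext, ← hz, ← hz] at h5
    have h6 : (z (l + 1) / z l).im = 0 := by rw [im_div_of_conj_mul, ← h0, zero_div]
    have h7 : 0 ≤ (z (l + 1) / z l).re := by
      by_contra hneg
      exact h5.ne (Complex.arg_eq_pi_iff.2 ⟨not_le.1 hneg, h6⟩)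
    have h8 : z (l + 1) = ((z (l + 1) / z l).re : ℂ) * z l := by
      rw [← div_eq_iff (hz0 l)]
      exact Complex.ext rfl (by rw [Complex.ofReal_im, h6])
    rw [h8, mul_left_comm, Complex.im_ofReal_mul] at h2
    have h9 : (conj u * z l).im = -(conj (z l) * u).im := by
      simp only [Complex.mul_im, Complex.conj_re, Complex.conj_im]; ring
    rw [h9] at h2
    nlinarith
  have hcone : ∀ l m, 0 < (conj (z l) * u).im → 0 < (conj u * z (l + 1)).im →
      0 ≤ (conj u * (T (M.tgt (M.sideNext^[m] s)) - T (M.tgt (M.sideNext^[l] s)))).im ∧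
      ((conj u * (T (M.tgt (M.sideNext^[m] s)) - T (M.tgt (M.sideNext^[l] s)))).im = 0 →
        T (M.tgt (M.sideNext^[m] s)) - T (M.tgt (M.sideNext^[l] s)) = 0) := by
    intro l m h1 h2
    refine nonneg_of_cone h1 h2 (hcross l h1 h2) ?_ ?_
    · rw [hz]
      exact hleft _ _ ((hface m).trans (hface l).symm)
    · rw [hz, Function.iterate_succ_apply']
      exact hleft' _ _ ((hface m).trans (hface l).symm)
  obtain ⟨c1, c2⟩ := hcone i j h1 h2
  obtain ⟨c3, -⟩ := hcone j i h3 h4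
  have h5 : (conj u * (T (M.tgt (M.sideNext^[i] s)) - T (M.tgt (M.sideNext^[j] s)))).im =
      -(conj u * (T (M.tgt (M.sideNext^[j] s)) - T (M.tgt (M.sideNext^[i] s)))).im := by
    rw [← Complex.neg_im]; congr 1; ring
  rw [h5] at c3
  have h6 := c2 (le_antisymm (by linarith) c1)
  have h7 := hcover.tgt_injective ((hface j).trans (hface i).symm) (hinj (sub_eq_zero.1 h6))
  exact hij (hinj' j hj i hi h7).symm

end MarkedBipartiteMap

end

/-! ### Angle bisectors and tangent lengths. -/

noncomputable section

theorem OnBisector.im_pos {p v q x : ℂ} (h : OnBisector p v q x) :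
    0 < ((x - v) / (q - v)).im ∧ 0 < ((p - v) / (x - v)).im := by
  obtain ⟨h1, h2, h3⟩ := h
  exact ⟨PlanarPolygon.im_pos_of_arg_mem h1 h2,
    PlanarPolygon.im_pos_of_arg_mem (h3 ▸ h1) (h3 ▸ h2)⟩

theorem OnBisector.ne_zero {p v q x : ℂ} (h : OnBisector p v q x) :
    p - v ≠ 0 ∧ q - v ≠ 0 ∧ x - v ≠ 0 := by
  obtain ⟨h1, h2⟩ := h.im_pos
  refine ⟨?_, ?_, ?_⟩ <;> intro h0 <;> simp [h0] at h1 h2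

/-- The bisector of an angle is unique. -/
theorem OnBisector.arg_eq {p v q x x' : ℂ} (h : OnBisector p v q x) (h' : OnBisector p v q x') :
    Complex.arg ((x - v) / (q - v)) = Complex.arg ((x' - v) / (q - v)) := by
  -- Twice the half-angle is determined modulo 2π, and half-angles lie between 0 and π.
  have key : ∀ {x}, OnBisector p v q x → ((2 * Complex.arg ((x - v) / (q - v)) : ℝ) : Real.Angle) =
      (Complex.arg ((p - v) / (q - v)) : Real.Angle) := by
    intro x h
    obtain ⟨hp, hq, hx⟩ := h.ne_zero
    have h1 : (p - v) / (q - v) = ((p - v) / (x - v)) * ((x - v) / (q - v)) := by field_simp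
    rw [h1, Complex.arg_mul_coe_angle (div_ne_zero hp hx) (div_ne_zero hx hq), h.2.2, two_mul,
      Real.Angle.coe_add]
  obtain ⟨k, hk⟩ := Real.Angle.angle_eq_iff_two_pi_dvd_sub.1 ((key h).trans (key h').symm)
  obtain ⟨h1, h2, -⟩ := h
  obtain ⟨h1', h2', -⟩ := h'
  have hpi := Real.pi_pos
  have hk0 : k = 0 := by
    have h3 : (k : ℝ) < 1 := by
      by_contra hc
      nlinarith [not_lt.1 hc]
    have h4 : (-1 : ℝ) < k := by
      by_contra hc
      nlinarith [not_lt.1 hc]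
    have h5 : k < 1 := by exact_mod_cast h3
    have h6 : -1 < k := by exact_mod_cast h4
    omega
  rw [hk0] at hk
  push_cast at hk
  linarith

/-- Equal angles have equal cosines. Applied at a boundary vertex, this compares its projections to
the two adjacent sides. -/
theorem re_conj_mul_of_arg_eq {v y y' : ℂ} (hv : v ≠ 0) (hy : y ≠ 0) (hy' : y' ≠ 0)
    (h : Complex.arg (y / v) = Complex.arg (-v / y')) :
    (conj v * y).re * ‖y'‖ = -(‖y‖ * (conj v * y').re) := by
  have hre : ∀ a b : ℂ, (b / a).re = (conj a * b).re / ‖a‖ ^ 2 := by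
    intro a b
    rw [div_eq_mul_inv, Complex.inv_def, ← mul_assoc, mul_comm b, Complex.re_mul_ofReal,
      div_eq_mul_inv, Complex.normSq_eq_norm_sq]
  have h1 := congrArg Real.cos h
  rw [Complex.cos_arg (div_ne_zero hy hv), Complex.cos_arg (div_ne_zero (neg_ne_zero.2 hv) hy'),
    hre, hre, norm_div, norm_div, norm_neg] at h1
  have h2 : (conj y' * -v).re = -(conj v * y').re := by
    simp only [Complex.mul_re, Complex.conj_re, Complex.conj_im, Complex.neg_re, Complex.neg_im]
    ring
  rw [h2] at h1
  have n1 := norm_ne_zero_iff.2 hv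
  have n2 := norm_ne_zero_iff.2 hy
  have n3 := norm_ne_zero_iff.2 hy'
  field_simp at h1
  linarith

namespace MarkedBipartiteMap

open Finset PlanarPolygon

variable {E : Type*} [Fintype E] {M : MarkedBipartiteMap E} {T : M.DualVertex → ℂ}

/-! ### The boundary of a perfect t-embedding -/

theorem IsTangential.isStar (h : M.IsTangential T) : M.IsStar T := by
  intro d hd
  have h1 := (h d hd).2
  have h2 := h1.im_pos.1
  rw [im_div_of_conj_mul] at h2
  have h3 := (div_pos_iff_of_pos_right (Complex.normSq_pos.2 h1.ne_zero.2.1)).1 h2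
  have h4 : (conj (T (M.vtx (M.next d)) - T (M.vtx d)) * (0 - T (M.vtx d))).im =
      (conj (T (M.vtx d)) * T (M.vtx (M.next d))).im := by
    simp only [Complex.mul_im, Complex.conj_re, Complex.conj_im, Complex.sub_re, Complex.sub_im,
      Complex.zero_re, Complex.zero_im, map_sub]
    ring
  rwa [h4] at h3

/-- The tangent length at a boundary vertex, with sign. -/
def tangentLength (T : M.DualVertex → ℂ) (d : E × Bool) : ℝ :=
  (conj (T (M.vtx d)) * (T (M.vtx (M.next d)) - T (M.vtx d))).re /
    ‖T (M.vtx (M.next d)) - T (M.vtx d)‖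

/-- Pythagoras, for the right triangle with hypotenuse `|T|` and legs the radius 1 and the tangent
length. -/
theorem IsTangential.norm_sq (h : M.IsTangential T) {d : E × Bool} (hd : M.face d = M.out) :
    ‖T (M.vtx d)‖ ^ 2 - tangentLength T d ^ 2 = 1 := by
  have hy := (h d hd).2.ne_zero.2.1
  have h1 := infDist_line_mul (sub_ne_zero.1 hy).symm
  rw [(h d hd).1, one_mul] at h1
  have h2 := norm_sq_eq (conj (T (M.vtx d)) * (T (M.vtx (M.next d)) - T (M.vtx d)))
  rw [← sq_abs (Complex.im _), ← h1, norm_mul, Complex.norm_conj, mul_pow] at h2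
  have hn := norm_ne_zero_iff.2 hy
  rw [tangentLength, div_pow]
  field_simp
  linarith

/-- Going from one end of a side to the other adds its length to the projection; at the new vertex
the bisector condition makes the projections to the two adjacent sides opposite. -/
theorem IsTangential.tangentLength_next (h : M.IsTangential T) {d : E × Bool}
    (hd : M.face d = M.out) : tangentLength T (M.next d) =
      -(tangentLength T d + ‖T (M.vtx (M.next d)) - T (M.vtx d)‖) := by
  have hdn : M.face (M.next d) = M.out := by rw [M.face_next, hd]
  have hy := (h d hd).2.ne_zero.2.1
  have h1 := (h _ hdn).2
  obtain ⟨-, hy', hv⟩ := h1.ne_zero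
  rw [zero_sub, neg_ne_zero] at hv
  have h2 := h1.2.2
  rw [M.prev_next, zero_sub, ← neg_sub (T (M.vtx (M.next d))), neg_div_neg_eq] at h2
  have h3 := re_conj_mul_of_arg_eq hv hy hy' h2
  have h4 : (conj (T (M.vtx (M.next d))) * (T (M.vtx (M.next d)) - T (M.vtx d))).re =
      (conj (T (M.vtx d)) * (T (M.vtx (M.next d)) - T (M.vtx d))).re +
        ‖T (M.vtx (M.next d)) - T (M.vtx d)‖ ^ 2 := by
    rw [norm_sq_eq]
    simp only [Complex.mul_re, Complex.conj_re, Complex.conj_im, Complex.sub_re, Complex.sub_im]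
    ring
  rw [h4] at h3
  have n1 := norm_ne_zero_iff.2 hy
  have n2 := norm_ne_zero_iff.2 hy'
  unfold tangentLength
  generalize (conj (T (M.vtx (M.next d))) *
    (T (M.vtx (M.next (M.next d))) - T (M.vtx (M.next d)))).re = c at *
  generalize (conj (T (M.vtx d)) * (T (M.vtx (M.next d)) - T (M.vtx d))).re = a at *
  generalize ‖T (M.vtx (M.next d)) - T (M.vtx d)‖ = y at *
  generalize ‖T (M.vtx (M.next (M.next d))) - T (M.vtx (M.next d))‖ = y' at *
  field_simp
  linarith

theorem boundaryOriented_of_bisector (h : M.BisectorCondition T) : M.BoundaryOriented T := by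
  intro d hd
  obtain ⟨h1, h2⟩ := (h d hd).im_pos
  obtain ⟨hp, hq, hx⟩ := (h d hd).ne_zero
  rw [im_div_of_conj_mul] at h1 h2
  have h1 := (div_pos_iff_of_pos_right (Complex.normSq_pos.2 hq)).1 h1
  have h2 := (div_pos_iff_of_pos_right (Complex.normSq_pos.2 hx)).1 h2
  simp only [Complex.mul_im, Complex.conj_re, Complex.conj_im, Complex.sub_re,
    Complex.sub_im] at h1 h2 ⊢
  constructor <;> linarith

open Classical in
theorem sum_black_sides (g : M.Side → ℝ) :
    ∑ s, (if (M.sideFace s).isLeft then g s else 0) = ∑ e, g (Sum.inl (e, false)) +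
      ∑ d : M.OutDart, if d.1.2 = false then g (Sum.inr d) else 0 := by
  have h1 : ∑ s : M.Side, (if (M.sideFace s).isLeft then g s else 0) =
      ∑ d : E × Bool, (if (M.vert d).isLeft then g (Sum.inl d) else 0) +
      ∑ d : M.OutDart, (if (M.vert d.1).isLeft then g (Sum.inr d) else 0) := Fintype.sum_sum_type _
  rw [h1, Fintype.sum_prod_type_right, Fintype.sum_bool]
  congr 1
  · simp
  · refine Finset.sum_congr rfl ?_
    rintro ⟨⟨e, _ | _⟩, hd⟩ _ <;> simp

open Classical in
/-- The count of angles of black faces. -/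
theorem two_mul_sum_half_angles (hcover : M.HasDimerCovers) (h : M.IsLocallyConvex T)
    (hang : M.AngleCondition T) {α : M.OutDart → ℝ} (h1 : ∀ d, M.intAngle T (Sum.inl d.1) = α d)
    (h2 : ∀ d, M.intAngle T (Sum.inr d) = α (M.outNext d)) :
    2 * ∑ d, α d = Fintype.card M.OutDart * Real.pi - 2 * Real.pi := by
  -- Only black faces are counted. With `N` boundary vertices they have `#E + N/2` sides, total
  -- turning 2π each, angle π at each inner vertex and one angle `α` at each boundary vertex.
  -- Euler's formula with `#B = #W` then gives the sum of all `α`.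
  have hadd : ∀ s, M.extAngle T s + M.intAngle T s = Real.pi := fun s => by
    rw [← M.abs_extAngle_add h.1 s, abs_of_nonneg (h.2.1 s), abs_of_pos (h.intAngle_pos s)]
  have hext : ∑ e, M.extAngle T (Sum.inl (e, false)) +
      ∑ d : M.OutDart, (if d.1.2 = false then M.extAngle T (Sum.inr d) else 0) =
      Fintype.card M.Black * (2 * Real.pi) := by
    rw [← sum_black_sides, ← Finset.sum_fiberwise univ M.sideFace]
    have h3 : ∀ v : M.DualFace, ∑ s with M.sideFace s = v,
        (if (M.sideFace s).isLeft then M.extAngle T s else 0) =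
        if v.isLeft then 2 * Real.pi else 0 := by
      intro v
      rw [Finset.sum_congr rfl fun s hs => by rw [(Finset.mem_filter.1 hs).2]]
      split_ifs
      · exact h.2.2.2 v
      · simp
    rw [Finset.sum_congr rfl fun v _ => h3 v, Fintype.sum_sum_type]
    simp
  have hinner : ∑ e, M.intAngle T (Sum.inl (e, false)) =
      (Fintype.card M.Face - 1) * Real.pi +
        ∑ d : M.OutDart, (if d.1.2 = false then α d else 0) := by
    rw [← Finset.sum_fiberwise univ fun e => M.face (e, false),
      ← Finset.sum_erase_add univ _ (mem_univ M.out)]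
    congr 1
    · have h3 : ∀ f ∈ univ.erase M.out, ∑ e with M.face (e, false) = f,
          M.intAngle T (Sum.inl (e, false)) = Real.pi := by
        intro f hf
        have hf := Finset.ne_of_mem_erase hf
        rw [← hang f hf]
        refine Finset.sum_congr rfl fun e he => ?_
        rw [angle_black_corner (by rw [(Finset.mem_filter.1 he).2]; exact hf) h.1,
          abs_of_pos (h.intAngle_pos _)]
      rw [Finset.sum_congr rfl h3, Finset.sum_const, nsmul_eq_mul,
        Finset.card_erase_of_mem (mem_univ _), Finset.card_univ,
        Nat.cast_sub (Fintype.card_pos_iff.2 ⟨M.out⟩)]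
      simp
    · simp only [← h1]
      have h3 : ∑ d : M.OutDart, (if d.1.2 = false then M.intAngle T (Sum.inl d.1) else 0) =
          ∑ d with M.face d = M.out, if d.2 = false then M.intAngle T (Sum.inl d) else 0 :=
        (Finset.sum_subtype _ (by simp)
          fun d => if d.2 = false then M.intAngle T (Sum.inl d) else 0).symm
      rw [h3, Finset.sum_filter, Finset.sum_filter, Fintype.sum_prod_type_right,
        Fintype.sum_bool]
      simp
  have hflip : ∀ d : M.OutDart, ((M.outNext d).1.2 = true) = (d.1.2 = false) := by
    rintro ⟨⟨e, _ | _⟩, hd⟩ <;> simp [next]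
  have hbd : ∑ d : M.OutDart, (if d.1.2 = false then M.intAngle T (Sum.inr d) else 0) =
      ∑ d : M.OutDart, (if d.1.2 = true then α d else 0) := by
    rw [← Equiv.sum_comp M.outNext fun d => if d.1.2 = true then α d else 0]
    exact Finset.sum_congr rfl fun d _ => by simp only [h2, hflip]
  have hN : ∑ d : M.OutDart, (if d.1.2 = false then Real.pi else 0) =
      ∑ d : M.OutDart, (if d.1.2 = true then Real.pi else 0) := by
    rw [← Equiv.sum_comp M.outNext fun d => if d.1.2 = true then Real.pi else 0]
    exact Finset.sum_congr rfl fun d _ => by simp only [hflip]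
  have hsplit : ∀ g : M.OutDart → ℝ, ∑ d : M.OutDart, (if d.1.2 = false then g d else 0) +
      ∑ d : M.OutDart, (if d.1.2 = true then g d else 0) = ∑ d, g d := by
    intro g
    rw [← Finset.sum_add_distrib]
    refine Finset.sum_congr rfl fun d _ => ?_
    cases d.1.2 <;> simp
  have hN' := hsplit fun _ => Real.pi
  rw [Finset.sum_const, nsmul_eq_mul, Finset.card_univ] at hN'
  have htot : ∑ e, M.extAngle T (Sum.inl (e, false)) + ∑ e, M.intAngle T (Sum.inl (e, false)) =
      Fintype.card E * Real.pi := by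
    rw [← Finset.sum_add_distrib, Finset.sum_congr rfl fun e _ => hadd _, Finset.sum_const,
      nsmul_eq_mul, Finset.card_univ]
  have htot' : ∑ d : M.OutDart, (if d.1.2 = false then M.extAngle T (Sum.inr d) else 0) +
      ∑ d : M.OutDart, (if d.1.2 = false then M.intAngle T (Sum.inr d) else 0) =
      ∑ d : M.OutDart, (if d.1.2 = false then Real.pi else 0) := by
    rw [← Finset.sum_add_distrib]
    refine Finset.sum_congr rfl fun d _ => ?_
    split_ifs
    · exact hadd _
    · simp
  have hα := hsplit α
  have heuler : (Fintype.card M.Black : ℝ) + Fintype.card M.White + Fintype.card M.Face =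
      Fintype.card E + 2 := by exact_mod_cast M.card_add_card_add_card
  have hBW : (Fintype.card M.Black : ℝ) = Fintype.card M.White := by
    exact_mod_cast hcover.card_black_eq
  have hmul : (2 * (Fintype.card M.Black : ℝ) + Fintype.card M.Face) * Real.pi =
      (Fintype.card E + 2) * Real.pi := by rw [← heuler, ← hBW]; ring
  linarith

/-- In the triangle spanned by the origin and a boundary side, the apex angle is π minus the two
half-angles. The count of black angles gives the sum of these apex angles. -/
theorem boundaryIndexOne_of_perfect (hcover : M.HasDimerCovers) (hne : ∀ s, M.sideVec T s ≠ 0)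
    (hemb : M.IsTEmbedding T) (htan : M.IsTangential T) (hbis : M.BisectorCondition T) :
    M.BoundaryIndexOne T := by
  classical
  have hstar := htan.isStar
  have hconv := isLocallyConvex_of_isConvexFace hcover hemb.1.1 hne hemb.1.2.2.1
  set α : M.OutDart → ℝ := fun d =>
    Complex.arg ((0 - T (M.vtx d.1)) / (T (M.vtx (M.next d.1)) - T (M.vtx d.1))) with hα
  have hdn : ∀ d : M.OutDart, M.face (M.next d.1) = M.out := fun d => by rw [M.face_next, d.2]
  have hcount := two_mul_sum_half_angles (α := α) hcover hconv hemb.2 (fun d => by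
    simp only [hα]
    rw [(htan d.1 d.2).2.arg_eq (hbis d.1 d.2), intAngle, M.sideNext_inl_of_out d.2]
    congr 2
    rw [sideVec]; simp) (fun d => by
    have h1 := hbis _ (hdn d)
    simp only [hα, outNext_coe]
    rw [(htan _ (hdn d)).2.arg_eq h1, ← h1.2.2, M.prev_next, intAngle, sideNext_inr]
    congr 2
    · rw [sideVec]; simp
    · rw [rot_apply, sideVec_inl_opp, sideVec]; simp)
  have htri : ∀ d : M.OutDart, Complex.arg (T (M.vtx (M.next d.1)) / T (M.vtx d.1)) =
      Real.pi - (α d + α (M.outNext d)) := by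
    intro d
    have h1 := sum_angles_triangle (hstar d.1 d.2)
    have h2 := (htan _ (hdn d)).2.2.2
    rw [M.prev_next, zero_sub] at h2
    rw [h2] at h1
    simp only [hα, outNext_coe, zero_sub]
    linarith
  have hsum : ∑ d : M.OutDart, Complex.arg (T (M.vtx (M.next d.1)) / T (M.vtx d.1)) =
      2 * Real.pi := by
    rw [Finset.sum_congr rfl fun d _ => htri d, Finset.sum_sub_distrib, Finset.sum_add_distrib,
      Equiv.sum_comp M.outNext α, Finset.sum_const, nsmul_eq_mul, Finset.card_univ]
    linarith
  refine ⟨fun d hd => ?_, ?_⟩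
  · rintro ⟨a, b, ha, hb, hab, h0⟩
    have h1 := hstar d hd
    have h2 : (conj (T (M.vtx d)) * (a • T (M.vtx d) + b • T (M.vtx (M.next d)))).im =
        b * (conj (T (M.vtx d)) * T (M.vtx (M.next d))).im := by
      simp only [Complex.real_smul, Complex.mul_im, Complex.mul_re, Complex.add_re,
        Complex.add_im, Complex.conj_re, Complex.conj_im, Complex.ofReal_re, Complex.ofReal_im]
      ring
    rw [h0, mul_zero, Complex.zero_im] at h2
    have hb0 : b = 0 := (mul_eq_zero.1 h2.symm).resolve_right h1.ne'
    have ha1 : a = 1 := by linarith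
    rw [ha1, hb0, one_smul, zero_smul, add_zero] at h0
    exact hstar.ne_zero hd h0
  · rw [div_eq_one_iff_eq (by positivity), ← hsum]
    convert (Finset.sum_subtype (p := fun d => M.face d = M.out)
      (univ.filter fun d : E × Bool => M.face d = M.out) (by simp)
      fun d => Complex.arg (T (M.vtx (M.next d)) / T (M.vtx d)))

end MarkedBipartiteMap

end

noncomputable section

namespace MarkedBipartiteMap

open Finset PlanarPolygon

variable {E : Type*} [Fintype E] {M : MarkedBipartiteMap E}
variable {χ K : E → ℝ} {Fb : M.Black → ℂ} {Fw : M.White → ℂ} {T O : M.DualVertex → ℂ}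

/-! ### Origami maps of perfect t-embeddings -/

/-- As `K` is real, conjugating the white gauge function preserves its equation, so the differential
is closed around all inner vertices of both colours. -/
theorem IsCoulombGauge.exists_origami (hF : M.IsCoulombGauge K Fb Fw) :
    ∃ O, M.IsOrigami K Fb Fw O := by
  classical
  refine M.exists_primitive (fun e => Fb (M.black e) * (K e : ℂ) * conj (Fw (M.white e)))
    (fun b hb => ?_) fun w hw => ?_
  · have h1 := congrArg conj (hF.2 b hb)
    rw [applyMatrix, map_sum, map_zero] at h1
    have h2 := congrArg (Fb b * ·) h1
    simp only [mul_zero, Finset.mul_sum] at h2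
    rw [← Finset.sum_filter]
    refine Eq.trans (Finset.sum_congr (by ext; simp) fun e he => ?_) h2
    rw [(Finset.mem_filter.1 he).2, map_mul, Complex.conj_ofReal]; ring
  · have h1 := hF.1 w hw
    rw [applyTranspose] at h1
    have h2 := congrArg (conj (Fw w) * ·) h1
    simp only [mul_zero, Finset.mul_sum] at h2
    rw [← Finset.sum_filter]
    refine Eq.trans (Finset.sum_congr (by ext; simp) fun e he => ?_) h2
    rw [(Finset.mem_filter.1 he).2]; ring

/-- In the application `F`, `G` are the gauge values at the ends of an edge and `A`, `B` the values
of `K Fw` and `Kᵀ Fb` there. The bisector condition becomes `h` after division by `F * G`; up to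
sign, the conclusions are the products of consecutive boundary increments of `O`, one of them
conjugated. -/
theorem neg_of_bisector {F G A B : ℂ} {k l : ℝ} (hF : F ≠ 0) (hG : G ≠ 0) (hk : k ≠ 0) (hl : 0 < l)
    (h : k ^ 2 * (F * G) = l * (A * B)) :
    ∃ ν : ℝ, 0 < ν ∧ conj (F * G) * (A * B) = ν ∧ F * G * conj (A * B) = ν := by
  have hl' : (l : ℂ) ≠ 0 := by exact_mod_cast hl.ne'
  have h1 : A * B = (k ^ 2 / l : ℝ) * (F * G) := by
    push_cast
    rw [div_mul_eq_mul_div, eq_div_iff hl', h]; ring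
  refine ⟨k ^ 2 / l * Complex.normSq (F * G), ?_, ?_, ?_⟩
  · have := Complex.normSq_pos.2 (mul_ne_zero hF hG)
    positivity
  · rw [h1, Complex.ofReal_mul, Complex.normSq_eq_conj_mul_self]; ring
  · rw [h1, map_mul, Complex.conj_ofReal, Complex.ofReal_mul, Complex.normSq_eq_conj_mul_self]; ring

theorem exists_pos_of_onBisector {p v q x : ℂ} (h : OnBisector p v q x) :
    ∃ l : ℝ, 0 < l ∧ (x - v) ^ 2 = l * ((p - v) * (q - v)) := by
  obtain ⟨hp, hq, hx⟩ := h.ne_zero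
  have h1 := (Complex.arg_eq_arg_iff (div_ne_zero hp hx) (div_ne_zero hx hq)).1 h.2.2
  refine ⟨‖(x - v) / (q - v)‖ / ‖(p - v) / (x - v)‖, div_pos
    (norm_pos_iff.2 (div_ne_zero hx hq)) (norm_pos_iff.2 (div_ne_zero hp hx)), ?_⟩
  push_cast
  generalize ((‖(x - v) / (q - v)‖ : ℂ) / ‖(p - v) / (x - v)‖) = l at *
  field_simp at h1
  linear_combination -h1

/-- The bisector condition forces the increments of the origami map along the outer boundary to be
collinear, with alternating directions. -/
theorem outer_origami_alternate (hcover : M.HasDimerCovers) (hK0 : ∀ e, K e ≠ 0)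
    (hnd : M.IsNondegenerate K Fb Fw) (hT : M.IsTRealisation K Fb Fw T)
    (hO : M.IsOrigami K Fb Fw O) (hbis : M.BisectorCondition T) {d : E × Bool}
    (hd : M.face d = M.out) :
    ∃ ν : ℝ, 0 < ν ∧ (O (M.vtx (M.next d)) - O (M.vtx d)) *
      conj (O (M.vtx d) - O (M.vtx (M.prev d))) = -ν := by
  have hp : M.face (M.prev d) = M.out := by rw [M.face_prev, hd]
  obtain ⟨l, hl, h1⟩ := exists_pos_of_onBisector (hbis d hd)
  rcases d with ⟨e, _ | _⟩
  · have hpe : M.prev (e, false) = (M.τ.symm e, true) := rfl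
    have hw : M.white (M.τ.symm e) = M.white e := by
      have := M.white_τ (M.τ.symm e)
      rwa [Equiv.apply_symm_apply, eq_comm] at this
    rw [hpe] at hp
    have q1 := hT.outer_black hcover hd
    have q2 := hO.outer_black hcover hd
    have q3 := hT.outer_white hcover hp
    have q4 := hO.outer_white hcover hp
    rw [← hpe, M.next_prev, hw] at q3 q4
    have q5 := hT e
    obtain ⟨ν, hν, -, h3⟩ := neg_of_bisector (F := Fb (M.black e)) (G := Fw (M.white e))
      (A := M.applyMatrix K Fw (M.black e)) (B := M.applyTranspose K Fb (M.white e))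
      (hnd.1 _) (hnd.2.2.1 _) (hK0 e) hl (by
        have q6 : T (M.vtx (M.prev (e, false))) - T (M.vtx (e, false)) =
          Fw (M.white e) * M.applyTranspose K Fb (M.white e) := by linear_combination -q3
        simp only [opp, Bool.not_false] at h1
        rw [q5, q6, q1] at h1
        refine mul_left_cancel₀ (mul_ne_zero (hnd.1 (M.black e)) (hnd.2.2.1 (M.white e))) ?_
        linear_combination h1)
    refine ⟨ν, hν, ?_⟩
    rw [q2, q4, ← h3]
    simp only [map_neg, map_mul, Complex.conj_conj]
    ring
  · have hpe : M.prev (e, true) = (M.σ.symm e, false) := rfl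
    have hb : M.black (M.σ.symm e) = M.black e := by
      have := M.black_σ (M.σ.symm e)
      rwa [Equiv.apply_symm_apply, eq_comm] at this
    rw [hpe] at hp
    have q1 := hT.outer_white hcover hd
    have q2 := hO.outer_white hcover hd
    have q3 := hT.outer_black hcover hp
    have q4 := hO.outer_black hcover hp
    rw [← hpe, M.next_prev, hb] at q3 q4
    have q5 := hT e
    obtain ⟨ν, hν, h3, -⟩ := neg_of_bisector (F := Fb (M.black e)) (G := Fw (M.white e))
      (A := M.applyMatrix K Fw (M.black e)) (B := M.applyTranspose K Fb (M.white e))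
      (hnd.1 _) (hnd.2.2.1 _) (hK0 e) hl (by
        have q6 : T (M.vtx (M.prev (e, true))) - T (M.vtx (e, true)) =
          -(Fb (M.black e) * M.applyMatrix K Fw (M.black e)) := by linear_combination -q3
        have q7 : T (M.vtx (e, false)) - T (M.vtx (e, true)) =
          -(Fb (M.black e) * K e * Fw (M.white e)) := by linear_combination -q5
        simp only [opp, Bool.not_true] at h1
        rw [q7, q6, q1] at h1
        refine mul_left_cancel₀ (mul_ne_zero (hnd.1 (M.black e)) (hnd.2.2.1 (M.white e))) ?_
        linear_combination h1)
    refine ⟨ν, hν, ?_⟩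
    rw [q2, q4, ← h3]
    simp only [map_mul, Complex.conj_conj]
    ring

theorem norm_outer_origami (hcover : M.HasDimerCovers) (hT : M.IsTRealisation K Fb Fw T)
    (hO : M.IsOrigami K Fb Fw O) {d : E × Bool} (hd : M.face d = M.out) :
    ‖O (M.vtx (M.next d)) - O (M.vtx d)‖ = ‖T (M.vtx (M.next d)) - T (M.vtx d)‖ := by
  rcases d with ⟨e, _ | _⟩
  · rw [hT.outer_black hcover hd, hO.outer_black hcover hd, norm_mul, norm_mul, Complex.norm_conj]
  · rw [hT.outer_white hcover hd, hO.outer_white hcover hd, norm_neg, norm_neg, norm_mul, norm_mul,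
      Complex.norm_conj]

/-- The sign of the colour of a half-edge. -/
def colourSign (d : E × Bool) : ℝ := if d.2 then 1 else -1

theorem colourSign_next (d : E × Bool) : colourSign (M.next d) = -colourSign d := by
  rcases d with ⟨e, _ | _⟩ <;> simp [colourSign, next]

theorem colourSign_sq {D : Type*} (d : D × Bool) : colourSign d ^ 2 = 1 := by
  rcases d with ⟨e, _ | _⟩ <;> simp [colourSign]

/-- After a rotation, the increments of the origami map along the outer boundary are real and have
alternating signs. -/
theorem exists_rotation (hcover : M.HasDimerCovers) (hK0 : ∀ e, K e ≠ 0)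
    (hnd : M.IsNondegenerate K Fb Fw) (hT : M.IsTRealisation K Fb Fw T)
    (hO : M.IsOrigami K Fb Fw O) (hbis : M.BisectorCondition T) :
    ∃ (u : ℂ) (ε : ℝ), ‖u‖ = 1 ∧ ε ^ 2 = 1 ∧ ∀ d, M.face d = M.out →
      u * (O (M.vtx (M.next d)) - O (M.vtx d)) =
        (ε * colourSign d * ‖T (M.vtx (M.next d)) - T (M.vtx d)‖ : ℝ) := by
  obtain ⟨e₀, he₀⟩ := M.face_false_surjective M.out
  set Q : E × Bool → ℂ := fun d => O (M.vtx (M.next d)) - O (M.vtx d) with hQ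
  have hQn : ∀ d, M.face d = M.out → ‖Q d‖ = ‖T (M.vtx (M.next d)) - T (M.vtx d)‖ := fun d hd =>
    norm_outer_origami hcover hT hO hd
  have hQ0 : ∀ d, M.face d = M.out → 0 < ‖Q d‖ := fun d hd => by
    rw [hQn d hd]; exact norm_pos_iff.2 (hnd.outer_ne_zero hcover hT hd)
  have halt : ∀ d, M.face d = M.out → ∃ μ : ℝ, 0 < μ ∧ Q (M.next d) = -μ * Q d := by
    intro d hd
    obtain ⟨ν, hν, h1⟩ := outer_origami_alternate hcover hK0 hnd hT hO hbis
      (d := M.next d) (by rw [M.face_next, hd])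
    rw [M.prev_next] at h1
    have h2 : Q (M.next d) * conj (Q d) = -ν := h1
    have hq := hQ0 d hd
    have hq' : (‖Q d‖ : ℂ) ≠ 0 := by exact_mod_cast hq.ne'
    refine ⟨ν / ‖Q d‖ ^ 2, by positivity, ?_⟩
    push_cast
    rw [neg_mul, div_mul_eq_mul_div, ← neg_div, eq_div_iff (pow_ne_zero 2 hq'),
      ← Complex.conj_mul']
    linear_combination Q d * h2
  -- This factor rotates the increment at a reference black half-edge to the positive axis.
  set u : ℂ := conj (Q (e₀, false)) / ‖Q (e₀, false)‖ with hu
  have hq₀ := hQ0 _ he₀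
  have hq₀' : (‖Q (e₀, false)‖ : ℂ) ≠ 0 := by exact_mod_cast hq₀.ne'
  have hu1 : ‖u‖ = 1 := by
    rw [hu, norm_div, Complex.norm_conj, Complex.norm_real, norm_norm, div_self hq₀.ne']
  have huQ : u * Q (e₀, false) = (‖Q (e₀, false)‖ : ℂ) := by
    rw [hu, div_mul_eq_mul_div, Complex.conj_mul', sq, mul_div_assoc, div_self hq₀', mul_one]
  have key : ∀ d, M.face d = M.out → ∃ r : ℝ, 0 < r ∧
      u * Q d = ((-colourSign d * r : ℝ) : ℂ) := by
    intro d hd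
    have h1 := M.eq_of_next_invariant (c := fun d => ∃ r : ℝ, 0 < r ∧
      u * Q d = ((-colourSign d * r : ℝ) : ℂ)) (d := (e₀, false)) (d' := d) (fun x hx => ?_)
      (he₀.trans hd.symm)
    · rw [← h1]
      refine ⟨‖Q (e₀, false)‖, hq₀, ?_⟩
      rw [huQ]; simp [colourSign]
    · obtain ⟨μ, hμ, h2⟩ := halt x (hx.trans he₀)
      have hμ' : (μ : ℂ) ≠ 0 := by exact_mod_cast hμ.ne'
      refine propext ⟨?_, ?_⟩
      · rintro ⟨r, hr, h3⟩
        refine ⟨r / μ, div_pos hr hμ, ?_⟩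
        rw [h2, colourSign_next] at h3
        push_cast at h3 ⊢
        rw [mul_div_assoc', eq_div_iff hμ']
        linear_combination -h3
      · rintro ⟨r, hr, h3⟩
        refine ⟨μ * r, mul_pos hμ hr, ?_⟩
        rw [h2, colourSign_next]
        push_cast at h3 ⊢
        linear_combination -μ * h3
  -- The reference half-edge is black, with colour sign -1, whence `ε = -1`.
  refine ⟨u, -1, hu1, by norm_num, fun d hd => ?_⟩
  obtain ⟨r, hr, h1⟩ := key d hd
  have h2 := congrArg norm h1
  have h3 : |colourSign d| = 1 := by
    rw [← sq_eq_sq₀ (abs_nonneg _) zero_le_one, sq_abs, colourSign_sq, one_pow]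
  rw [norm_mul, hu1, one_mul, Complex.norm_real, Real.norm_eq_abs, abs_mul, abs_neg, h3, one_mul,
    abs_of_pos hr, hQn d hd] at h2
  rw [h1, h2]
  congr 1; ring

/-- The tangent length multiplied by the colour sign satisfies the same recurrence along the
boundary as the rotated `O`. One translation makes them agree up to the global sign `ε`, and
Pythagoras concludes. -/
theorem exists_hyperboloid (hcover : M.HasDimerCovers) (hK0 : ∀ e, K e ≠ 0)
    (hnd : M.IsNondegenerate K Fb Fw) (hT : M.IsTRealisation K Fb Fw T)
    (hO : M.IsOrigami K Fb Fw O) (htan : M.IsTangential T) (hbis : M.BisectorCondition T) :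
    ∃ u t : ℂ, ‖u‖ = 1 ∧ M.BoundaryOnHyperboloid T fun x => u * O x + t := by
  obtain ⟨u, ε, hu, hε, h⟩ := exists_rotation hcover hK0 hnd hT hO hbis
  obtain ⟨e₀, he₀⟩ := M.face_false_surjective M.out
  refine ⟨u, (ε * colourSign (e₀, false) * tangentLength T (e₀, false) : ℝ) -
    u * O (M.vtx (e₀, false)), hu, ?_⟩
  set t : ℂ := (ε * colourSign (e₀, false) * tangentLength T (e₀, false) : ℝ) -
    u * O (M.vtx (e₀, false)) with ht
  have key : ∀ d, M.face d = M.out →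
      u * O (M.vtx d) + t = (ε * colourSign d * tangentLength T d : ℝ) := by
    intro d hd
    have h1 := M.eq_of_next_invariant (c := fun d => u * O (M.vtx d) + t =
      (ε * colourSign d * tangentLength T d : ℝ)) (d := (e₀, false)) (d' := d) (fun x hx => ?_)
      (he₀.trans hd.symm)
    · rw [← h1, ht]; ring
    · have h2 := h x (hx.trans he₀)
      have h3 := htan.tangentLength_next (hx.trans he₀)
      rw [h3, colourSign_next]
      push_cast at h2 ⊢
      refine propext ⟨fun h4 => ?_, fun h4 => ?_⟩
      · linear_combination h4 - h2
      · linear_combination h4 + h2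
  intro d hd
  simp only [key d hd]
  refine ⟨?_, Complex.ofReal_im _⟩
  rw [Complex.norm_real, Real.norm_eq_abs, sq_abs, mul_pow, mul_pow, hε, colourSign_sq, one_mul,
    one_mul]
  exact htan.norm_sq hd

/-! ### Rescaling of gauge functions -/

theorem IsTRealisation.rescale_iff {c : ℂ} (hc : c ≠ 0) :
    M.IsTRealisation K (fun b => c * Fb b) (fun w => c⁻¹ * Fw w) T ↔
      M.IsTRealisation K Fb Fw T := by
  refine forall_congr' fun e => ?_
  have : c * Fb (M.black e) * (K e : ℂ) * (c⁻¹ * Fw (M.white e)) =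
      Fb (M.black e) * K e * Fw (M.white e) := by field_simp
  rw [this]

theorem IsNondegenerate.rescale (hnd : M.IsNondegenerate K Fb Fw) {c : ℂ} (hc : c ≠ 0) :
    M.IsNondegenerate K (fun b => c * Fb b) (fun w => c⁻¹ * Fw w) := by
  refine ⟨fun b => mul_ne_zero hc (hnd.1 b), fun w hw => ?_,
    fun w => mul_ne_zero (inv_ne_zero hc) (hnd.2.2.1 w), fun b hb => ?_⟩
  · have : M.applyTranspose K (fun b => c * Fb b) w = c * M.applyTranspose K Fb w := by
      rw [applyTranspose, applyTranspose, Finset.mul_sum]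
      exact Finset.sum_congr rfl fun e _ => by ring
    rw [this]
    exact mul_ne_zero hc (hnd.2.1 w hw)
  · have : M.applyMatrix K (fun w => c⁻¹ * Fw w) b = c⁻¹ * M.applyMatrix K Fw b := by
      rw [applyMatrix, applyMatrix, Finset.mul_sum]
      exact Finset.sum_congr rfl fun e _ => by ring
    rw [this]
    exact mul_ne_zero (inv_ne_zero hc) (hnd.2.2.2 b hb)

/-- For `|c| = 1` the rescaling leaves `T` unchanged and multiplies the increments of `O` by `c *
conj c⁻¹ = c²`. So `c` is chosen as a square root of the rotation `u`. -/
theorem exists_boundary_of_isPerfectTEmbedding (hcover : M.HasDimerCovers) (hχ : ∀ e, 0 < χ e)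
    (hK : M.IsKasteleyn χ K) (hF : M.IsCoulombGauge K Fb Fw) (hnd : M.IsNondegenerate K Fb Fw)
    (hT : M.IsTRealisation K Fb Fw T) (h : M.IsPerfectTEmbedding χ T) :
    ∃ c : ℂ, c ≠ 0 ∧ ∃ O : M.DualVertex → ℂ,
      M.IsOrigami K (fun b => c * Fb b) (fun w => c⁻¹ * Fw w) O ∧
      M.BoundaryOnHyperboloid T O ∧ M.BoundaryOriented T ∧ M.BoundaryIndexOne T := by
  obtain ⟨hemb, -, htan, hbis⟩ := h
  have hK0 := hK.ne_zero hχ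
  obtain ⟨O, hO⟩ := hF.exists_origami
  obtain ⟨u, t, hu, hH⟩ := exists_hyperboloid hcover hK0 hnd hT hO htan hbis
  obtain ⟨c, hc⟩ := IsAlgClosed.exists_eq_mul_self u
  have hc1 : ‖c‖ = 1 := by
    rw [hc, norm_mul] at hu
    nlinarith [norm_nonneg c]
  have hc0 : c ≠ 0 := by
    intro h0
    rw [h0, norm_zero] at hc1
    exact zero_ne_one hc1
  have hconj : conj c⁻¹ = c := by
    rw [map_inv₀, inv_eq_iff_eq_inv, ← mul_eq_one_iff_eq_inv₀ hc0, Complex.conj_mul', hc1]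
    simp
  refine ⟨c, hc0, _, ?_, hH, boundaryOriented_of_bisector hbis, ?_⟩
  · intro e
    simp only [map_mul, hconj]
    linear_combination u * hO e + Fb (M.black e) * K e * conj (Fw (M.white e)) * hc
  · refine boundaryIndexOne_of_perfect hcover ?_ hemb htan hbis
    rintro (d | d)
    · exact hT.sideVec_inl_ne_zero hK0 hnd.1 hnd.2.2.1 d
    · exact hnd.outer_ne_zero hcover hT d.2

end MarkedBipartiteMap

end

theorem theorem4p1 {E : Type*} [Fintype E] (M : MarkedBipartiteMap E)
    (hcover : M.HasDimerCovers) (hspread : M.IsSpread)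
    (χ K : E → ℝ) (hχ : ∀ e, 0 < χ e) (hK : M.IsKasteleyn χ K)
    (Fb : M.Black → ℂ) (Fw : M.White → ℂ)
    (hF : M.IsCoulombGauge K Fb Fw) (hnd : M.IsNondegenerate K Fb Fw) :
    ((∃ T : M.DualVertex → ℂ, M.IsTRealisation K Fb Fw T ∧ M.IsPerfectTEmbedding χ T) ↔
      ∃ c : ℂ, c ≠ 0 ∧ ∃ T O : M.DualVertex → ℂ,
        M.IsTRealisation K (fun b => c * Fb b) (fun w => c⁻¹ * Fw w) T ∧
        M.IsOrigami K (fun b => c * Fb b) (fun w => c⁻¹ * Fw w) O ∧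
        M.BoundaryOnHyperboloid T O ∧ M.BoundaryOriented T ∧ M.BoundaryIndexOne T) ∧
    (∀ c : ℂ, c ≠ 0 → ∀ T O : M.DualVertex → ℂ,
      M.IsTRealisation K (fun b => c * Fb b) (fun w => c⁻¹ * Fw w) T →
      M.IsOrigami K (fun b => c * Fb b) (fun w => c⁻¹ * Fw w) O →
      M.BoundaryOnHyperboloid T O → M.BoundaryOriented T → M.BoundaryIndexOne T →
      M.IsPerfectTEmbedding χ T) := by
  have hB : ∀ c : ℂ, c ≠ 0 → ∀ T O : M.DualVertex → ℂ,
      M.IsTRealisation K (fun b => c * Fb b) (fun w => c⁻¹ * Fw w) T →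
      M.IsOrigami K (fun b => c * Fb b) (fun w => c⁻¹ * Fw w) O →
      M.BoundaryOnHyperboloid T O → M.BoundaryOriented T → M.BoundaryIndexOne T →
      M.IsPerfectTEmbedding χ T := fun c hc T O hT hO hH hor hidx =>
    MarkedBipartiteMap.isPerfectTEmbedding_of_boundary hcover hspread hχ hK (hnd.rescale hc) hT hO
      hH hor hidx
  refine ⟨⟨?_, ?_⟩, hB⟩
  · rintro ⟨T, hT, h⟩
    obtain ⟨c, hc, O, hO, hH, hor, hidx⟩ :=
      MarkedBipartiteMap.exists_boundary_of_isPerfectTEmbedding hcover hχ hK hF hnd hT h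
    exact ⟨c, hc, T, O, (MarkedBipartiteMap.IsTRealisation.rescale_iff hc).2 hT, hO, hH, hor, hidx⟩
  · rintro ⟨c, hc, T, O, hT, hO, hH, hor, hidx⟩
    exact ⟨T, (MarkedBipartiteMap.IsTRealisation.rescale_iff hc).1 hT,
      hB c hc T O hT hO hH hor hidx⟩
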